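/- Let $(M,\boldsymbol g)$ be a smooth Lorentzian surface (signature $(1,1)$; a vector $X$ is spacelike if $\boldsymbol g(X,X)<0$). For a local orthonormal frame $\mathsf v_1,\mathsf v_2$ on an open set $U\subset M$, with $\boldsymbol g(\mathsf v_1,\mathsf v_1)=1=-\boldsymbol g(\mathsf v_2,\mathsf v_2)$, let $\eta^1,\eta^2$ be the dual coframe, and let the connection form $\eta^1_2$ and the Gauss curvature $K$ be defined by $$d\eta^1=-\eta^1_2\wedge\eta^2,\qquad d\eta^2=-\eta^1_2\wedge\eta^1,\qquad d\eta^1_2=-K\,\eta^1\wedge\eta^2 .$$ Let $\mathcal F$ be the bundle of oriented orthonormal frames $(\mathsf e_1,\mathsf e_2,\mathsf e_3)$ of Minkowski space $\mathbb R^{1,2}$, with $\langle \mathsf e_1,\mathsf e_1\rangle=1$, $\langle \mathsf e_2,\mathsf e_2\rangle=\langle \mathsf e_3,\mathsf e_3\rangle=-1$, with base point map $\boldsymbol\rho$ and with the forms $\omega^i,\omega^i_j$ given by $d\boldsymbol\rho=\mathsf e_i\omega^i$, $d\mathsf e_j=\mathsf e_i\omega^i_j$. The isometric embedding system of $\boldsymbol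 g$ into $\mathbb R^{1,2}$ is, locally, the exterior differential system $\mathcal I$ on the 8-manifold $U\times\mathcal F$ generated by $$\omega^3,\quad \omega^1-\eta^1,\quad \omega^2-\eta^2,\quad \omega^1_2-\eta^1_2 .$$ The metric $\boldsymbol g$ is *hyperbolic* if $K<0$ on $M$. It is *Darboux integrable* if near each point of $M$ and for some (equivalently, any) local orthonormal frame the system $\mathcal I$ is Darboux integrable in the following sense. Locally there are a coframe $\theta^i,\hat\sigma^a,\check\sigma^\alpha$ (the $\theta^i$ being the four generators, with at least two $\hat\sigma$'s and at least two $\check\sigma$'s) and 2-forms $\hat\Omega^b\in\Lambda^2(\hat\sigma)$, $\check\Omega^\beta\in\Lambda^2(\check\sigma)$ (at least one of each kind) such that $\mathcal I$ is algebraically generated by the $\theta^i,\hat\Omega^b,\check\Omega^\beta$; the singular systems $\{\theta,\hat\sigma,\check\Omega\}$ and $\{\theta,\check\sigma,\hat\Omega\}$ are Pfaffian (that is, generated as differential systems by their 1-forms); and the bundles $\hat V=\mathrm{span}\{\theta,\hat\sigma\}$, $\check V=\mathrm{span}\{\theta,\check\sigma\}$ form a Darboux pair: with $V^\infty$ denoting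 the final element of the derived flag of $V$, $$\hat V+\check V^\infty=\check V+\hat V^\infty=T^*,\qquad \hat V^\infty\cap\check V^\infty=0,\qquad d\omega\in\Lambda^2\hat V+\Lambda^2\check V\ \text{ for all sections }\omega\text{ of }\hat V\cap\check V .$$ **Theorem.** Let $\boldsymbol g$ be a hyperbolic Darboux integrable Lorentzian metric on $M$ that admits a smooth Killing field which is spacelike at every point. Then, up to a constant scale factor, $\boldsymbol g$ is locally equivalent to $\cos^4u\,(du)^2-\sin^2u\,(dv)^2$, for which $K=-\sec^4u$. Precisely: there is a locally constant function $c:M\to(0,\infty)$ (a constant, if $M$ is connected) such that near every point $p\in M$ there are local coordinates $(u,v)$ with $0<u<\pi/2$ in which, with $c=c(p)$, $$\boldsymbol g=c\,\bigl(\cos^4u\,(du)^2-\sin^2u\,(dv)^2\bigr),\qquad K=-c^{-1}\sec^4u .$$ -/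

import Mathlib

open scoped Manifold ContDiff

noncomputable section

/-! ### Differential forms and Pfaffian systems on a submanifold of a vector space

The submanifold is a level set `S = {x ∈ O | F x = 0}` of a smooth map `F : E → G` of constant rank
on the open set `O ⊆ E`; its tangent space at `x` is the kernel of the differential of `F` at `x`.
Differential forms on `S` are the restrictions to the tangent spaces of `S` of smooth forms on `O`,
and the exterior derivative commutes with this restriction. -/

namespace EDS

variable {E G : Type*} [NormedAddCommGroup E] [NormedSpace ℝ E]
  [NormedAddCommGroup G] [NormedSpace ℝ G]

/-- A (not necessarily smooth) differential 1-form on `E`. -/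
abbrev OneForm (E : Type*) [NormedAddCommGroup E] [NormedSpace ℝ E] := E → E →L[ℝ] ℝ

/-- A differential 2-form on `E`, as a function of a point and two tangent vectors. -/
abbrev TwoForm (E : Type*) := E → E → E → ℝ

/-- The exterior derivative of a 1-form: `dζ(v, w) = (D_v ζ)(w) - (D_w ζ)(v)`. -/
def dForm (ζ : OneForm E) : TwoForm E :=
  fun x v w => fderiv ℝ ζ x v w - fderiv ℝ ζ x w v

/-- `dForm` agrees with Mathlib's exterior derivative. -/
theorem dForm_eq_extDeriv (ζ : OneForm E) (x : E) (hζ : DifferentiableAt ℝ ζ x) (v w : E) :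
    extDeriv (fun y => ContinuousAlternatingMap.ofSubsingleton ℝ E ℝ (0 : Fin 1) (ζ y)) x ![v, w]
      = dForm ζ x v w := by
  have h : DifferentiableAt ℝ
      (fun y => ContinuousAlternatingMap.ofSubsingleton ℝ E ℝ (0 : Fin 1) (ζ y)) x :=
    (ContinuousAlternatingMap.ofSubsingletonLIE (𝕜 := ℝ) (E := E) (F := ℝ)
      (0 : Fin 1)).toContinuousLinearEquiv.differentiableAt.comp x hζ
  have h1 (u : E) : fderiv ℝ (fun y => ζ y u) x = (fderiv ℝ ζ x).flip u := by
    ext z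
    simp [fderiv_clm_apply hζ (differentiableAt_const u)]
  rw [extDeriv_apply h]
  simp [Fin.sum_univ_two, dForm, Fin.removeNth, h1, sub_eq_add_neg]

/-- The points of the submanifold. -/
def levelSet (F : E → G) (O : Set E) : Set E := {x ∈ O | F x = 0}

/-- The tangent space of the submanifold at `x`. -/
def tangent (F : E → G) (x : E) : Submodule ℝ E := LinearMap.ker (fderiv ℝ F x).toLinearMap

/-- The restriction of a 1-form to the tangent space at `x`. -/
def res (F : E → G) (ζ : OneForm E) (x : E) : Module.Dual ℝ (tangent F x) :=
  (ζ x).toLinearMap.domRestrict (tangent F x)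

/-- The span, in the cotangent space of the submanifold at `x`, of the values of the 1-forms
in `Φ`.  As `x` varies this is the bundle spanned by `Φ`. -/
def coSpan (F : E → G) (Φ : Set (OneForm E)) (x : E) :
    Submodule ℝ (Module.Dual ℝ (tangent F x)) :=
  Submodule.span ℝ ((fun ζ => res F ζ x) '' Φ)

/-- The tangent vectors at `x` on which all 1-forms in `Φ` vanish. -/
def ann (F : E → G) (Φ : Set (OneForm E)) (x : E) : Submodule ℝ (tangent F x) :=
  (coSpan F Φ x).dualCoannihilator

/-- The smooth sections of the bundle spanned by `Φ`. -/
def sections (F : E → G) (O : Set E) (Φ : Set (OneForm E)) : Set (OneForm E) :=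
  {ζ | ContDiffOn ℝ ∞ ζ O ∧ ∀ x ∈ levelSet F O, res F ζ x ∈ coSpan F Φ x}

/-- The derived system `Γ' = {ζ ∈ Γ | dζ ≡ 0 mod Γ}`.  A 2-form is in the ideal generated by the
covectors of `Γ` at `x` exactly when it vanishes on the vectors annihilated by `Γ`. -/
def derivedSystem (F : E → G) (O : Set E) (Γ : Set (OneForm E)) : Set (OneForm E) :=
  {ζ ∈ Γ | ∀ x ∈ levelSet F O, ∀ v ∈ ann F Γ x, ∀ w ∈ ann F Γ x, dForm ζ x v w = 0}

/-- The derived flag of the bundle spanned by `Φ`. -/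
def derivedFlag (F : E → G) (O : Set E) (Φ : Set (OneForm E)) : ℕ → Set (OneForm E)
  | 0 => sections F O Φ
  | n + 1 => derivedSystem F O (derivedFlag F O Φ n)

/-- The final element `V^∞` of the derived flag. -/
def terminal (F : E → G) (O : Set E) (Φ : Set (OneForm E)) : Set (OneForm E) :=
  ⋂ n, derivedFlag F O Φ n

/-- The second exterior power `Λ²W` of a space `W` of covectors, inside the bilinear functions. -/
def lambda2 {T : Type*} [AddCommGroup T] [Module ℝ T] (W : Submodule ℝ (Module.Dual ℝ T)) :
    Submodule ℝ (T → T → ℝ) :=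
  Submodule.span ℝ {η | ∃ α ∈ W, ∃ β ∈ W, η = fun v w => α v * β w - α w * β v}

/-- The span at `x` of the 2-forms in `A`, modulo the algebraic ideal generated by `Φ`. -/
def modSpan (F : E → G) (Φ : Set (OneForm E)) (A : Set (TwoForm E)) (x : E) :
    Submodule ℝ (ann F Φ x → ann F Φ x → ℝ) :=
  Submodule.span ℝ ((fun Ω => fun v w : ann F Φ x => Ω x v w) '' A)

/-- The 2-form `∑ C i j σ i ∧ σ j` with coefficient functions `C i j`. -/
def quadForm {p : ℕ} (σ : Fin p → OneForm E) (C : Fin p → Fin p → E → ℝ) : TwoForm E :=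
  fun x v w => ∑ i, ∑ j, C i j x * (σ i x v * σ j x w - σ i x w * σ j x v)

/-- The bundles spanned by `Vh` and `Vc` form a Darboux pair. -/
structure IsDarbouxPair (F : E → G) (O : Set E) (Vh Vc : Set (OneForm E)) : Prop where
  sup_left : ∀ x ∈ levelSet F O, coSpan F Vh x ⊔ coSpan F (terminal F O Vc) x = ⊤
  sup_right : ∀ x ∈ levelSet F O, coSpan F Vc x ⊔ coSpan F (terminal F O Vh) x = ⊤
  inf_eq_bot : ∀ x ∈ levelSet F O,
    coSpan F (terminal F O Vh) x ⊓ coSpan F (terminal F O Vc) x = ⊥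
  d_mem : ∀ ζ : OneForm E, ContDiffOn ℝ ∞ ζ O →
    (∀ x ∈ levelSet F O, res F ζ x ∈ coSpan F Vh x ⊓ coSpan F Vc x) →
    ∀ x ∈ levelSet F O, (fun v w : tangent F x => dForm ζ x v w) ∈
      lambda2 (coSpan F Vh x) ⊔ lambda2 (coSpan F Vc x)

/-- The exterior differential system generated (differentially) by the 1-forms `θ i` is decomposable
of type `[p, q]`: `θ, σh, σc` is a coframe, and the system is generated algebraically by the `θ i`
and by the 2-forms `Ωh b = quadForm σh (Ch b)` and `Ωc b = quadForm σc (Cc b)`. -/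
structure IsDecomposition (F : E → G) (O : Set E) {r p q s t : ℕ} (θ : Fin r → OneForm E)
    (σh : Fin p → OneForm E) (σc : Fin q → OneForm E)
    (Ch : Fin s → Fin p → Fin p → E → ℝ) (Cc : Fin t → Fin q → Fin q → E → ℝ) : Prop where
  two_le_p : 2 ≤ p
  two_le_q : 2 ≤ q
  one_le_s : 1 ≤ s
  one_le_t : 1 ≤ t
  smooth_θ : ∀ i, ContDiffOn ℝ ∞ (θ i) O
  smooth_σh : ∀ i, ContDiffOn ℝ ∞ (σh i) O
  smooth_σc : ∀ i, ContDiffOn ℝ ∞ (σc i) O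
  smooth_Ch : ∀ b i j, ContDiffOn ℝ ∞ (Ch b i j) O
  smooth_Cc : ∀ b i j, ContDiffOn ℝ ∞ (Cc b i j) O
  linearIndependent : ∀ x ∈ levelSet F O,
    LinearIndependent ℝ (fun i => res F (Sum.elim θ (Sum.elim σh σc) i) x)
  span_eq_top : ∀ x ∈ levelSet F O,
    coSpan F (Set.range (Sum.elim θ (Sum.elim σh σc))) x = ⊤
  generated : ∀ x ∈ levelSet F O,
    modSpan F (Set.range θ) (Set.range fun i => dForm (θ i)) x =
      modSpan F (Set.range θ)
        (Set.range (fun b => quadForm σh (Ch b)) ∪ Set.range (fun b => quadForm σc (Cc b))) x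

/-- The system generated algebraically by the 1-forms in `V` and the 2-forms in `A` is Pfaffian:
modulo `V`, the 2-forms in `A` and the exterior derivatives of the forms in `V` have equal span. -/
def IsPfaffian (F : E → G) (O : Set E) (V : Set (OneForm E)) (A : Set (TwoForm E)) : Prop :=
  ∀ x ∈ levelSet F O, modSpan F V A x = modSpan F V (dForm '' V) x

/-- The Pfaffian system generated by the 1-forms `θ i` on the submanifold is Darboux integrable:
about each point it is decomposable, with singular systems `{θ, σh, Ωc}` and `{θ, σc, Ωh}` that are
Pfaffian and whose 1-forms make up a Darboux pair. -/
def IsDarbouxIntegrable (F : E → G) (O : Set E) {r : ℕ} (θ : Fin r → OneForm E) : Prop :=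
  ∀ x ∈ levelSet F O, ∃ O' : Set E, IsOpen O' ∧ x ∈ O' ∧ O' ⊆ O ∧
    ∃ (p q s t : ℕ) (σh : Fin p → OneForm E) (σc : Fin q → OneForm E)
      (Ch : Fin s → Fin p → Fin p → E → ℝ) (Cc : Fin t → Fin q → Fin q → E → ℝ),
      IsDecomposition F O' θ σh σc Ch Cc ∧
      IsPfaffian F O' (Set.range θ ∪ Set.range σh) (Set.range fun b => quadForm σc (Cc b)) ∧
      IsPfaffian F O' (Set.range θ ∪ Set.range σc) (Set.range fun b => quadForm σh (Ch b)) ∧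
      IsDarbouxPair F O' (Set.range θ ∪ Set.range σh) (Set.range θ ∪ Set.range σc)

end EDS

/-! ### The orthonormal frame bundle of Minkowski space `ℝ^{1,2}` -/

namespace Minkowski

/-- `⟨v, ·⟩` for the inner product `⟨v, w⟩ = v₀w₀ - v₁w₁ - v₂w₂` of signature `(1, 2)`. -/
def form (v : Fin 3 → ℝ) : (Fin 3 → ℝ) →L[ℝ] ℝ :=
  v 0 • ContinuousLinearMap.proj 0 - v 1 • ContinuousLinearMap.proj 1
    - v 2 • ContinuousLinearMap.proj 2

/-- `⟨e_i, e_i⟩` for an orthonormal frame: `1, -1, -1`. -/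
def sgn (i : Fin 3) : ℝ := if i = 0 then 1 else -1

/-- The ambient space of `U × F(ℝ^{1,2})`: triples `(x, ρ, e)` of a point of the coordinate plane,
a base point in `ℝ^{1,2}` and three vectors `e 0, e 1, e 2` in `ℝ^{1,2}`. -/
abbrev Ambient := EuclideanSpace ℝ (Fin 2) × (Fin 3 → ℝ) × (Fin 3 → Fin 3 → ℝ)

/-- The defining function of orthonormality: `⟨e_i, e_j⟩ - sgn i δ_{ij}`. -/
def frameDefect (z : Ambient) : Fin 3 → Fin 3 → ℝ :=
  fun i j => form (z.2.2 i) (z.2.2 j) - if i = j then sgn i else 0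

/-- Points over `U` with a positively oriented triple of vectors. -/
def region (U : Set (EuclideanSpace ℝ (Fin 2))) : Set Ambient :=
  {z | z.1 ∈ U ∧ 0 < (Matrix.of z.2.2).det}

/-- The canonical form `ω^i`, defined by `dρ = ∑ e_i ω^i`. -/
def canonicalForm (i : Fin 3) : EDS.OneForm Ambient := fun z =>
  sgn i • (form (z.2.2 i)).comp
    ((ContinuousLinearMap.fst ℝ (Fin 3 → ℝ) (Fin 3 → Fin 3 → ℝ)).comp
      (ContinuousLinearMap.snd ℝ (EuclideanSpace ℝ (Fin 2)) _))

/-- The connection form `ω^i_j`, defined by `de_j = ∑ e_i ω^i_j`. -/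
def connectionForm (i j : Fin 3) : EDS.OneForm Ambient := fun z =>
  sgn i • (form (z.2.2 i)).comp
    ((ContinuousLinearMap.proj j).comp
      ((ContinuousLinearMap.snd ℝ (Fin 3 → ℝ) (Fin 3 → Fin 3 → ℝ)).comp
        (ContinuousLinearMap.snd ℝ (EuclideanSpace ℝ (Fin 2)) _)))

end Minkowski

/-! ### Lorentzian metrics in coordinates -/

namespace Lorentz

/-- The coordinate plane. -/
abbrev Plane := EuclideanSpace ℝ (Fin 2)

/-- `f 0` (timelike), `f 1` (spacelike) is a smooth orthonormal frame on `U` for the metric with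
components `γ`. -/
structure IsOrthonormalFrame (γ : Plane → Plane →L[ℝ] Plane →L[ℝ] ℝ) (U : Set Plane)
    (f : Fin 2 → Plane → Plane) : Prop where
  smooth : ∀ i, ContDiffOn ℝ ∞ (f i) U
  zero_zero : ∀ x ∈ U, γ x (f 0 x) (f 0 x) = 1
  one_one : ∀ x ∈ U, γ x (f 1 x) (f 1 x) = -1
  zero_one : ∀ x ∈ U, γ x (f 0 x) (f 1 x) = 0

/-- The coframe `η^1, η^2` (here `η 0, η 1`) dual to an orthonormal frame. -/
def dualForm (γ : Plane → Plane →L[ℝ] Plane →L[ℝ] ℝ) (f : Fin 2 → Plane → Plane) (i : Fin 2) :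
    EDS.OneForm Plane :=
  fun x => if i = 0 then γ x (f 0 x) else -γ x (f 1 x)

/-- The connection form `η^1_2 = η^2_1`: the only 1-form with `dη^1 = -η^1_2 ∧ η^2` and
`dη^2 = -η^1_2 ∧ η^1`. -/
def connForm (γ : Plane → Plane →L[ℝ] Plane →L[ℝ] ℝ) (f : Fin 2 → Plane → Plane) :
    EDS.OneForm Plane :=
  fun x => -(EDS.dForm (dualForm γ f 0) x (f 0 x) (f 1 x)) • dualForm γ f 0 x
    + (EDS.dForm (dualForm γ f 1) x (f 0 x) (f 1 x)) • dualForm γ f 1 x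

/-- The Gauss curvature computed in an orthonormal frame: `dη^1_2 = -K η^1 ∧ η^2`. -/
def frameCurvature (γ : Plane → Plane →L[ℝ] Plane →L[ℝ] ℝ) (f : Fin 2 → Plane → Plane)
    (x : Plane) : ℝ :=
  -EDS.dForm (connForm γ f) x (f 0 x) (f 1 x)

/-- Pullback of a 1-form on the coordinate plane to the ambient space. -/
def pull (η : EDS.OneForm Plane) : EDS.OneForm Minkowski.Ambient :=
  fun z => (η z.1).comp (ContinuousLinearMap.fst ℝ Plane _)

/-- The generators `ω^3, ω^1 - η^1, ω^2 - η^2, ω^1_2 - η^1_2` of the isometric embedding system into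
`ℝ^{1,2}`, on the product of the domain of an orthonormal frame `f` with `F(ℝ^{1,2})`. -/
def embeddingSystem (γ : Plane → Plane →L[ℝ] Plane →L[ℝ] ℝ) (f : Fin 2 → Plane → Plane) :
    Fin 4 → EDS.OneForm Minkowski.Ambient :=
  ![Minkowski.canonicalForm 2,
    Minkowski.canonicalForm 0 - pull (dualForm γ f 0),
    Minkowski.canonicalForm 1 - pull (dualForm γ f 1),
    Minkowski.connectionForm 0 1 - pull (connForm γ f)]

end Lorentz

/-! ### Lorentzian surfaces -/

open Lorentz

/-- A smooth Lorentzian metric, of signature `(1, 1)`, on a surface `M`. -/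
structure LorentzianMetric (M : Type*) [TopologicalSpace M] [ChartedSpace Plane M]
    [IsManifold (𝓡 2) ∞ M] where
  val : ∀ p : M, TangentSpace (𝓡 2) p →L[ℝ] TangentSpace (𝓡 2) p →L[ℝ] ℝ
  symm : ∀ p v w, val p v w = val p w v
  exists_timelike : ∀ p, ∃ v, 0 < val p v v
  exists_spacelike : ∀ p, ∃ v, val p v v < 0
  contMDiff : ContMDiff (𝓡 2) ((𝓡 2).prod 𝓘(ℝ, Plane →L[ℝ] Plane →L[ℝ] ℝ)) ∞
    (fun p => Bundle.TotalSpace.mk' (Plane →L[ℝ] Plane →L[ℝ] ℝ)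
      (E := fun p : M => TangentSpace (𝓡 2) p →L[ℝ] TangentSpace (𝓡 2) p →L[ℝ] ℝ) p (val p))

namespace LorentzianMetric

variable {M : Type*} [TopologicalSpace M] [ChartedSpace Plane M] [IsManifold (𝓡 2) ∞ M]

/-- The components of the metric in a chart `φ`, as a function on `φ.target`. -/
def inChart (g : LorentzianMetric M) (φ : OpenPartialHomeomorph M Plane) :
    Plane → Plane →L[ℝ] Plane →L[ℝ] ℝ :=
  fun x =>
    let B : Plane →L[ℝ] Plane →L[ℝ] ℝ := g.val (φ.symm x)
    let L : Plane →L[ℝ] Plane := mfderiv (𝓡 2) (𝓡 2) φ.symm x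
    B.bilinearComp L L

/-- The components of a vector field in a chart `φ`, as a function on `φ.target`. -/
def fieldInChart (V : ∀ p : M, TangentSpace (𝓡 2) p) (φ : OpenPartialHomeomorph M Plane) :
    Plane → Plane :=
  fun x => mfderiv (𝓡 2) (𝓡 2) φ (φ.symm x) (V (φ.symm x))

/-- `κ` is the Gauss curvature of `g` at `p` (computed in any chart and any orthonormal frame). -/
def HasGaussCurvatureAt (g : LorentzianMetric M) (p : M) (κ : ℝ) : Prop :=
  ∀ φ ∈ IsManifold.maximalAtlas (𝓡 2) ∞ M, p ∈ φ.source →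
    ∀ (U : Set Plane) (f : Fin 2 → Plane → Plane), IsOpen U → φ p ∈ U → U ⊆ φ.target →
      IsOrthonormalFrame (g.inChart φ) U f → frameCurvature (g.inChart φ) f (φ p) = κ

/-- The isometric embedding system is hyperbolic: the Gauss curvature is negative everywhere. -/
def IsHyperbolic (g : LorentzianMetric M) : Prop :=
  ∀ p, ∃ κ < 0, g.HasGaussCurvatureAt p κ

/-- The isometric embedding system of `(M, g)` into `ℝ^{1,2}` is Darboux integrable (near each point,
in a chart and for an orthonormal frame; the choices do not matter). -/
def IsDarbouxIntegrable (g : LorentzianMetric M) : Prop :=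
  ∀ p, ∃ φ ∈ IsManifold.maximalAtlas (𝓡 2) ∞ M, p ∈ φ.source ∧
    ∃ (U : Set Plane) (f : Fin 2 → Plane → Plane), IsOpen U ∧ φ p ∈ U ∧ U ⊆ φ.target ∧
      IsOrthonormalFrame (g.inChart φ) U f ∧
      EDS.IsDarbouxIntegrable Minkowski.frameDefect (Minkowski.region U)
        (embeddingSystem (g.inChart φ) f)

/-- `V` is a smooth Killing field: its components `v` in any chart satisfy `L_v γ = 0`. -/
structure IsKillingField (g : LorentzianMetric M) (V : ∀ p : M, TangentSpace (𝓡 2) p) : Prop where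
  contMDiff : ContMDiff (𝓡 2) (𝓡 2).tangent ∞
    (fun p => (Bundle.TotalSpace.mk' Plane p (V p) : TangentBundle (𝓡 2) M))
  lieDeriv_eq_zero : ∀ φ ∈ IsManifold.maximalAtlas (𝓡 2) ∞ M, ∀ x ∈ φ.target, ∀ a b : Plane,
    fderiv ℝ (g.inChart φ) x (fieldInChart V φ x) a b
      + g.inChart φ x (fderiv ℝ (fieldInChart V φ) x a) b
      + g.inChart φ x a (fderiv ℝ (fieldInChart V φ) x b) = 0

end LorentzianMetric

end

open scoped Manifold ContDiff

noncomputable section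

/-! ### The tangent spaces of the manifold of orthonormal frames. -/

namespace Minkowski

open EDS

/-! A tangent vector annihilated by the four generators is given by a vector `a` of the surface and
the values of ω³₁ and ω³₂. Write K = -k². On such vectors suitable combinations of dω³ and d(ω¹₂ -
η¹₂) are decomposable: they are (ω³₁ ∓ k η²) ∧ (ω³₂ ± k η¹). The factors cut out two distributions
C_κ, given by ω³₁ = κ η², ω³₂ = -κ η¹, with κ = ±k. By the Plücker relation, every decomposition of
the system has these two as the annihilators of its singular systems (`splitting_of_decomposable`,
`characteristic_of_isDecomposition`).

Every Lie bracket of fields in C_κ, iterated any number of times, is annihilated by the final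
derived system of the forms that vanish on C_κ (`EDS.apply_bracket_eq_zero`). The Darboux pair
condition V̂ + V̌^∞ = T* therefore says that these brackets never produce a nonzero vector of
C_{-κ}.

A spacelike Killing field X, of length G, commutes with its unit normal n, and all functions that
matter are constant along X. Write ′ for the derivative along n. The Gauss equation is G″ = k²G
(`IsKillingFrame.gauss`). In a moving frame adapted to n and X, brackets of fields become an
algebraic operation on 8-tuples of functions and their derivatives (`bracket_gauge`). A few brackets
of the lifts of n and X to C_κ give two identities. Eliminating κ″ between them leaves a nonzero
multiple of (2κ³G - κ′G′)² = 0. Hence G′κ′ = 2κ³G (`along_mul_along_of_characteristic`).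

With k > 0 this equation and G″ = k²G have the first integrals A = k / G′² and C = (1 + k²G²/G′²) /
G′². Put tan u = ±A G G′, and v = w/√C, where dw is the closed form dual to X. Then cos²u = 1/(C
G′²), sin²u = A²G²/C and du = ±A G′² times the form dual to n, so the metric is c (cos⁴u du² - sin²u
dv²) with c = C²/A² (`exists_normal_coordinates`).

Finally c = (1 - K G²/G′²)² / (-K) involves only the curvature and the Killing field, not the chart.
So the constants found near different points agree on overlaps, and c is locally constant
(`LorentzianMetric.normalScale`). -/

@[simp] theorem form_apply (v w : Fin 3 → ℝ) :
    form v w = v 0 * w 0 - v 1 * w 1 - v 2 * w 2 := by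
  simp [form]

/-- The Minkowski inner product as a bounded bilinear map. -/
def formBilin : (Fin 3 → ℝ) →L[ℝ] (Fin 3 → ℝ) →L[ℝ] ℝ :=
  LinearMap.toContinuousLinearMap
    { toFun := form
      map_add' := fun v w => by ext; simp; ring
      map_smul' := fun c w => by ext; simp; ring }

/-- The `i`-th frame vector, as a linear map on the ambient space. -/
def frameVec (i : Fin 3) : Ambient →L[ℝ] (Fin 3 → ℝ) :=
  (ContinuousLinearMap.proj i).comp
    ((ContinuousLinearMap.snd ℝ (Fin 3 → ℝ) (Fin 3 → Fin 3 → ℝ)).comp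
      (ContinuousLinearMap.snd ℝ (EuclideanSpace ℝ (Fin 2)) _))

/-- The base point, as a linear map on the ambient space. -/
def basePoint : Ambient →L[ℝ] (Fin 3 → ℝ) :=
  (ContinuousLinearMap.fst ℝ (Fin 3 → ℝ) (Fin 3 → Fin 3 → ℝ)).comp
      (ContinuousLinearMap.snd ℝ (EuclideanSpace ℝ (Fin 2)) _)

theorem fderiv_frameDefect (z v : Ambient) (i j : Fin 3) :
    fderiv ℝ frameDefect z v i j =
      form (v.2.2 i) (z.2.2 j) + form (z.2.2 i) (v.2.2 j) := by
  have h (i j : Fin 3) : HasFDerivAt (fun z => frameDefect z i j)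
      (formBilin.precompR Ambient (frameVec i z) (frameVec j) +
        formBilin.precompL Ambient (frameVec i) (frameVec j z)) z :=
    (formBilin.hasFDerivAt_of_bilinear (frameVec i).hasFDerivAt
      (frameVec j).hasFDerivAt).sub_const _
  have h2 : HasFDerivAt frameDefect (ContinuousLinearMap.pi fun i => ContinuousLinearMap.pi fun j =>
      (formBilin.precompR Ambient (frameVec i z) (frameVec j) +
        formBilin.precompL Ambient (frameVec i) (frameVec j z))) z :=
    hasFDerivAt_pi.2 fun i => hasFDerivAt_pi.2 fun j => h i j
  rw [h2.fderiv]
  exact add_comm _ _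

theorem mem_tangent_iff {z v : Ambient} : v ∈ tangent frameDefect z ↔
    ∀ i j, form (v.2.2 i) (z.2.2 j) + form (z.2.2 i) (v.2.2 j) = 0 := by
  rw [tangent, LinearMap.mem_ker, funext_iff]
  simp only [funext_iff, ContinuousLinearMap.coe_coe, fderiv_frameDefect, Pi.zero_apply]

@[simp] theorem sgn_zero : sgn 0 = 1 := by simp [sgn]

@[simp] theorem sgn_one : sgn 1 = -1 := by simp [sgn]

@[simp] theorem sgn_two : sgn 2 = -1 := by simp [sgn]

theorem form_frame {O : Set Ambient} {z : Ambient} (hz : z ∈ levelSet frameDefect O) (i j : Fin 3) :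
    form (z.2.2 i) (z.2.2 j) = if i = j then sgn i else 0 := by
  have := congrFun (congrFun hz.2 i) j
  simp only [frameDefect, Pi.zero_apply] at this
  linarith

/-- An orthonormal frame is a basis, with the obvious components. -/
theorem sum_form_smul {O : Set Ambient} {z : Ambient} (hz : z ∈ levelSet frameDefect O)
    (w : Fin 3 → ℝ) : ∑ i, (sgn i * form (z.2.2 i) w) • z.2.2 i = w := by
  let A : Matrix (Fin 3) (Fin 3) ℝ := Matrix.of z.2.2
  let D : Matrix (Fin 3) (Fin 3) ℝ := Matrix.diagonal sgn
  -- Orthonormality of the rows, A D Aᵀ = D, gives a right inverse of A. It is also a left inverse,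
  -- and this is the expansion in the frame.
  have hAD : A * (D * A.transpose * D) = 1 := by
    have h : A * D * A.transpose = D := by
      ext i j
      have := form_frame hz i j
      rw [form_apply] at this
      simp only [Matrix.mul_apply, Matrix.transpose_apply, Fin.sum_univ_three,
        A, D, Matrix.of_apply, Matrix.diagonal_apply]
      rw [← this]
      simp [sgn]
      ring
    calc A * (D * A.transpose * D) = A * D * A.transpose * D := by simp only [Matrix.mul_assoc]
      _ = D * D := by rw [h]
      _ = 1 := by
        rw [Matrix.diagonal_mul_diagonal, ← Matrix.diagonal_one]
        congr 1
        ext i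
        fin_cases i <;> simp [sgn]
  have hDA := mul_eq_one_comm.1 hAD
  have h (k l : Fin 3) := congrFun (congrFun hDA k) l
  have hl : ∀ l, (∑ i, (sgn i * form (z.2.2 i) w) • z.2.2 i) l = w l := by
    simp only [Matrix.mul_apply, Matrix.transpose_apply, Fin.sum_univ_three, A,
      D, Matrix.of_apply, Fin.forall_fin_succ, Matrix.diagonal_apply,
      Matrix.one_apply] at h
    simp at h
    obtain ⟨⟨h00, h01, h02⟩, ⟨h10, h11, h12⟩, ⟨h20, h21, h22⟩⟩ := h
    simp only [Fin.sum_univ_three, form_apply, Pi.add_apply, Pi.smul_apply, smul_eq_mul,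
      Fin.forall_fin_succ]
    simp
    refine ⟨?_, ?_, ?_⟩
    · linear_combination w 0 * h00 + w 1 * h10 + w 2 * h20
    · linear_combination w 0 * h01 + w 1 * h11 + w 2 * h21
    · linear_combination w 0 * h02 + w 1 * h12 + w 2 * h22
  exact funext hl

/-- The tangent vector at `z` to the manifold of frames over the tangent vector `a`, with components
`u 0, u 1, u 2` of `ω^1, ω^2, ω^3` and `u 3, u 4, u 5` of `ω^1_2, ω^3_1, ω^3_2`. -/
def lift (z : Ambient) (a : Lorentz.Plane) (u : Fin 6 → ℝ) : Ambient :=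
  (a, u 0 • z.2.2 0 + u 1 • z.2.2 1 + u 2 • z.2.2 2,
    ![u 3 • z.2.2 1 + u 4 • z.2.2 2, u 3 • z.2.2 0 + u 5 • z.2.2 2, u 4 • z.2.2 0 - u 5 • z.2.2 1])

theorem lift_mem_tangent {O : Set Ambient} {z : Ambient} (hz : z ∈ levelSet frameDefect O)
    (a : Lorentz.Plane) (u : Fin 6 → ℝ) : lift z a u ∈ tangent frameDefect z := by
  rw [mem_tangent_iff]
  have h := form_frame hz
  simp only [form_apply, sgn] at h
  have h00 := h 0 0
  have h01 := h 0 1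
  have h02 := h 0 2
  have h11 := h 1 1
  have h12 := h 1 2
  have h22 := h 2 2
  simp at h00 h01 h02 h11 h12 h22
  intro i j
  fin_cases i <;> fin_cases j <;> simp [lift]
  · linear_combination 2 * u 3 * h01 + 2 * u 4 * h02
  · linear_combination u 3 * h11 + u 3 * h00 + u 4 * h12 + u 5 * h02
  · linear_combination u 3 * h12 + u 4 * h22 + u 4 * h00 - u 5 * h01
  · linear_combination u 3 * h11 + u 3 * h00 + u 4 * h12 + u 5 * h02
  · linear_combination 2 * u 3 * h01 + 2 * u 5 * h12
  · linear_combination u 3 * h02 + u 5 * h22 + u 4 * h01 - u 5 * h11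
  · linear_combination u 3 * h12 + u 4 * h22 + u 4 * h00 - u 5 * h01
  · linear_combination u 3 * h02 + u 5 * h22 + u 4 * h01 - u 5 * h11
  · linear_combination 2 * u 4 * h02 - 2 * u 5 * h12

/-- The components of a tangent vector. -/
def components (z v : Ambient) : Fin 6 → ℝ :=
  ![canonicalForm 0 z v, canonicalForm 1 z v, canonicalForm 2 z v,
    connectionForm 0 1 z v, connectionForm 2 0 z v, connectionForm 2 1 z v]

theorem canonicalForm_apply (i : Fin 3) (z v : Ambient) :
    canonicalForm i z v = sgn i * form (z.2.2 i) v.2.1 := rfl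

theorem connectionForm_apply (i j : Fin 3) (z v : Ambient) :
    connectionForm i j z v = sgn i * form (z.2.2 i) (v.2.2 j) := rfl

/-- Differentiating orthonormality makes the matrix ⟨e_i, de_j⟩ skew, so three of its entries
determine the variation of the frame. The rest is expansion in the basis e_i. -/
theorem lift_components {O : Set Ambient} {z : Ambient} (hz : z ∈ levelSet frameDefect O)
    {v : Ambient} (hv : v ∈ tangent frameDefect z) : lift z v.1 (components z v) = v := by
  have hs := sum_form_smul hz
  rw [mem_tangent_iff] at hv
  have hv' (i j : Fin 3) : form (z.2.2 i) (v.2.2 j) = - form (z.2.2 j) (v.2.2 i) := by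
    have h1 := hv i j
    have h2 : form (v.2.2 i) (z.2.2 j) = form (z.2.2 j) (v.2.2 i) := by simp; ring
    linarith
  have h00 : form (z.2.2 0) (v.2.2 0) = 0 := by linarith [hv' 0 0]
  have h11 : form (z.2.2 1) (v.2.2 1) = 0 := by linarith [hv' 1 1]
  have h22 : form (z.2.2 2) (v.2.2 2) = 0 := by linarith [hv' 2 2]
  refine Prod.ext rfl (Prod.ext ?_ ?_)
  · have := hs v.2.1
    rw [Fin.sum_univ_three] at this
    exact this
  · have e0 := hs (v.2.2 0)
    have e1 := hs (v.2.2 1)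
    have e2 := hs (v.2.2 2)
    rw [Fin.sum_univ_three] at e0 e1 e2
    rw [h00, hv' 1 0] at e0
    rw [h11] at e1
    rw [h22, hv' 0 2, hv' 1 2] at e2
    funext j
    fin_cases j
    · change (sgn 0 * form (z.2.2 0) (v.2.2 1)) • z.2.2 1 + (sgn 2 * form (z.2.2 2) (v.2.2 0)) •
          z.2.2 2 = v.2.2 0
      refine Eq.trans ?_ e0
      simp only [sgn]
      simp
    · change (sgn 0 * form (z.2.2 0) (v.2.2 1)) • z.2.2 0 + (sgn 2 * form (z.2.2 2) (v.2.2 1)) •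
          z.2.2 2 = v.2.2 1
      refine Eq.trans ?_ e1
      simp only [sgn]
      simp
    · change (sgn 2 * form (z.2.2 2) (v.2.2 0)) • z.2.2 0 - (sgn 2 * form (z.2.2 2) (v.2.2 1)) •
          z.2.2 1 = v.2.2 2
      refine Eq.trans ?_ e2
      simp only [sgn]
      simp
      module

theorem components_lift {O : Set Ambient} {z : Ambient} (hz : z ∈ levelSet frameDefect O)
    (a : Lorentz.Plane) (u : Fin 6 → ℝ) : components z (lift z a u) = u := by
  have h := form_frame hz
  simp only [form_apply, sgn] at h
  have h00 := h 0 0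
  have h01 := h 0 1
  have h02 := h 0 2
  have h11 := h 1 1
  have h12 := h 1 2
  have h22 := h 2 2
  simp at h00 h01 h02 h11 h12 h22
  funext i
  fin_cases i <;>
    simp [components, canonicalForm_apply, connectionForm_apply, lift, sgn]
  · linear_combination u 0 * h00 + u 1 * h01 + u 2 * h02
  · linear_combination -u 0 * h01 - u 1 * h11 - u 2 * h12
  · linear_combination -u 0 * h02 - u 1 * h12 - u 2 * h22
  · linear_combination u 3 * h00 + u 5 * h02
  · linear_combination -u 3 * h12 - u 4 * h22
  · linear_combination -u 3 * h02 - u 5 * h22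

theorem lift_add (z : Ambient) (a b : Lorentz.Plane) (u w : Fin 6 → ℝ) :
    lift z (a + b) (u + w) = lift z a u + lift z b w := by
  refine Prod.ext rfl (Prod.ext ?_ ?_)
  · simp [lift]; module
  · funext j; fin_cases j <;> simp [lift] <;> module

theorem lift_smul (z : Ambient) (r : ℝ) (a : Lorentz.Plane) (u : Fin 6 → ℝ) :
    lift z (r • a) (r • u) = r • lift z a u := by
  refine Prod.ext rfl (Prod.ext ?_ ?_)
  · simp [lift]; module
  · funext j; fin_cases j <;> simp [lift] <;> module

/-- `lift` as a linear map from the 8-dimensional model space. -/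
def liftₗ {O : Set Ambient} {z : Ambient} (hz : z ∈ levelSet frameDefect O) :
    (Lorentz.Plane × (Fin 6 → ℝ)) →ₗ[ℝ] tangent frameDefect z where
  toFun p := ⟨lift z p.1 p.2, lift_mem_tangent hz _ _⟩
  map_add' _ _ := Subtype.ext (lift_add z _ _ _ _)
  map_smul' r _ := Subtype.ext (lift_smul z r _ _)

/-- This bound forces exactly two forms of each kind in a decomposition, since 4 + p + q ≤ 8 and p,
q ≥ 2. -/
theorem finrank_tangent_le {O : Set Ambient} {z : Ambient} (hz : z ∈ levelSet frameDefect O) :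
    Module.finrank ℝ (tangent frameDefect z) ≤ 8 := by
  have hs : Function.Surjective (liftₗ hz) := fun v =>
    ⟨(v.1.1, components z v), Subtype.ext (lift_components hz v.2)⟩
  have := LinearMap.finrank_le_finrank_of_surjective (f := liftₗ hz) hs
  simpa using this

end Minkowski

/-! ### Lie brackets of lifted fields and exterior derivatives of the structure forms. -/

namespace Minkowski

open EDS

/-- `lift` in its dependence on the frame and on the components. -/
def liftBilin : (Fin 3 → Fin 3 → ℝ) →L[ℝ] (Fin 6 → ℝ) →L[ℝ] Ambient :=
  (LinearMap.mk₂ ℝ (fun e u => lift (0, 0, e) 0 u)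
    (fun e e' u => by
      refine Prod.ext (by simp [lift]) (Prod.ext ?_ ?_)
      · simp [lift]; module
      · funext j; fin_cases j <;> simp [lift] <;> module)
    (fun r e u => by
      refine Prod.ext (by simp [lift]) (Prod.ext ?_ ?_)
      · simp [lift]; module
      · funext j; fin_cases j <;> simp [lift] <;> module)
    (fun e u u' => by rw [← lift_add, add_zero])
    (fun r e u => by rw [← lift_smul, smul_zero])).toContinuousBilinearMap

theorem liftBilin_apply (e : Fin 3 → Fin 3 → ℝ) (u : Fin 6 → ℝ) :
    liftBilin e u = lift (0, 0, e) 0 u := rfl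

theorem lift_eq (z : Ambient) (a : Lorentz.Plane) (u : Fin 6 → ℝ) :
    lift z a u = (a, 0, 0) + liftBilin z.2.2 u := by
  rw [liftBilin_apply]
  exact Prod.ext (by simp [lift]) (by simp [lift])

/-- The Lie algebra bracket of the isometry group of Minkowski space, in components. -/
def isoBracket (u v : Fin 6 → ℝ) : Fin 6 → ℝ :=
  ![u 3 * v 1 + u 4 * v 2 - (v 3 * u 1 + v 4 * u 2),
    u 3 * v 0 - u 5 * v 2 - (v 3 * u 0 - v 5 * u 2),
    u 4 * v 0 + u 5 * v 1 - (v 4 * u 0 + v 5 * u 1),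
    u 4 * v 5 - v 4 * u 5, u 5 * v 3 - v 5 * u 3, u 4 * v 3 - v 4 * u 3]

theorem hasFDerivAt_lift {a : Lorentz.Plane → Lorentz.Plane} {u : Lorentz.Plane → Fin 6 → ℝ}
    {a' : Lorentz.Plane →L[ℝ] Lorentz.Plane} {u' : Lorentz.Plane →L[ℝ] Fin 6 → ℝ} {z : Ambient}
    (ha : HasFDerivAt a a' z.1) (hu : HasFDerivAt u u' z.1) :
    ∃ L : Ambient →L[ℝ] Ambient, HasFDerivAt (fun y : Ambient => lift y (a y.1) (u y.1)) L z ∧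
      ∀ w, L w = lift z (a' w.1) (u' w.1) + liftBilin w.2.2 (u z.1) := by
  have h1 : HasFDerivAt (fun y : Ambient => y.2.2)
      ((ContinuousLinearMap.snd ℝ (Fin 3 → ℝ) (Fin 3 → Fin 3 → ℝ)).comp
      (ContinuousLinearMap.snd ℝ (EuclideanSpace ℝ (Fin 2)) _)) z :=
    hasFDerivAt_snd.comp z hasFDerivAt_snd
  have h2 : HasFDerivAt (fun y : Ambient => u y.1)
      (u'.comp (ContinuousLinearMap.fst ℝ (EuclideanSpace ℝ (Fin 2)) _)) z :=
    hu.comp z hasFDerivAt_fst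
  have h3 : HasFDerivAt (fun y : Ambient => a y.1)
      (a'.comp (ContinuousLinearMap.fst ℝ (EuclideanSpace ℝ (Fin 2)) _)) z :=
    ha.comp z hasFDerivAt_fst
  have h4 := (h3.prodMk (hasFDerivAt_const (0 : (Fin 3 → ℝ) × (Fin 3 → Fin 3 → ℝ)) z)).add
    (liftBilin.hasFDerivAt_of_bilinear h1 h2)
  refine ⟨_, h4.congr_of_eventuallyEq (Filter.Eventually.of_forall fun y => lift_eq _ _ _), ?_⟩
  intro w
  rw [lift_eq]
  simp
  exact add_assoc _ _ _ |>.symm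

/-- The Lie bracket of two vector fields with components depending on the base point only. -/
theorem bracket_lift {a b : Lorentz.Plane → Lorentz.Plane} {u v : Lorentz.Plane → Fin 6 → ℝ}
    {a' b' : Lorentz.Plane →L[ℝ] Lorentz.Plane} {u' v' : Lorentz.Plane →L[ℝ] Fin 6 → ℝ}
    {z : Ambient} (ha : HasFDerivAt a a' z.1) (hu : HasFDerivAt u u' z.1)
    (hb : HasFDerivAt b b' z.1) (hv : HasFDerivAt v v' z.1) :
    fderiv ℝ (fun y : Ambient => lift y (b y.1) (v y.1)) z (lift z (a z.1) (u z.1)) -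
      fderiv ℝ (fun y : Ambient => lift y (a y.1) (u y.1)) z (lift z (b z.1) (v z.1)) =
    lift z (b' (a z.1) - a' (b z.1))
      (v' (a z.1) - u' (b z.1) + isoBracket (u z.1) (v z.1)) := by
  obtain ⟨L, hL, hL'⟩ := hasFDerivAt_lift ha hu
  obtain ⟨K, hK, hK'⟩ := hasFDerivAt_lift hb hv
  rw [hL.fderiv, hK.fderiv, hL', hK']
  simp only [liftBilin_apply]
  refine Prod.ext (by simp [lift]) (Prod.ext ?_ ?_)
  · simp [lift, isoBracket]; module
  · funext j; fin_cases j <;> simp [lift, isoBracket] <;> module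

theorem dForm_canonicalForm (i : Fin 3) (z v w : Ambient) :
    dForm (canonicalForm i) z v w =
      sgn i * (form (v.2.2 i) w.2.1 - form (w.2.2 i) v.2.1) := by
  have h : canonicalForm i = ⇑(sgn i • (formBilin.precompR Ambient).flip basePoint ∘L frameVec i :
      Ambient →L[ℝ] Ambient →L[ℝ] ℝ) := by
    funext z
    rfl
  rw [dForm, h, ContinuousLinearMap.fderiv]
  change sgn i * form (v.2.2 i) w.2.1 - sgn i * form (w.2.2 i) v.2.1 = _
  ring

theorem dForm_connectionForm (i j : Fin 3) (z v w : Ambient) :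
    dForm (connectionForm i j) z v w =
      sgn i * (form (v.2.2 i) (w.2.2 j) - form (w.2.2 i) (v.2.2 j)) := by
  have h : connectionForm i j = ⇑(sgn i • (formBilin.precompR Ambient).flip (frameVec j) ∘L
      frameVec i : Ambient →L[ℝ] Ambient →L[ℝ] ℝ) := by
    funext z
    rfl
  rw [dForm, h, ContinuousLinearMap.fderiv]
  change sgn i * form (v.2.2 i) (w.2.2 j) - sgn i * form (w.2.2 i) (v.2.2 j) = _
  ring

theorem differentiable_connectionForm (i j : Fin 3) : Differentiable ℝ (connectionForm i j) := by
  have h : connectionForm i j = ⇑(sgn i • (formBilin.precompR Ambient).flip (frameVec j) ∘L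
      frameVec i : Ambient →L[ℝ] Ambient →L[ℝ] ℝ) := by
    funext z
    rfl
  rw [h]
  exact ContinuousLinearMap.differentiable _

theorem hasFDerivAt_pull {η : OneForm Lorentz.Plane} {z : Ambient}
    (h : DifferentiableAt ℝ η z.1) :
    ∃ L : Ambient →L[ℝ] Ambient →L[ℝ] ℝ, HasFDerivAt (Lorentz.pull η) L z ∧
      ∀ v w, L v w = fderiv ℝ η z.1 v.1 w.1 := by
  have h1 : HasFDerivAt (fun y : Ambient => η y.1)
      ((fderiv ℝ η z.1).comp (ContinuousLinearMap.fst ℝ (EuclideanSpace ℝ (Fin 2)) _)) z :=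
    h.hasFDerivAt.comp z hasFDerivAt_fst
  have h2 := (((ContinuousLinearMap.compL ℝ Ambient Lorentz.Plane ℝ).flip
    (ContinuousLinearMap.fst ℝ Lorentz.Plane _)).hasFDerivAt (x := η z.1)).comp z h1
  exact ⟨_, h2, fun v w => rfl⟩

theorem dForm_pull {η : OneForm Lorentz.Plane} {z : Ambient} (h : DifferentiableAt ℝ η z.1)
    (v w : Ambient) : dForm (Lorentz.pull η) z v w = dForm η z.1 v.1 w.1 := by
  obtain ⟨L, hL, hL'⟩ := hasFDerivAt_pull h
  rw [dForm, hL.fderiv, hL', hL', dForm]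

theorem dForm_sub {E : Type*} [NormedAddCommGroup E] [NormedSpace ℝ E] {ζ ξ : OneForm E} {x : E}
    (hζ : DifferentiableAt ℝ ζ x) (hξ : DifferentiableAt ℝ ξ x) (v w : E) :
    dForm (ζ - ξ) x v w = dForm ζ x v w - dForm ξ x v w := by
  simp only [dForm]
  rw [fderiv_sub hζ hξ]
  simp
  ring

/-! ### Tangential derivatives of functions vanishing on the manifold of frames. -/

section Curves

variable {O : Set Ambient} {z : Ambient} {ψ : Ambient → ℝ}

/-- Along a curve in the level set ψ vanishes for small times. Explicit curves (translations,
boosts, a rotation) then cover all tangent directions, and no implicit function theorem is needed.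
-/
theorem fderiv_eq_zero_of_curve (hO : IsOpen O) (hz : z ∈ levelSet frameDefect O)
    (hψ : DifferentiableAt ℝ ψ z) (h0 : ∀ y ∈ levelSet frameDefect O, ψ y = 0)
    {c : ℝ → Ambient} {v : Ambient} (hc : HasDerivAt c v 0) (hc0 : c 0 = z)
    (hF : ∀ t, frameDefect (c t) = 0) : fderiv ℝ ψ z v = 0 := by
  subst hc0
  have h1 : HasDerivAt (ψ ∘ c) (fderiv ℝ ψ (c 0) v) 0 :=
    hψ.hasFDerivAt.comp_hasDerivAt 0 hc
  have h2 : ψ ∘ c =ᶠ[nhds 0] fun _ => 0 := by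
    filter_upwards [hc.continuousAt.preimage_mem_nhds (hO.mem_nhds hz.1)] with t ht
    exact h0 _ ⟨ht, hF t⟩
  exact h1.unique ((hasDerivAt_const (0 : ℝ) (0 : ℝ)).congr_of_eventuallyEq h2)

theorem frameDefect_eq_zero_iff (e : Fin 3 → Fin 3 → ℝ) (x : EuclideanSpace ℝ (Fin 2))
    (ρ : Fin 3 → ℝ) : frameDefect (x, ρ, e) = 0 ↔
      form (e 0) (e 0) = 1 ∧ form (e 1) (e 1) = -1 ∧ form (e 2) (e 2) = -1 ∧
        form (e 0) (e 1) = 0 ∧ form (e 0) (e 2) = 0 ∧ form (e 1) (e 2) = 0 := by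
  constructor
  · intro h
    have h (i j : Fin 3) := congrFun (congrFun h i) j
    simp only [frameDefect, Pi.zero_apply, sub_eq_zero] at h
    exact ⟨by simpa using h 0 0, by simpa using h 1 1, by simpa using h 2 2, by simpa using h 0 1,
      by simpa using h 0 2, by simpa using h 1 2⟩
  · rintro ⟨h0, h1, h2, h01, h02, h12⟩
    simp only [form_apply] at *
    funext i j
    fin_cases i <;> fin_cases j <;> simp [frameDefect] <;> linarith

theorem hasDerivAt_smul_add {f g : ℝ → ℝ} {f' g' : ℝ} (hf : HasDerivAt f f' 0)
    (hg : HasDerivAt g g' 0) (v w : Fin 3 → ℝ) :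
    HasDerivAt (fun t => f t • v + g t • w) (f' • v + g' • w) 0 :=
  (hf.smul_const v).add (hg.smul_const w)

theorem hasDerivAt_frame (x : Lorentz.Plane) (ρ : Fin 3 → ℝ) {c₀ c₁ c₂ : ℝ → Fin 3 → ℝ}
    {d₀ d₁ d₂ : Fin 3 → ℝ} (h₀ : HasDerivAt c₀ d₀ 0) (h₁ : HasDerivAt c₁ d₁ 0)
    (h₂ : HasDerivAt c₂ d₂ 0) {v : Ambient} (hv : v = (0, 0, ![d₀, d₁, d₂])) :
    HasDerivAt (fun t => ((x, ρ, ![c₀ t, c₁ t, c₂ t]) : Ambient)) v 0 := by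
  subst hv
  refine (hasDerivAt_const (0 : ℝ) x).prodMk ((hasDerivAt_const (0 : ℝ) ρ).prodMk
    (hasDerivAt_pi.2 fun i => ?_))
  fin_cases i
  exacts [h₀, h₁, h₂]

theorem hasDerivAt_cosh_zero : HasDerivAt Real.cosh 0 0 := by simpa using Real.hasDerivAt_cosh 0

theorem hasDerivAt_sinh_zero : HasDerivAt Real.sinh 1 0 := by simpa using Real.hasDerivAt_sinh 0

theorem hasDerivAt_cos_zero : HasDerivAt Real.cos 0 0 := by simpa using Real.hasDerivAt_cos 0

theorem hasDerivAt_sin_zero : HasDerivAt Real.sin 1 0 := by simpa using Real.hasDerivAt_sin 0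

theorem fderiv_translation_eq_zero {x : Lorentz.Plane} {ρ : Fin 3 → ℝ} {e : Fin 3 → Fin 3 → ℝ}
    (hO : IsOpen O) (hz : (x, ρ, e) ∈ levelSet frameDefect O) (hψ : DifferentiableAt ℝ ψ (x, ρ, e))
    (h0 : ∀ y ∈ levelSet frameDefect O, ψ y = 0) (a : Lorentz.Plane) (u : Fin 6 → ℝ) :
    fderiv ℝ ψ (x, ρ, e) (lift (x, ρ, e) a ![u 0, u 1, u 2, 0, 0, 0]) = 0 := by
  have hF := (frameDefect_eq_zero_iff e x ρ).1 hz.2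
  simp only [form_apply] at hF
  obtain ⟨f0, f1, f2, f01, f02, f12⟩ := hF
  refine fderiv_eq_zero_of_curve hO hz hψ h0 (c := fun t => (x, ρ, e) + t • lift (x, ρ, e) a ![u 0,
      u 1, u 2, 0, 0, 0]) ?_ ?_ ?_
  · simpa using (((hasDerivAt_id (0 : ℝ)).smul_const
      (lift (x, ρ, e) a ![u 0, u 1, u 2, 0, 0, 0])).const_add (x, ρ, e))
  · simp
  · intro t
    refine (frameDefect_eq_zero_iff _ _ _).2 ?_
    simp only [form_apply]
    simp [lift]
    exact ⟨f0, f1, f2, f01, f02, f12⟩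

theorem fderiv_boost_zero_one_eq_zero {x : Lorentz.Plane} {ρ : Fin 3 → ℝ} {e : Fin 3 → Fin 3 → ℝ}
    (hO : IsOpen O) (hz : (x, ρ, e) ∈ levelSet frameDefect O) (hψ : DifferentiableAt ℝ ψ (x, ρ, e))
    (h0 : ∀ y ∈ levelSet frameDefect O, ψ y = 0) :
    fderiv ℝ ψ (x, ρ, e) (lift (x, ρ, e) 0 ![0, 0, 0, 1, 0, 0]) = 0 := by
  have hF := (frameDefect_eq_zero_iff e x ρ).1 hz.2
  simp only [form_apply] at hF
  obtain ⟨f0, f1, f2, f01, f02, f12⟩ := hF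
  refine fderiv_eq_zero_of_curve hO hz hψ h0 (c := fun t => (x, ρ, ![Real.cosh t • e 0 + Real.sinh
      t • e 1,
    Real.sinh t • e 0 + Real.cosh t • e 1, e 2])) ?_ ?_ ?_
  · exact hasDerivAt_frame x ρ (hasDerivAt_smul_add hasDerivAt_cosh_zero hasDerivAt_sinh_zero _ _)
      (hasDerivAt_smul_add hasDerivAt_sinh_zero hasDerivAt_cosh_zero _ _) (hasDerivAt_const _ _)
          (by simp [lift])
  · refine Prod.ext rfl (Prod.ext rfl ?_)
    funext i; fin_cases i <;> simp
  · intro t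
    have := Real.cosh_sq t
    refine (frameDefect_eq_zero_iff _ _ _).2 ?_
    simp only [form_apply]
    simp
    refine ⟨?_, ?_, f2, ?_, ?_, ?_⟩
    · linear_combination Real.cosh t ^ 2 * f0 + Real.sinh t ^ 2 * f1 +
        2 * Real.cosh t * Real.sinh t * f01 + this
    · linear_combination Real.sinh t ^ 2 * f0 + Real.cosh t ^ 2 * f1 +
        2 * Real.cosh t * Real.sinh t * f01 - this
    · linear_combination Real.cosh t * Real.sinh t * f0 + Real.cosh t * Real.sinh t * f1 +
        (Real.cosh t ^ 2 + Real.sinh t ^ 2) * f01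
    · linear_combination Real.cosh t * f02 + Real.sinh t * f12
    · linear_combination Real.sinh t * f02 + Real.cosh t * f12

theorem fderiv_boost_zero_two_eq_zero {x : Lorentz.Plane} {ρ : Fin 3 → ℝ} {e : Fin 3 → Fin 3 → ℝ}
    (hO : IsOpen O) (hz : (x, ρ, e) ∈ levelSet frameDefect O) (hψ : DifferentiableAt ℝ ψ (x, ρ, e))
    (h0 : ∀ y ∈ levelSet frameDefect O, ψ y = 0) :
    fderiv ℝ ψ (x, ρ, e) (lift (x, ρ, e) 0 ![0, 0, 0, 0, 1, 0]) = 0 := by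
  have hF := (frameDefect_eq_zero_iff e x ρ).1 hz.2
  simp only [form_apply] at hF
  obtain ⟨f0, f1, f2, f01, f02, f12⟩ := hF
  refine fderiv_eq_zero_of_curve hO hz hψ h0 (c := fun t => (x, ρ, ![Real.cosh t • e 0 + Real.sinh
      t • e 2, e 1,
    Real.sinh t • e 0 + Real.cosh t • e 2])) ?_ ?_ ?_
  · exact hasDerivAt_frame x ρ (hasDerivAt_smul_add hasDerivAt_cosh_zero hasDerivAt_sinh_zero _ _)
        (hasDerivAt_const _ _)
      (hasDerivAt_smul_add hasDerivAt_sinh_zero hasDerivAt_cosh_zero _ _) (by simp [lift])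
  · refine Prod.ext rfl (Prod.ext rfl ?_)
    funext i; fin_cases i <;> simp
  · intro t
    have := Real.cosh_sq t
    refine (frameDefect_eq_zero_iff _ _ _).2 ?_
    simp only [form_apply]
    simp
    refine ⟨?_, f1, ?_, ?_, ?_, ?_⟩
    · linear_combination Real.cosh t ^ 2 * f0 + Real.sinh t ^ 2 * f2 +
        2 * Real.cosh t * Real.sinh t * f02 + this
    · linear_combination Real.sinh t ^ 2 * f0 + Real.cosh t ^ 2 * f2 +
        2 * Real.cosh t * Real.sinh t * f02 - this
    · linear_combination Real.cosh t * f01 + Real.sinh t * f12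
    · linear_combination Real.cosh t * Real.sinh t * f0 + Real.cosh t * Real.sinh t * f2 +
        (Real.cosh t ^ 2 + Real.sinh t ^ 2) * f02
    · linear_combination Real.sinh t * f01 + Real.cosh t * f12

theorem fderiv_rotation_eq_zero {x : Lorentz.Plane} {ρ : Fin 3 → ℝ} {e : Fin 3 → Fin 3 → ℝ}
    (hO : IsOpen O) (hz : (x, ρ, e) ∈ levelSet frameDefect O) (hψ : DifferentiableAt ℝ ψ (x, ρ, e))
    (h0 : ∀ y ∈ levelSet frameDefect O, ψ y = 0) :
    fderiv ℝ ψ (x, ρ, e) (lift (x, ρ, e) 0 ![0, 0, 0, 0, 0, 1]) = 0 := by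
  have hF := (frameDefect_eq_zero_iff e x ρ).1 hz.2
  simp only [form_apply] at hF
  obtain ⟨f0, f1, f2, f01, f02, f12⟩ := hF
  refine fderiv_eq_zero_of_curve hO hz hψ h0 (c := fun t => (x, ρ, ![e 0, Real.cos t • e 1 +
      Real.sin t • e 2,
    (-Real.sin t) • e 1 + Real.cos t • e 2])) ?_ ?_ ?_
  · exact hasDerivAt_frame x ρ (hasDerivAt_const _ _) (hasDerivAt_smul_add hasDerivAt_cos_zero
        hasDerivAt_sin_zero _ _)
      (hasDerivAt_smul_add hasDerivAt_sin_zero.neg hasDerivAt_cos_zero _ _) (by simp [lift])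
  · refine Prod.ext rfl (Prod.ext rfl ?_)
    funext i; fin_cases i <;> simp
  · intro t
    have := Real.sin_sq_add_cos_sq t
    refine (frameDefect_eq_zero_iff _ _ _).2 ?_
    simp only [form_apply]
    simp
    refine ⟨f0, ?_, ?_, ?_, ?_, ?_⟩
    · linear_combination Real.cos t ^ 2 * f1 + Real.sin t ^ 2 * f2 +
        2 * Real.cos t * Real.sin t * f12 - this
    · linear_combination Real.sin t ^ 2 * f1 + Real.cos t ^ 2 * f2 -
        2 * Real.cos t * Real.sin t * f12 - this
    · linear_combination Real.cos t * f01 + Real.sin t * f02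
    · linear_combination -Real.sin t * f01 + Real.cos t * f02
    · linear_combination -Real.cos t * Real.sin t * f1 + Real.cos t * Real.sin t * f2 +
        (Real.cos t ^ 2 - Real.sin t ^ 2) * f12

/-- A function that vanishes on the manifold of frames has vanishing derivative along it. -/
theorem fderiv_lift_eq_zero (hO : IsOpen O) (hz : z ∈ levelSet frameDefect O)
    (hψ : DifferentiableAt ℝ ψ z) (h0 : ∀ y ∈ levelSet frameDefect O, ψ y = 0)
    (a : Lorentz.Plane) (u : Fin 6 → ℝ) : fderiv ℝ ψ z (lift z a u) = 0 := by
  obtain ⟨x, ρ, e⟩ := z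
  have hdec : lift (x, ρ, e) a u = lift (x, ρ, e) a ![u 0, u 1, u 2, 0, 0, 0] +
      u 3 • lift (x, ρ, e) 0 ![0, 0, 0, 1, 0, 0] + u 4 • lift (x, ρ, e) 0 ![0, 0, 0, 0, 1, 0] +
      u 5 • lift (x, ρ, e) 0 ![0, 0, 0, 0, 0, 1] := by
    simp only [← lift_smul, ← lift_add]
    congr 1
    · simp
    · funext i; fin_cases i <;> simp
  rw [hdec]
  simp only [map_add, map_smul, fderiv_translation_eq_zero hO hz hψ h0,
    fderiv_boost_zero_one_eq_zero hO hz hψ h0, fderiv_boost_zero_two_eq_zero hO hz hψ h0,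
    fderiv_rotation_eq_zero hO hz hψ h0]
  simp

end Curves

end Minkowski

/-! ### Derived flags and Lie brackets. -/

namespace EDS

variable {E G : Type*} [NormedAddCommGroup E] [NormedSpace ℝ E]
  [NormedAddCommGroup G] [NormedSpace ℝ G] {F : E → G} {O : Set E} {Φ : Set (OneForm E)}

theorem mem_ann_iff {x : E} (v : tangent F x) : v ∈ ann F Φ x ↔ ∀ ζ ∈ Φ, ζ x v = 0 := by
  rw [ann, Submodule.mem_dualCoannihilator, coSpan]
  constructor
  · intro h ζ hζ
    exact h _ (Submodule.subset_span ⟨ζ, hζ, rfl⟩)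
  · intro h φ hφ
    induction hφ using Submodule.span_induction with
    | mem φ hφ =>
      obtain ⟨ζ, hζ, rfl⟩ := hφ
      exact h ζ hζ
    | zero => simp
    | add φ ψ _ _ h1 h2 => simp [h1, h2]
    | smul r φ _ h1 => simp [h1]

theorem apply_eq_zero_of_mem_sections {ζ : OneForm E} (hζ : ζ ∈ sections F O Φ) {x : E}
    (hx : x ∈ levelSet F O) {v : E} (hv : v ∈ tangent F x) (h : ∀ ξ ∈ Φ, ξ x v = 0) :
    ζ x v = 0 := by
  have h1 : (⟨v, hv⟩ : tangent F x) ∈ ann F Φ x := (mem_ann_iff _).2 h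
  exact (Submodule.mem_dualCoannihilator _).1 h1 _ (hζ.2 x hx)

theorem derivedFlag_succ_subset (n : ℕ) : derivedFlag F O Φ (n + 1) ⊆ derivedFlag F O Φ n :=
  fun _ h => h.1

theorem contDiffOn_of_mem_derivedFlag : ∀ {n : ℕ} {ζ : OneForm E}, ζ ∈ derivedFlag F O Φ n →
    ContDiffOn ℝ ∞ ζ O
  | 0, _, h => h.1
  | n + 1, _, h => contDiffOn_of_mem_derivedFlag (derivedFlag_succ_subset n h)

/-- If all forms of a derived system annihilate two vector fields along the submanifold, then those of
the next one annihilate the Lie bracket. -/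
theorem apply_bracket_eq_zero (hO : IsOpen O) {n : ℕ} {ζ : OneForm E}
    (hζ : ζ ∈ derivedFlag F O Φ (n + 1)) {N : Set E} {z : E} (hz : z ∈ levelSet F O) (hzN : z ∈ N)
    {A B : E → E} (hA : DifferentiableAt ℝ A z) (hB : DifferentiableAt ℝ B z)
    (hAt : A z ∈ tangent F z) (hBt : B z ∈ tangent F z)
    (hA0 : ∀ ξ ∈ derivedFlag F O Φ n, ∀ y ∈ levelSet F O, y ∈ N → ξ y (A y) = 0)
    (hB0 : ∀ ξ ∈ derivedFlag F O Φ n, ∀ y ∈ levelSet F O, y ∈ N → ξ y (B y) = 0)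
    (hS : ∀ ψ : E → ℝ, DifferentiableAt ℝ ψ z → (∀ y ∈ levelSet F O, y ∈ N → ψ y = 0) →
      ∀ v ∈ tangent F z, fderiv ℝ ψ z v = 0) :
    ζ z (fderiv ℝ B z (A z) - fderiv ℝ A z (B z)) = 0 := by
  have hζn := derivedFlag_succ_subset n hζ
  have hd := hζ.2 z hz ⟨A z, hAt⟩ ((mem_ann_iff _).2 fun ξ hξ => hA0 ξ hξ z hz hzN) ⟨B z, hBt⟩
    ((mem_ann_iff _).2 fun ξ hξ => hB0 ξ hξ z hz hzN)
  have hdiff : DifferentiableAt ℝ ζ z :=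
    ((contDiffOn_of_mem_derivedFlag hζ).contDiffAt (hO.mem_nhds hz.1)).differentiableAt (by simp)
  -- Cartan's formula dζ(A, B) = A ζ(B) - B ζ(A) - ζ([A, B]): the functions ζ(A), ζ(B) vanish along
  -- the submanifold, so their tangential derivatives vanish too.
  have hA1 := hS (fun y => ζ y (A y)) (hdiff.clm_apply hA) (hA0 ζ hζn) _ hBt
  have hB1 := hS (fun y => ζ y (B y)) (hdiff.clm_apply hB) (hB0 ζ hζn) _ hAt
  rw [fderiv_clm_apply hdiff hA] at hA1
  rw [fderiv_clm_apply hdiff hB] at hB1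
  simp only [dForm] at hd
  simp at hA1 hB1
  rw [map_sub]
  linarith

end EDS

/-- Two decomposable 2-forms `μ ∧ ν` and `μ' ∧ ν'` in the span of `s ∧ s'` and `t ∧ t'`, where
`s, s', t, t'` are independent, are multiples of one each. -/
theorem splitting_of_decomposable {V : Type*} {s s' t t' μ ν μ' ν' : V → ℝ} {v₀ v₁ w₀ w₁ : V}
    (hs : s v₀ = 1 ∧ s v₁ = 0 ∧ s w₀ = 0 ∧ s w₁ = 0)
    (hs' : s' v₀ = 0 ∧ s' v₁ = 1 ∧ s' w₀ = 0 ∧ s' w₁ = 0)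
    (ht : t v₀ = 0 ∧ t v₁ = 0 ∧ t w₀ = 1 ∧ t w₁ = 0)
    (ht' : t' v₀ = 0 ∧ t' v₁ = 0 ∧ t' w₀ = 0 ∧ t' w₁ = 1) {a b a' b' : ℝ}
    (h : ∀ v w, μ v * ν w - μ w * ν v =
      a * (s v * s' w - s w * s' v) + b * (t v * t' w - t w * t' v))
    (h' : ∀ v w, μ' v * ν' w - μ' w * ν' v =
      a' * (s v * s' w - s w * s' v) + b' * (t v * t' w - t w * t' v))
    {x₀ x₁ y₀ y₁ : V} (hx₀ : μ' x₀ = 0 ∧ ν' x₀ = 0)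
    (hx : μ x₀ * ν x₁ - μ x₁ * ν x₀ ≠ 0)
    (hy : μ' y₀ * ν' y₁ - μ' y₁ * ν' y₀ ≠ 0) :
    ((∀ v, μ v = 0 → ν v = 0 → s v = 0 ∧ s' v = 0) ∧
        ∀ v, μ' v = 0 → ν' v = 0 → t v = 0 ∧ t' v = 0) ∨
      ((∀ v, μ v = 0 → ν v = 0 → t v = 0 ∧ t' v = 0) ∧
        ∀ v, μ' v = 0 → ν' v = 0 → s v = 0 ∧ s' v = 0) := by
  obtain ⟨s0, s1, s2, s3⟩ := hs
  obtain ⟨s0', s1', s2', s3'⟩ := hs'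
  obtain ⟨t0, t1, t2, t3⟩ := ht
  obtain ⟨t0', t1', t2', t3'⟩ := ht'
  have key (μ ν : V → ℝ) (a b : ℝ) (h : ∀ v w, μ v * ν w - μ w * ν v =
      a * (s v * s' w - s w * s' v) + b * (t v * t' w - t w * t' v)) (x₀ x₁ : V)
      (hx : μ x₀ * ν x₁ - μ x₁ * ν x₀ ≠ 0) :
      (b = 0 ∧ ∀ v, μ v = 0 → ν v = 0 → s v = 0 ∧ s' v = 0) ∨
      (a = 0 ∧ ∀ v, μ v = 0 → ν v = 0 → t v = 0 ∧ t' v = 0) := by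
    have e01 := h v₀ v₁
    have e02 := h v₀ w₀
    have e03 := h v₀ w₁
    have e12 := h v₁ w₀
    have e13 := h v₁ w₁
    have e23 := h w₀ w₁
    simp only [s0, s1, s2, s3, s0', s1', s2', s3', t0, t1, t2, t3, t0', t1', t2', t3']
      at e01 e02 e03 e12 e13 e23
    -- The 2×2 minors of (μ, ν) on `v₀, v₁, w₀, w₁` satisfy the Plücker relation. The mixed minors
    -- are zero, which leaves the product of the two remaining ones.
    have hab : a * b = 0 := by
      have : a * b = (μ v₀ * ν v₁ - μ v₁ * ν v₀) * (μ w₀ * ν w₁ - μ w₁ * ν w₀) := by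
        rw [e01, e23]; ring
      rw [this]
      have e : (μ v₀ * ν v₁ - μ v₁ * ν v₀) * (μ w₀ * ν w₁ - μ w₁ * ν w₀) =
        (μ v₀ * ν w₀ - μ w₀ * ν v₀) * (μ v₁ * ν w₁ - μ w₁ * ν v₁) -
        (μ v₀ * ν w₁ - μ w₁ * ν v₀) * (μ v₁ * ν w₀ - μ w₀ * ν v₁) := by ring
      rw [e, e02, e03]
      ring
    rcases mul_eq_zero.1 hab with rfl | rfl
    · right
      refine ⟨rfl, fun v h1 h2 => ?_⟩
      have hb : b ≠ 0 := by
        rintro rfl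
        apply hx
        rw [h]
        ring
      have e0 := h v w₀
      have e1 := h v w₁
      simp only [h1, h2, t2, t3, t2', t3'] at e0 e1
      constructor
      · apply mul_left_cancel₀ hb; linarith
      · apply mul_left_cancel₀ hb; linarith
    · left
      refine ⟨rfl, fun v h1 h2 => ?_⟩
      have hb : a ≠ 0 := by
        rintro rfl
        apply hx
        rw [h]
        ring
      have e0 := h v v₀
      have e1 := h v v₁
      simp only [h1, h2, s0, s1, s0', s1'] at e0 e1
      constructor
      · apply mul_left_cancel₀ hb; linarith
      · apply mul_left_cancel₀ hb; linarith
  rcases key μ ν a b h x₀ x₁ hx with ⟨hb, h1⟩ | ⟨ha, h1⟩ <;>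
    rcases key μ' ν' a' b' h' y₀ y₁ hy with ⟨hb', h2⟩ | ⟨ha', h2⟩
  · exfalso
    apply hx
    rw [h, hb, (h2 x₀ hx₀.1 hx₀.2).1, (h2 x₀ hx₀.1 hx₀.2).2]
    ring
  · exact Or.inl ⟨h1, h2⟩
  · exact Or.inr ⟨h1, h2⟩
  · exfalso
    apply hx
    rw [h, ha, (h2 x₀ hx₀.1 hx₀.2).1, (h2 x₀ hx₀.1 hx₀.2).2]
    ring

/-- Independent covectors take arbitrary values. -/
theorem exists_apply_eq_of_linearIndependent {T ι : Type*} [AddCommGroup T] [Module ℝ T]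
    [Fintype ι] [DecidableEq ι] {φ : ι → Module.Dual ℝ T} (h : LinearIndependent ℝ φ) :
    Function.Surjective (LinearMap.pi φ) := by
  rw [← LinearMap.dualMap_injective_iff, ← LinearMap.ker_eq_bot, LinearMap.ker_eq_bot']
  intro m hm
  have h1 : ∑ i, m (Pi.single i 1) • φ i = 0 := by
    ext v
    have := LinearMap.congr_fun hm v
    simp only [LinearMap.dualMap_apply, LinearMap.zero_apply] at this
    rw [LinearMap.pi_apply_eq_sum_univ m] at this
    simp only [LinearMap.sum_apply, LinearMap.smul_apply, smul_eq_mul, LinearMap.zero_apply]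
    rw [← this]
    refine Finset.sum_congr rfl fun i _ => ?_
    rw [LinearMap.pi_apply, smul_eq_mul, mul_comm]
    congr 2
    ext j
    simp [Pi.single_apply, eq_comm]
  have h2 := Fintype.linearIndependent_iff.1 h _ h1
  ext i
  simpa using h2 i

/-! ### The characteristic distributions of the embedding system. -/

namespace Lorentz

open EDS Minkowski

/-- A coframe `η₀, η₁` with connection form `τ` and curvature `K` on an open set. -/
structure IsCoframe (U : Set Plane) (η₀ η₁ τ : OneForm Plane) (K : Plane → ℝ) : Prop where
  smooth_zero : ContDiffOn ℝ ∞ η₀ U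
  smooth_one : ContDiffOn ℝ ∞ η₁ U
  smooth_conn : ContDiffOn ℝ ∞ τ U
  d_zero : ∀ x ∈ U, ∀ a b, dForm η₀ x a b = -(τ x a * η₁ x b - τ x b * η₁ x a)
  d_one : ∀ x ∈ U, ∀ a b, dForm η₁ x a b = -(τ x a * η₀ x b - τ x b * η₀ x a)
  d_conn : ∀ x ∈ U, ∀ a b, dForm τ x a b = -K x * (η₀ x a * η₁ x b - η₀ x b * η₁ x a)
  exists_dual : ∀ x ∈ U, ∃ a b, η₀ x a = 1 ∧ η₁ x a = 0 ∧ η₀ x b = 0 ∧ η₁ x b = 1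

/-- The components of the tangent vector over `a` that is annihilated by the isometric embedding
system and has components `p, q` of `ω^3_1, ω^3_2`. -/
def adapted (η₀ η₁ τ : OneForm Plane) (x a : Plane) (p q : ℝ) : Fin 6 → ℝ :=
  ![η₀ x a, η₁ x a, 0, τ x a, p, q]

/-- The isometric embedding system in terms of a coframe and its connection form. -/
def system (η₀ η₁ τ : OneForm Plane) : Fin 4 → OneForm Ambient :=
  ![canonicalForm 2, canonicalForm 0 - pull η₀, canonicalForm 1 - pull η₁,
    connectionForm 0 1 - pull τ]

variable {U : Set Plane} {η₀ η₁ τ : OneForm Plane} {K : Plane → ℝ} {O : Set Ambient} {z : Ambient}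

theorem system_apply_adapted (hz : z ∈ levelSet frameDefect O) (i : Fin 4) (a : Plane) (p q : ℝ) :
    system η₀ η₁ τ i z (lift z a (adapted η₀ η₁ τ z.1 a p q)) = 0 := by
  have h := components_lift hz a (adapted η₀ η₁ τ z.1 a p q)
  have h0 := congrFun h 0
  have h1 := congrFun h 1
  have h2 := congrFun h 2
  have h3 := congrFun h 3
  simp [components, adapted] at h0 h1 h2 h3
  fin_cases i <;> simp [system, pull, adapted, h0, h1, h2, h3] <;> simp [lift]

theorem eq_lift_adapted (hz : z ∈ levelSet frameDefect O) {v : Ambient}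
    (hv : v ∈ tangent frameDefect z) (h : ∀ i, system η₀ η₁ τ i z v = 0) :
    v = lift z v.1 (adapted η₀ η₁ τ z.1 v.1 (connectionForm 2 0 z v) (connectionForm 2 1 z v)) := by
  have h0 := h 0
  have h1 := h 1
  have h2 := h 2
  have h3 := h 3
  simp [system, pull, sub_eq_zero] at h0 h1 h2 h3
  conv_lhs => rw [← lift_components hz hv]
  congr 1
  simp only [components, adapted, h0, h1, h2, h3]

theorem components_adapted (hz : z ∈ levelSet frameDefect O) (a : Plane) (p q : ℝ) :
    connectionForm 2 0 z (lift z a (adapted η₀ η₁ τ z.1 a p q)) = p ∧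
      connectionForm 2 1 z (lift z a (adapted η₀ η₁ τ z.1 a p q)) = q := by
  have h := components_lift hz a (adapted η₀ η₁ τ z.1 a p q)
  have h4 := congrFun h 4
  have h5 := congrFun h 5
  simp [components, adapted] at h4 h5
  exact ⟨h4, h5⟩

/-- The structure equation dω³ = -ω³₁ ∧ ω¹ - ω³₂ ∧ ω², restricted to vectors annihilated by the
system, where ω¹ = η¹ and ω² = η². -/
theorem dForm_system_zero (hz : z ∈ levelSet frameDefect O) (a b : Plane) (p q p' q' : ℝ) :
    dForm (system η₀ η₁ τ 0) z (lift z a (adapted η₀ η₁ τ z.1 a p q))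
      (lift z b (adapted η₀ η₁ τ z.1 b p' q')) =
    -(p * η₀ z.1 b + q * η₁ z.1 b - p' * η₀ z.1 a - q' * η₁ z.1 a) := by
  obtain ⟨x, ρ, e⟩ := z
  obtain ⟨f0, f1, f2, f01, f02, f12⟩ := (frameDefect_eq_zero_iff e x ρ).1 hz.2
  simp only [form_apply] at f0 f1 f2 f01 f02 f12
  rw [show system η₀ η₁ τ 0 = canonicalForm 2 from rfl, dForm_canonicalForm]
  simp [lift, adapted]
  generalize η₀ x a = A0, η₁ x a = A1, η₀ x b = B0, η₁ x b = B1
  linear_combination (p' * A0 - p * B0) * f0 + (q * B1 - q' * A1) * f1 +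
    (p' * A1 - p * B1 + q * B0 - q' * A0) * f01

/-- The structure equation dω¹₂ = -ω³₁ ∧ ω³₂ on such vectors, minus dη¹₂ = -K η¹ ∧ η². Its vanishing
is the Gauss equation of the immersed surface. -/
theorem dForm_system_three (hU : IsCoframe U η₀ η₁ τ K) (hUo : IsOpen U)
    (hz : z ∈ levelSet frameDefect O) (hzU : z.1 ∈ U) (a b : Plane) (p q p' q' : ℝ) :
    dForm (system η₀ η₁ τ 3) z (lift z a (adapted η₀ η₁ τ z.1 a p q))
      (lift z b (adapted η₀ η₁ τ z.1 b p' q')) =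
    -(p * q' - p' * q) + K z.1 * (η₀ z.1 a * η₁ z.1 b - η₀ z.1 b * η₁ z.1 a) := by
  have hτ : DifferentiableAt ℝ τ z.1 :=
    (hU.smooth_conn.contDiffAt (hUo.mem_nhds hzU)).differentiableAt (by simp)
  obtain ⟨L, hL, -⟩ := hasFDerivAt_pull hτ
  rw [show system η₀ η₁ τ 3 = connectionForm 0 1 - pull τ from rfl,
    dForm_sub (differentiable_connectionForm 0 1 z) hL.differentiableAt, dForm_pull hτ,
    dForm_connectionForm]
  rw [show (lift z a (adapted η₀ η₁ τ z.1 a p q)).1 = a from rfl,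
    show (lift z b (adapted η₀ η₁ τ z.1 b p' q')).1 = b from rfl, hU.d_conn _ hzU]
  obtain ⟨x, ρ, e⟩ := z
  obtain ⟨f0, f1, f2, f01, f02, f12⟩ := (frameDefect_eq_zero_iff e x ρ).1 hz.2
  simp only [form_apply] at f0 f1 f2 f01 f02 f12
  simp [lift, adapted]
  generalize τ x a = A0, τ x b = B0
  linear_combination (p * q' - p' * q) * f2 + (A0 * q' - B0 * q) * f12 + (p * B0 - p' * A0) * f02

/-- The two characteristic distributions of the system: the vectors over `a` with
`ω^3_1 = κ η^2`, `ω^3_2 = -κ η^1`. -/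
def characteristic (η₀ η₁ τ : OneForm Plane) (κ : ℝ) (z : Ambient) (a : Plane) : Ambient :=
  lift z a (adapted η₀ η₁ τ z.1 a (κ * η₁ z.1 a) (-(κ * η₀ z.1 a)))

theorem quadForm_two {E : Type*} [NormedAddCommGroup E] [NormedSpace ℝ E] (σ : Fin 2 → OneForm E)
    (C : Fin 2 → Fin 2 → E → ℝ) (x v w : E) : quadForm σ C x v w =
      (C 0 1 x - C 1 0 x) * (σ 0 x v * σ 1 x w - σ 0 x w * σ 1 x v) := by
  simp [quadForm, Fin.sum_univ_two]
  ring

/-- The singular systems of a decomposition are the characteristic distributions. -/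
theorem characteristic_of_isDecomposition (hU : IsCoframe U η₀ η₁ τ K) (hUo : IsOpen U)
    {p q s t : ℕ} {σh : Fin p → OneForm Ambient} {σc : Fin q → OneForm Ambient}
    {Ch : Fin s → Fin p → Fin p → Ambient → ℝ} {Cc : Fin t → Fin q → Fin q → Ambient → ℝ}
    (hD : IsDecomposition frameDefect O (system η₀ η₁ τ) σh σc Ch Cc)
    (hz : z ∈ levelSet frameDefect O) (hzU : z.1 ∈ U) {k : ℝ} (hk : k ≠ 0)
    (hK : K z.1 = -k ^ 2) :
    (∀ a, (∀ i, σc i z (characteristic η₀ η₁ τ k z a) = 0) ∧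
        ∀ i, σh i z (characteristic η₀ η₁ τ (-k) z a) = 0) ∨
      (∀ a, (∀ i, σc i z (characteristic η₀ η₁ τ (-k) z a) = 0) ∧
        ∀ i, σh i z (characteristic η₀ η₁ τ k z a) = 0) := by
  have hsurj := exists_apply_eq_of_linearIndependent (hD.linearIndependent z hz)
  -- The members of the coframe are independent covectors on a space of dimension at most 8.
  have hcard : 4 + (p + q) ≤ 8 := by
    have h1 : FiniteDimensional ℝ (tangent frameDefect z) := inferInstance
    have h2 := LinearMap.finrank_le_finrank_of_surjective hsurj
    simp at h2
    exact h2.trans (finrank_tangent_le hz)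
  have hp := hD.two_le_p
  have hq := hD.two_le_q
  obtain rfl : p = 2 := by omega
  obtain rfl : q = 2 := by omega
  set V := ann frameDefect (Set.range (system η₀ η₁ τ)) z with hV
  -- Vectors dual to the σ's can be chosen in the annihilator of the θ's.
  have hdual (c : Fin 4 ⊕ Fin 2 ⊕ Fin 2) (hc : ∀ i, Sum.inl i ≠ c) : ∃ v : V,
      ∀ j : Fin 2 ⊕ Fin 2, (Sum.elim σh σc j) z v = if Sum.inr j = c then 1 else 0 := by
    obtain ⟨v, hv⟩ := hsurj (Pi.single c 1)
    have hv' (i) := congrFun hv i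
    simp only [LinearMap.pi_apply, Pi.single_apply] at hv'
    refine ⟨⟨v, (mem_ann_iff v).2 ?_⟩, fun j => hv' (Sum.inr j)⟩
    rintro _ ⟨i, rfl⟩
    have := hv' (Sum.inl i)
    rw [if_neg (hc i)] at this
    exact this
  obtain ⟨v₀, hv₀⟩ := hdual (Sum.inr (Sum.inl 0)) (by simp)
  obtain ⟨v₁, hv₁⟩ := hdual (Sum.inr (Sum.inl 1)) (by simp)
  obtain ⟨w₀, hw₀⟩ := hdual (Sum.inr (Sum.inr 0)) (by simp)
  obtain ⟨w₁, hw₁⟩ := hdual (Sum.inr (Sum.inr 1)) (by simp)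
  have hspan : ∀ B ∈ modSpan frameDefect (Set.range (system η₀ η₁ τ))
      (Set.range fun i => dForm (system η₀ η₁ τ i)) z, ∃ a b : ℝ, ∀ v w : V,
      B v w = a * (σh 0 z v * σh 1 z w - σh 0 z w * σh 1 z v) +
        b * (σc 0 z v * σc 1 z w - σc 0 z w * σc 1 z v) := by
    rw [hD.generated z hz]
    intro B hB
    induction hB using Submodule.span_induction with
    | mem B hB =>
      obtain ⟨Ω, hΩ | hΩ, rfl⟩ := hB
      · obtain ⟨b, rfl⟩ := hΩ
        exact ⟨Ch b 0 1 z - Ch b 1 0 z, 0, fun v w => by simp only [quadForm_two]; ring⟩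
      · obtain ⟨b, rfl⟩ := hΩ
        exact ⟨0, Cc b 0 1 z - Cc b 1 0 z, fun v w => by simp only [quadForm_two]; ring⟩
    | zero => exact ⟨0, 0, fun v w => by simp⟩
    | add B B' _ _ h1 h2 =>
      obtain ⟨a, b, h1⟩ := h1
      obtain ⟨a', b', h2⟩ := h2
      exact ⟨a + a', b + b', fun v w => by simp only [Pi.add_apply, h1, h2]; ring⟩
    | smul r B _ h1 =>
      obtain ⟨a, b, h1⟩ := h1
      exact ⟨r * a, r * b, fun v w => by simp only [Pi.smul_apply, smul_eq_mul, h1]; ring⟩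
  obtain ⟨a0, b0, hB0⟩ := hspan _ (Submodule.subset_span ⟨_, ⟨0, rfl⟩, rfl⟩)
  obtain ⟨a3, b3, hB3⟩ := hspan _ (Submodule.subset_span ⟨_, ⟨3, rfl⟩, rfl⟩)
  have hVv (v : V) := eq_lift_adapted (η₀ := η₀) (η₁ := η₁) (τ := τ) hz v.1.2
    fun i => (mem_ann_iff v.1).1 v.2 _ ⟨i, rfl⟩
  let P : V → ℝ := fun v => connectionForm 2 0 z v
  let Q : V → ℝ := fun v => connectionForm 2 1 z v
  let A : V → ℝ := fun v => η₀ z.1 (v : Ambient).1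
  let B : V → ℝ := fun v => η₁ z.1 (v : Ambient).1
  have hd0 (v w : V) : dForm (system η₀ η₁ τ 0) z v w =
      -(P v * A w + Q v * B w - P w * A v - Q w * B v) := by
    rw [hVv v, hVv w, dForm_system_zero hz]
  have hd3 (v w : V) : dForm (system η₀ η₁ τ 3) z v w =
      -(P v * Q w - P w * Q v) - k ^ 2 * (A v * B w - A w * B v) := by
    rw [hVv v, hVv w, dForm_system_three hU hUo hz hzU, hK]
    ring
  have hX (κ : ℝ) (a : Plane) : ∃ v : V, (v : Ambient) = characteristic η₀ η₁ τ κ z a ∧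
      P v = κ * B v ∧ Q v = -(κ * A v) ∧ A v = η₀ z.1 a ∧ B v = η₁ z.1 a := by
    refine ⟨⟨⟨characteristic η₀ η₁ τ κ z a, lift_mem_tangent hz _ _⟩, (mem_ann_iff _).2 ?_⟩,
      rfl, ?_, ?_, rfl, rfl⟩
    · rintro _ ⟨i, rfl⟩
      exact system_apply_adapted hz i _ _ _
    · exact (components_adapted hz _ _ _).1
    · exact (components_adapted hz _ _ _).2
  obtain ⟨α, β, hα0, hα1, hβ0, hβ1⟩ := hU.exists_dual _ hzU
  obtain ⟨x₀, -, hx0P, hx0Q, hx0A, hx0B⟩ := hX (-k) α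
  obtain ⟨x₁, -, hx1P, hx1Q, hx1A, hx1B⟩ := hX (-k) β
  obtain ⟨y₀, -, hy0P, hy0Q, hy0A, hy0B⟩ := hX k α
  obtain ⟨y₁, -, hy1P, hy1Q, hy1A, hy1B⟩ := hX k β
  have hkk : k * k ≠ 0 := mul_ne_zero hk hk
  -- Since dθ₀ = -(P∧A + Q∧B) and dθ₃ = -P∧Q - k² A∧B, the combinations -dθ₃ ∓ k dθ₀ factor as (P ∓
  -- kB) ∧ (Q ± kA). The vectors `x₀, x₁` of the distribution for -k and `y₀, y₁` of that for k show
  -- that neither product is zero. As `μ'` and `ν'` vanish at `x₀`, the products are not multiples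
  -- of the same factor.
  have := splitting_of_decomposable (V := V) (s := fun v => σh 0 z v) (s' := fun v => σh 1 z v)
    (t := fun v => σc 0 z v) (t' := fun v => σc 1 z v)
    (μ := fun v => P v - k * B v) (ν := fun v => Q v + k * A v)
    (μ' := fun v => P v + k * B v) (ν' := fun v => Q v - k * A v)
    (v₀ := v₀) (v₁ := v₁) (w₀ := w₀) (w₁ := w₁)
    (a := -a3 - k * a0) (b := -b3 - k * b0) (a' := -a3 + k * a0) (b' := -b3 + k * b0)
    (x₀ := x₀) (x₁ := x₁) (y₀ := y₀) (y₁ := y₁)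
    ⟨by simpa using hv₀ (Sum.inl 0), by simpa using hv₁ (Sum.inl 0),
      by simpa using hw₀ (Sum.inl 0), by simpa using hw₁ (Sum.inl 0)⟩
    ⟨by simpa using hv₀ (Sum.inl 1), by simpa using hv₁ (Sum.inl 1),
      by simpa using hw₀ (Sum.inl 1), by simpa using hw₁ (Sum.inl 1)⟩
    ⟨by simpa using hv₀ (Sum.inr 0), by simpa using hv₁ (Sum.inr 0),
      by simpa using hw₀ (Sum.inr 0), by simpa using hw₁ (Sum.inr 0)⟩
    ⟨by simpa using hv₀ (Sum.inr 1), by simpa using hv₁ (Sum.inr 1),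
      by simpa using hw₀ (Sum.inr 1), by simpa using hw₁ (Sum.inr 1)⟩
    (fun v w => by
      have e0 := hB0 v w
      have e3 := hB3 v w
      simp only [hd0, hd3] at e0 e3
      linear_combination -e3 - k * e0)
    (fun v w => by
      have e0 := hB0 v w
      have e3 := hB3 v w
      simp only [hd0, hd3] at e0 e3
      linear_combination -e3 + k * e0)
    ⟨by rw [hx0P]; ring, by rw [hx0Q]; ring⟩
    (by
      rw [hx0P, hx0Q, hx1P, hx1Q, hx0A, hx0B, hx1A, hx1B, hα0, hα1, hβ0, hβ1]
      ring_nf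
      simpa using hk)
    (by
      rw [hy0P, hy0Q, hy1P, hy1Q, hy0A, hy0B, hy1A, hy1B, hα0, hα1, hβ0, hβ1]
      ring_nf
      simpa using hk)
  have fin2 {P : Fin 2 → Prop} (h : P 0 ∧ P 1) : ∀ i, P i := by
    intro i; fin_cases i; exacts [h.1, h.2]
  rcases this with ⟨h1, h2⟩ | ⟨h1, h2⟩
  · right
    intro a
    obtain ⟨v, hv, hvP, hvQ, -⟩ := hX k a
    obtain ⟨w, hw, hwP, hwQ, -⟩ := hX (-k) a
    rw [← hv, ← hw]
    exact ⟨fin2 (h2 w (by rw [hwP]; ring) (by rw [hwQ]; ring)),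
      fin2 (h1 v (by rw [hvP]; ring) (by rw [hvQ]; ring))⟩
  · left
    intro a
    obtain ⟨v, hv, hvP, hvQ, -⟩ := hX k a
    obtain ⟨w, hw, hwP, hwQ, -⟩ := hX (-k) a
    rw [← hv, ← hw]
    exact ⟨fin2 (h1 v (by rw [hvP]; ring) (by rw [hvQ]; ring)),
      fin2 (h2 w (by rw [hwP]; ring) (by rw [hwQ]; ring))⟩

end Lorentz

/-! ### The frame adapted to a Killing field and the Gauss equation. -/

namespace Lorentz

open EDS Minkowski

/-- A Killing field `X` of length `G` (in the spacelike direction), with the unit vector field `n`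
orthogonal to it, in terms of the hyperbolic rotation `r₀, r₁` from a given coframe. -/
structure IsKillingFrame (U : Set Plane) (η₀ η₁ : OneForm Plane) (n X : Plane → Plane)
    (G r₀ r₁ : Plane → ℝ) : Prop where
  smooth_n : ContDiffOn ℝ ∞ n U
  smooth_X : ContDiffOn ℝ ∞ X U
  smooth_G : ContDiffOn ℝ ∞ G U
  smooth_r₀ : ContDiffOn ℝ ∞ r₀ U
  smooth_r₁ : ContDiffOn ℝ ∞ r₁ U
  pos : ∀ x ∈ U, 0 < G x
  sq_sub_sq : ∀ x ∈ U, r₀ x ^ 2 - r₁ x ^ 2 = 1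
  zero_n : ∀ x ∈ U, η₀ x (n x) = r₀ x
  one_n : ∀ x ∈ U, η₁ x (n x) = r₁ x
  zero_X : ∀ x ∈ U, η₀ x (X x) = G x * r₁ x
  one_X : ∀ x ∈ U, η₁ x (X x) = G x * r₀ x
  commute : ∀ x ∈ U, fderiv ℝ X x (n x) = fderiv ℝ n x (X x)
  invariant_G : ∀ x ∈ U, fderiv ℝ G x (X x) = 0

variable {U : Set Plane} {η₀ η₁ τ : OneForm Plane} {K : Plane → ℝ} {n X : Plane → Plane}
  {G r₀ r₁ : Plane → ℝ}

theorem differentiableAt_of_contDiffOn {E F : Type*} [NormedAddCommGroup E] [NormedSpace ℝ E]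
    [NormedAddCommGroup F] [NormedSpace ℝ F] {f : E → F} {U : Set E} (hU : IsOpen U)
    (hf : ContDiffOn ℝ ∞ f U) {x : E} (hx : x ∈ U) : DifferentiableAt ℝ f x :=
  (hf.contDiffAt (hU.mem_nhds hx)).differentiableAt (by simp)

theorem contDiffOn_fderiv_apply {E F : Type*} [NormedAddCommGroup E] [NormedSpace ℝ E]
    [NormedAddCommGroup F] [NormedSpace ℝ F] {f : E → F} {v : E → E} {U : Set E} (hU : IsOpen U)
    (hf : ContDiffOn ℝ ∞ f U) (hv : ContDiffOn ℝ ∞ v U) :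
    ContDiffOn ℝ ∞ (fun x => fderiv ℝ f x (v x)) U :=
  (hf.fderiv_of_isOpen hU (by simp)).clm_apply hv

/-- Derivatives along commuting vector fields commute. -/
theorem fderiv_fderiv_comm {E : Type*} [NormedAddCommGroup E] [NormedSpace ℝ E] {U : Set E}
    {n X : E → E} (hU : IsOpen U) (hn : ContDiffOn ℝ ∞ n U) (hX : ContDiffOn ℝ ∞ X U)
    (hc : ∀ x ∈ U, fderiv ℝ X x (n x) = fderiv ℝ n x (X x)) {q : E → ℝ}
    (hq : ContDiffOn ℝ ∞ q U) {x : E} (hx : x ∈ U) :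
    fderiv ℝ (fun y => fderiv ℝ q y (n y)) x (X x) =
      fderiv ℝ (fun y => fderiv ℝ q y (X y)) x (n x) := by
  have h := VectorField.fderiv_apply_lieBracket (𝕜 := ℝ) (x := x) (V := n) (W := X)
    (hq.contDiffAt (hU.mem_nhds hx)) (by
      simp only [minSmoothness_of_isRCLikeNormedField]
      exact WithTop.coe_le_coe.2 (le_top : (2 : ℕ∞) ≤ ⊤))
    (differentiableAt_of_contDiffOn hU hX hx) (differentiableAt_of_contDiffOn hU hn hx)
  rw [VectorField.lieBracket_eq] at h
  simp only [hc x hx, sub_self, map_zero] at h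
  linarith

/-- The exterior derivative on two vector fields. -/
theorem dForm_apply_fields {E : Type*} [NormedAddCommGroup E] [NormedSpace ℝ E] {ζ : OneForm E}
    {n X : E → E} {x : E} (hζ : DifferentiableAt ℝ ζ x) (hn : DifferentiableAt ℝ n x)
    (hX : DifferentiableAt ℝ X x) (hc : fderiv ℝ X x (n x) = fderiv ℝ n x (X x)) :
    dForm ζ x (n x) (X x) = fderiv ℝ (fun y => ζ y (X y)) x (n x) -
      fderiv ℝ (fun y => ζ y (n y)) x (X x) := by
  rw [fderiv_clm_apply hζ hX, fderiv_clm_apply hζ hn, dForm]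
  simp [hc]

theorem fderiv_congr_on {E F : Type*} [NormedAddCommGroup E] [NormedSpace ℝ E]
    [NormedAddCommGroup F] [NormedSpace ℝ F] {f g : E → F} {U : Set E} (hU : IsOpen U)
    (h : ∀ x ∈ U, f x = g x) {x : E} (hx : x ∈ U) : fderiv ℝ f x = fderiv ℝ g x :=
  Filter.EventuallyEq.fderiv_eq (Filter.eventuallyEq_of_mem (hU.mem_nhds hx) h)

theorem eq_zero_of_dual {ζ ξ : Plane →L[ℝ] ℝ} {a b c : Plane} (hb0 : ζ b = 1) (hb1 : ξ b = 0)
    (hc0 : ζ c = 0) (hc1 : ξ c = 1) (h0 : ζ a = 0) (h1 : ξ a = 0) : a = 0 := by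
  let f : Plane →ₗ[ℝ] ℝ × ℝ := ζ.toLinearMap.prod ξ.toLinearMap
  have hs : Function.Surjective f := by
    rintro ⟨s, t⟩
    refine ⟨s • b + t • c, ?_⟩
    simp [f, hb0, hb1, hc0, hc1]
  have hi : Function.Injective f :=
    (LinearMap.injective_iff_surjective_of_finrank_eq_finrank (by simp)).2 hs
  exact hi (by simp [f, h0, h1])

theorem IsCoframe.eq_zero (hC : IsCoframe U η₀ η₁ τ K) {x : Plane} (hx : x ∈ U) {a : Plane}
    (h0 : η₀ x a = 0) (h1 : η₁ x a = 0) : a = 0 := by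
  obtain ⟨b, c, hb0, hb1, hc0, hc1⟩ := hC.exists_dual x hx
  exact eq_zero_of_dual hb0 hb1 hc0 hc1 h0 h1

namespace IsKillingFrame

/-- The 1-form dual to `n`. -/
def dualN (η₀ η₁ : OneForm Plane) (r₀ r₁ : Plane → ℝ) : OneForm Plane :=
  fun x => r₀ x • η₀ x - r₁ x • η₁ x

/-- The 1-form dual to `X`. -/
def dualX (η₀ η₁ : OneForm Plane) (G r₀ r₁ : Plane → ℝ) : OneForm Plane :=
  fun x => (G x)⁻¹ • (r₀ x • η₁ x - r₁ x • η₀ x)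

theorem dualN_n (h : IsKillingFrame U η₀ η₁ n X G r₀ r₁) {x : Plane} (hx : x ∈ U) :
    dualN η₀ η₁ r₀ r₁ x (n x) = 1 := by
  simp [dualN, h.zero_n x hx, h.one_n x hx]
  linarith [h.sq_sub_sq x hx]

theorem dualN_X (h : IsKillingFrame U η₀ η₁ n X G r₀ r₁) {x : Plane} (hx : x ∈ U) :
    dualN η₀ η₁ r₀ r₁ x (X x) = 0 := by
  simp [dualN, h.zero_X x hx, h.one_X x hx]
  ring

theorem dualX_n (h : IsKillingFrame U η₀ η₁ n X G r₀ r₁) {x : Plane} (hx : x ∈ U) :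
    dualX η₀ η₁ G r₀ r₁ x (n x) = 0 := by
  simp [dualX, h.zero_n x hx, h.one_n x hx]
  right
  ring

theorem dualX_X (h : IsKillingFrame U η₀ η₁ n X G r₀ r₁) {x : Plane} (hx : x ∈ U) :
    dualX η₀ η₁ G r₀ r₁ x (X x) = 1 := by
  have := h.pos x hx
  simp [dualX, h.zero_X x hx, h.one_X x hx]
  field_simp
  linarith [h.sq_sub_sq x hx]

theorem eq_smul_add_smul (h : IsKillingFrame U η₀ η₁ n X G r₀ r₁) (hC : IsCoframe U η₀ η₁ τ K)
    {x : Plane} (hx : x ∈ U) (a : Plane) :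
    a = dualN η₀ η₁ r₀ r₁ x a • n x + dualX η₀ η₁ G r₀ r₁ x a • X x := by
  rw [← sub_eq_zero]
  have hG := (h.pos x hx).ne'
  have h2 := h.sq_sub_sq x hx
  refine hC.eq_zero hx ?_ ?_
  · simp [dualN, dualX, h.zero_n x hx, h.zero_X x hx]
    field_simp
    linear_combination (-η₀ x a) * h2
  · simp [dualN, dualX, h.one_n x hx, h.one_X x hx]
    field_simp
    linear_combination (-η₁ x a) * h2

/-- The derivative of an invariant function. -/
theorem hasFDerivAt_of_invariant (h : IsKillingFrame U η₀ η₁ n X G r₀ r₁)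
    (hC : IsCoframe U η₀ η₁ τ K) (hU : IsOpen U) {q : Plane → ℝ} (hq : ContDiffOn ℝ ∞ q U)
    (hqX : ∀ x ∈ U, fderiv ℝ q x (X x) = 0) {x : Plane} (hx : x ∈ U) :
    HasFDerivAt q (fderiv ℝ q x (n x) • dualN η₀ η₁ r₀ r₁ x) x := by
  have e : fderiv ℝ q x (n x) • dualN η₀ η₁ r₀ r₁ x = fderiv ℝ q x := by
    refine ContinuousLinearMap.ext fun a => ?_
    conv_rhs => rw [h.eq_smul_add_smul hC hx a]
    simp [hqX x hx]
    ring
  rw [e]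
  exact (differentiableAt_of_contDiffOn hU hq hx).hasFDerivAt

/-- The derivative along `n` of an invariant function is invariant. -/
theorem invariant_fderiv (h : IsKillingFrame U η₀ η₁ n X G r₀ r₁) (hU : IsOpen U)
    {q : Plane → ℝ} (hq : ContDiffOn ℝ ∞ q U) (hqX : ∀ x ∈ U, fderiv ℝ q x (X x) = 0)
    {x : Plane} (hx : x ∈ U) : fderiv ℝ (fun y => fderiv ℝ q y (n y)) x (X x) = 0 := by
  rw [fderiv_fderiv_comm hU h.smooth_n h.smooth_X h.commute hq hx, fderiv_congr_on hU hqX hx]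
  simp

/-- How the rotation from the coframe to the frame `n, X / G` varies. -/
theorem fderiv_rotation (h : IsKillingFrame U η₀ η₁ n X G r₀ r₁)
    (hC : IsCoframe U η₀ η₁ τ K) (hU : IsOpen U) {x : Plane} (hx : x ∈ U) :
    fderiv ℝ r₀ x (n x) = -τ x (n x) * r₁ x ∧ fderiv ℝ r₁ x (n x) = -τ x (n x) * r₀ x ∧
      fderiv ℝ r₀ x (X x) = (fderiv ℝ G x (n x) - τ x (X x)) * r₁ x ∧
      fderiv ℝ r₁ x (X x) = (fderiv ℝ G x (n x) - τ x (X x)) * r₀ x := by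
  have hn := differentiableAt_of_contDiffOn hU h.smooth_n hx
  have hX := differentiableAt_of_contDiffOn hU h.smooth_X hx
  have hG := differentiableAt_of_contDiffOn hU h.smooth_G hx
  have hr0 := differentiableAt_of_contDiffOn hU h.smooth_r₀ hx
  have hr1 := differentiableAt_of_contDiffOn hU h.smooth_r₁ hx
  have e0 := dForm_apply_fields (differentiableAt_of_contDiffOn hU hC.smooth_zero hx) hn hX
    (h.commute x hx)
  have e1 := dForm_apply_fields (differentiableAt_of_contDiffOn hU hC.smooth_one hx) hn hX
    (h.commute x hx)
  rw [hC.d_zero x hx, fderiv_congr_on hU h.zero_X hx, fderiv_congr_on hU h.zero_n hx,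
    h.one_n x hx, h.one_X x hx, fderiv_fun_mul hG hr1] at e0
  rw [hC.d_one x hx, fderiv_congr_on hU h.one_X hx, fderiv_congr_on hU h.one_n hx,
    h.zero_n x hx, h.zero_X x hx, fderiv_fun_mul hG hr0] at e1
  have e2 := fderiv_congr_on hU h.sq_sub_sq hx
  rw [fderiv_fun_sub (hr0.fun_pow 2) (hr1.fun_pow 2), fderiv_fun_pow 2 hr0, fderiv_fun_pow 2 hr1]
      at e2
  have e2n := congrArg (fun L => L (n x)) e2
  have e2X := congrArg (fun L => L (X x)) e2
  simp at e0 e1 e2n e2X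
  have h2 := h.sq_sub_sq x hx
  have hGp := (h.pos x hx).ne'
  generalize fderiv ℝ r₀ x (n x) = a0, fderiv ℝ r₁ x (n x) = a1, fderiv ℝ r₀ x (X x) = b0,
    fderiv ℝ r₁ x (X x) = b1, τ x (n x) = tn, τ x (X x) = tX, fderiv ℝ G x (n x) = G1,
    r₀ x = R0, r₁ x = R1, G x = g at *
  -- the values of the 1-form `r₀ dr₁ - r₁ dr₀`
  set dn := R0 * a1 - R1 * a0 with hdn
  set dX := R0 * b1 - R1 * b0 with hdX
  -- By r₀² - r₁² = 1 the differentials of r₀, r₁ are r₁, r₀ times that of the hyperbolic angle. The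
  -- structure equations evaluated on (n, X) then determine its two values.
  have ha0 : a0 = dn * R1 := by rw [hdn]; linear_combination (-a0) * h2 + (R0 / 2) * e2n
  have ha1 : a1 = dn * R0 := by rw [hdn]; linear_combination (-a1) * h2 + (R1 / 2) * e2n
  have hb0 : b0 = dX * R1 := by rw [hdX]; linear_combination (-b0) * h2 + (R0 / 2) * e2X
  have hb1 : b1 = dX * R0 := by rw [hdX]; linear_combination (-b1) * h2 + (R1 / 2) * e2X
  clear_value dn dX
  subst ha0 ha1 hb0 hb1
  have k1 : dn = -tn := by
    apply mul_left_cancel₀ hGp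
    linear_combination (-R0) * e0 + R1 * e1 - (g * dn + g * tn) * h2
  have k2 : dX = G1 - tX := by
    linear_combination (-R1) * e0 + R0 * e1 - (dX + tX - G1) * h2
  rw [k1, k2]
  exact ⟨rfl, rfl, rfl, rfl⟩

/-- The Gauss equation for the norm of a Killing field, and the closedness of the change of
connection forms. -/
theorem gauss (h : IsKillingFrame U η₀ η₁ n X G r₀ r₁)
    (hC : IsCoframe U η₀ η₁ τ K) (hU : IsOpen U) {x : Plane} (hx : x ∈ U) :
    fderiv ℝ (fun y => τ y (X y) - fderiv ℝ G y (n y)) x (n x) =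
        fderiv ℝ (fun y => τ y (n y)) x (X x) ∧
      fderiv ℝ (fun y => fderiv ℝ G y (n y)) x (n x) = -K x * G x := by
  have hn := differentiableAt_of_contDiffOn hU h.smooth_n hx
  have hX := differentiableAt_of_contDiffOn hU h.smooth_X hx
  have hτ := differentiableAt_of_contDiffOn hU hC.smooth_conn hx
  have hr0 := differentiableAt_of_contDiffOn hU h.smooth_r₀ hx
  have hr1 := differentiableAt_of_contDiffOn hU h.smooth_r₁ hx
  have hG1 := differentiableAt_of_contDiffOn hU (contDiffOn_fderiv_apply hU h.smooth_G h.smooth_n)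
      hx
  have hτn := hτ.clm_apply hn
  have hτX := hτ.clm_apply hX
  have e := dForm_apply_fields hτ hn hX (h.commute x hx)
  rw [hC.d_conn x hx, h.zero_n x hx, h.one_n x hx, h.zero_X x hx, h.one_X x hx] at e
  -- Equality of the mixed derivatives of r₁ along the commuting fields n, X. Terms quadratic in the
  -- connection cancel, and after division by r₀ ≠ 0 the change of connection forms is seen to be
  -- closed.
  have c := fderiv_fderiv_comm hU h.smooth_n h.smooth_X h.commute h.smooth_r₁ hx
  rw [fderiv_congr_on hU (fun y hy => (h.fderiv_rotation hC hU hy).2.1) hx,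
    fderiv_congr_on hU (fun y hy => (h.fderiv_rotation hC hU hy).2.2.2) hx] at c
  have hs := hG1.fun_sub hτX
  rw [fderiv_fun_mul hτn.fun_neg hr0, fderiv_fun_mul hs hr0, fderiv_fun_neg,
    fderiv_fun_sub hG1 hτX] at c
  obtain ⟨p1, -, p3, -⟩ := h.fderiv_rotation hC hU hx
  have h2 := h.sq_sub_sq x hx
  rw [fderiv_fun_sub hτX hG1]
  simp [p1, p3] at c ⊢
  have hr : r₀ x ≠ 0 := by
    intro h0
    rw [h0] at h2
    nlinarith [sq_nonneg (r₁ x)]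
  have key : fderiv ℝ (fun y => τ y (X y)) x (n x) -
      fderiv ℝ (fun y => fderiv ℝ G y (n y)) x (n x) = fderiv ℝ (fun y => τ y (n y)) x (X x) := by
    apply mul_left_cancel₀ hr
    linear_combination c
  refine ⟨key, ?_⟩
  linear_combination -key - e - K x * G x * h2

/-- Derivatives along n of invariant functions are invariant, so G″ is; and G″ = -K G with G
invariant and positive. -/
theorem invariant_K (h : IsKillingFrame U η₀ η₁ n X G r₀ r₁)
    (hC : IsCoframe U η₀ η₁ τ K) (hU : IsOpen U) (hK : ContDiffOn ℝ ∞ K U) {x : Plane}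
    (hx : x ∈ U) : fderiv ℝ K x (X x) = 0 := by
  have h1 := contDiffOn_fderiv_apply hU h.smooth_G h.smooth_n
  have h2 := h.invariant_fderiv hU h1
    (fun y hy => h.invariant_fderiv hU h.smooth_G h.invariant_G hy) hx
  have hKd := differentiableAt_of_contDiffOn hU hK hx
  rw [fderiv_congr_on hU (fun y hy => (h.gauss hC hU hy).2) hx,
    fderiv_fun_mul hKd.fun_neg (differentiableAt_of_contDiffOn hU h.smooth_G hx),
    fderiv_fun_neg] at h2
  simp [h.invariant_G x hx, (h.pos x hx).ne'] at h2
  exact h2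

end IsKillingFrame

end Lorentz

/-! ### The bracket in the moving frame adapted to the Killing field. -/

namespace Lorentz

open EDS Minkowski

/-- The tangent vector with components `c` in the moving frame made up of the lifts of `n` and `X`,
the vectors `e_i` rotated by `r₀, r₁`, and the correspondingly rotated infinitesimal rotations. -/
def gaugeVec (n X : Plane → Plane) (c : Fin 8 → ℝ) (x : Plane) : Plane := c 0 • n x + c 1 • X x

/-- The components of the same vector in the original frame. -/
def gaugeComp (r₀ r₁ s₀ s₁ : Plane → ℝ) (c : Fin 8 → ℝ) (x : Plane) : Fin 6 → ℝ :=
  ![r₀ x * c 2 + r₁ x * c 3, r₁ x * c 2 + r₀ x * c 3, c 4, c 5 + c 0 * s₀ x + c 1 * s₁ x,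
    r₀ x * c 6 - r₁ x * c 7, -(r₁ x * c 6) + r₀ x * c 7]

/-- The components of the Lie bracket of two vector fields with invariant components `c`, `d`, whose
derivatives along `n` are `c'`, `d'`. -/
def bracketTuple (c c' d d' : Fin 8 → ℝ) : Fin 8 → ℝ :=
  ![c 0 * d' 0 - d 0 * c' 0, c 0 * d' 1 - d 0 * c' 1,
    c 0 * d' 2 - d 0 * c' 2 + (c 5 * d 3 + c 6 * d 4 - (d 5 * c 3 + d 6 * c 4)),
    c 0 * d' 3 - d 0 * c' 3 + (c 5 * d 2 - c 7 * d 4 - (d 5 * c 2 - d 7 * c 4)),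
    c 0 * d' 4 - d 0 * c' 4 + (c 6 * d 2 + c 7 * d 3 - (d 6 * c 2 + d 7 * c 3)),
    c 0 * d' 5 - d 0 * c' 5 + (c 6 * d 7 - d 6 * c 7),
    c 0 * d' 6 - d 0 * c' 6 + (c 7 * d 5 - d 7 * c 5),
    c 0 * d' 7 - d 0 * c' 7 + (c 6 * d 5 - d 6 * c 5)]

section Pointwise

variable {n X : Plane → Plane} {r₀ r₁ s₀ s₁ : Plane → ℝ} {z : Ambient} {α : Plane →L[ℝ] ℝ}
  {Dn DX : Plane →L[ℝ] Plane} {R₀ R₁ S₀ S₁ : Plane →L[ℝ] ℝ} {c d : Plane → Fin 8 → ℝ}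
  {c' d' : Fin 8 → ℝ}

theorem hasFDerivAt_vec_six {E : Type*} [NormedAddCommGroup E] [NormedSpace ℝ E]
    {f₀ f₁ f₂ f₃ f₄ f₅ : E → ℝ} {L₀ L₁ L₂ L₃ L₄ L₅ : E →L[ℝ] ℝ} {x : E}
    (h₀ : HasFDerivAt f₀ L₀ x) (h₁ : HasFDerivAt f₁ L₁ x) (h₂ : HasFDerivAt f₂ L₂ x)
    (h₃ : HasFDerivAt f₃ L₃ x) (h₄ : HasFDerivAt f₄ L₄ x) (h₅ : HasFDerivAt f₅ L₅ x) :
    HasFDerivAt (fun x => ![f₀ x, f₁ x, f₂ x, f₃ x, f₄ x, f₅ x])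
      (ContinuousLinearMap.pi ![L₀, L₁, L₂, L₃, L₄, L₅]) x := by
  refine hasFDerivAt_pi.2 fun i => ?_
  fin_cases i
  exacts [h₀, h₁, h₂, h₃, h₄, h₅]

theorem hasFDerivAt_gaugeVec {x : Plane} (hn : HasFDerivAt n Dn x) (hX : HasFDerivAt X DX x)
    (hc : HasFDerivAt c (α.smulRight c') x) :
    ∃ L : Plane →L[ℝ] Plane, HasFDerivAt (fun x => gaugeVec n X (c x) x) L x ∧
      ∀ w, L w = c x 0 • Dn w + (α w * c' 0) • n x + (c x 1 • DX w + (α w * c' 1) • X x) := by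
  have h (i) := hasFDerivAt_pi'.1 hc i
  refine ⟨_, ((h 0).smul hn).add ((h 1).smul hX), fun w => ?_⟩
  simp

theorem hasFDerivAt_gaugeComp {x : Plane}
    (hr₀ : HasFDerivAt r₀ R₀ x) (hr₁ : HasFDerivAt r₁ R₁ x) (hs₀ : HasFDerivAt s₀ S₀ x)
    (hs₁ : HasFDerivAt s₁ S₁ x) (hc : HasFDerivAt c (α.smulRight c') x) :
    ∃ L : Plane →L[ℝ] Fin 6 → ℝ, HasFDerivAt (fun x => gaugeComp r₀ r₁ s₀ s₁ (c x) x) L x ∧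
      ∀ w, L w = ![R₀ w * c x 2 + r₀ x * (α w * c' 2) + (R₁ w * c x 3 + r₁ x * (α w * c' 3)),
        R₁ w * c x 2 + r₁ x * (α w * c' 2) + (R₀ w * c x 3 + r₀ x * (α w * c' 3)),
        α w * c' 4,
        α w * c' 5 + (c x 0 * S₀ w + α w * c' 0 * s₀ x) + (c x 1 * S₁ w + α w * c' 1 * s₁ x),
        R₀ w * c x 6 + r₀ x * (α w * c' 6) - (R₁ w * c x 7 + r₁ x * (α w * c' 7)),
        -(R₁ w * c x 6 + r₁ x * (α w * c' 6)) + (R₀ w * c x 7 + r₀ x * (α w * c' 7))] := by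
  have h (i) := hasFDerivAt_pi'.1 hc i
  have h0 := (hr₀.mul (h 2)).add (hr₁.mul (h 3))
  have h1 := (hr₁.mul (h 2)).add (hr₀.mul (h 3))
  have h3 := ((h 5).add ((h 0).mul hs₀)).add ((h 1).mul hs₁)
  have h4 := (hr₀.mul (h 6)).sub (hr₁.mul (h 7))
  have h5 := (hr₁.mul (h 6)).neg.add (hr₀.mul (h 7))
  refine ⟨_, hasFDerivAt_vec_six h0 h1 (h 4) h3 h4 h5, fun w => ?_⟩
  funext i
  fin_cases i <;> simp <;> ring

/-- The frame rotates by the closed form with values -s₀, -s₁ on n, X. The shift of the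
ω¹₂-component by `c 0 * s₀ + c 1 * s₁` compensates this rotation. As n and X commute, only the
derivatives of the components along n and the bracket of the isometry algebra remain, and r₀, r₁,
s₀, s₁ do not enter the resulting tuple. -/
theorem bracket_gauge (hn : HasFDerivAt n Dn z.1) (hX : HasFDerivAt X DX z.1)
    (hr₀ : HasFDerivAt r₀ R₀ z.1) (hr₁ : HasFDerivAt r₁ R₁ z.1) (hs₀ : HasFDerivAt s₀ S₀ z.1)
    (hs₁ : HasFDerivAt s₁ S₁ z.1) (hαn : α (n z.1) = 1) (hαX : α (X z.1) = 0)
    (hcomm : DX (n z.1) = Dn (X z.1)) (hS : S₁ (n z.1) = S₀ (X z.1))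
    (hR₀n : R₀ (n z.1) = -s₀ z.1 * r₁ z.1) (hR₁n : R₁ (n z.1) = -s₀ z.1 * r₀ z.1)
    (hR₀X : R₀ (X z.1) = -s₁ z.1 * r₁ z.1) (hR₁X : R₁ (X z.1) = -s₁ z.1 * r₀ z.1)
    (hrr : r₀ z.1 ^ 2 - r₁ z.1 ^ 2 = 1)
    (hc : HasFDerivAt c (α.smulRight c') z.1) (hd : HasFDerivAt d (α.smulRight d') z.1) :
    fderiv ℝ (fun y : Ambient => lift y (gaugeVec n X (d y.1) y.1)
        (gaugeComp r₀ r₁ s₀ s₁ (d y.1) y.1)) z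
        (lift z (gaugeVec n X (c z.1) z.1) (gaugeComp r₀ r₁ s₀ s₁ (c z.1) z.1)) -
      fderiv ℝ (fun y : Ambient => lift y (gaugeVec n X (c y.1) y.1)
        (gaugeComp r₀ r₁ s₀ s₁ (c y.1) y.1)) z
        (lift z (gaugeVec n X (d z.1) z.1) (gaugeComp r₀ r₁ s₀ s₁ (d z.1) z.1)) =
    lift z (gaugeVec n X (bracketTuple (c z.1) c' (d z.1) d') z.1)
      (gaugeComp r₀ r₁ s₀ s₁ (bracketTuple (c z.1) c' (d z.1) d') z.1) := by
  obtain ⟨La, hLa, hLa'⟩ := hasFDerivAt_gaugeVec hn hX hc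
  obtain ⟨Lb, hLb, hLb'⟩ := hasFDerivAt_gaugeVec hn hX hd
  obtain ⟨Lu, hLu, hLu'⟩ := hasFDerivAt_gaugeComp hr₀ hr₁ hs₀ hs₁ hc
  obtain ⟨Lv, hLv, hLv'⟩ := hasFDerivAt_gaugeComp hr₀ hr₁ hs₀ hs₁ hd
  have := bracket_lift (z := z) hLa hLu hLb hLv
  refine this.trans ?_
  rw [hLa', hLb', hLu', hLv']
  simp only [gaugeVec, map_add, map_smul, hαn, hαX, hcomm, hS, hR₀n, hR₁n, hR₀X, hR₁X, smul_eq_mul]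
  generalize c z.1 = C, d z.1 = D at *
  congr 1
  · simp only [bracketTuple, Matrix.cons_val_zero, Matrix.cons_val_one]
    module
  · funext i
    fin_cases i <;> simp [isoBracket, gaugeComp, bracketTuple]
    · ring
    · ring
    · linear_combination (C 6 * D 2 + C 7 * D 3 - D 6 * C 2 - D 7 * C 3) * hrr
    · linear_combination (C 6 * D 7 - D 6 * C 7) * hrr
    · ring
    · ring

end Pointwise

end Lorentz

/-! ### Iterated brackets of a characteristic distribution and the differential equation. -/

namespace Lorentz

open EDS Minkowski

/-- `c` has derivative `c' ⊗ α`. -/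
def HasInvDeriv {F : Type*} [NormedAddCommGroup F] [NormedSpace ℝ F] (U : Set Plane)
    (α : OneForm Plane) (c c' : Plane → F) : Prop :=
  ∀ x ∈ U, HasFDerivAt c ((α x).smulRight (c' x)) x

namespace HasInvDeriv

variable {U : Set Plane} {α : OneForm Plane} {q q' r r' : Plane → ℝ}

theorem const (a : ℝ) : HasInvDeriv U α (fun _ => a) fun _ => 0 := fun x _ => by
  simpa using hasFDerivAt_const a x

theorem add (hq : HasInvDeriv U α q q') (hr : HasInvDeriv U α r r') :
    HasInvDeriv U α (fun x => q x + r x) fun x => q' x + r' x := fun x hx => by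
  have h : (α x).smulRight (q' x + r' x) = (α x).smulRight (q' x) + (α x).smulRight (r' x) := by
    ext; simp [mul_add]
  rw [h]
  exact (hq x hx).add (hr x hx)

theorem mul (hq : HasInvDeriv U α q q') (hr : HasInvDeriv U α r r') :
    HasInvDeriv U α (fun x => q x * r x) fun x => q' x * r x + q x * r' x := fun x hx => by
  have h : (α x).smulRight (q' x * r x + q x * r' x) =
      q x • (α x).smulRight (r' x) + r x • (α x).smulRight (q' x) := by
    refine ContinuousLinearMap.ext fun a => ?_
    simp
    ring
  rw [h]
  exact (hq x hx).mul (hr x hx)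

theorem congr (hq : HasInvDeriv U α q q') (h : ∀ x, q x = r x) (h' : ∀ x, q' x = r' x) :
    HasInvDeriv U α r r' := by
  obtain rfl : q = r := funext h
  obtain rfl : q' = r' := funext h'
  exact hq

theorem tuple {c c' : Plane → Fin 8 → ℝ}
    (h : ∀ i, HasInvDeriv U α (fun x => c x i) fun x => c' x i) : HasInvDeriv U α c c' :=
  fun x hx => hasFDerivAt_pi'.2 fun i => by
    have h1 : (ContinuousLinearMap.proj i).comp ((α x).smulRight (c' x)) =
      (α x).smulRight (c' x i) := by
      ext; simp
    rw [h1]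
    exact h i x hx

end HasInvDeriv

theorem lift_gauge_comb (z : Ambient) {n X : Plane → Plane} {r₀ r₁ s₀ s₁ : Plane → ℝ} (a b : ℝ)
    (c d : Fin 8 → ℝ) :
    lift z (gaugeVec n X (a • c + b • d) z.1) (gaugeComp r₀ r₁ s₀ s₁ (a • c + b • d) z.1) =
      a • lift z (gaugeVec n X c z.1) (gaugeComp r₀ r₁ s₀ s₁ c z.1) +
        b • lift z (gaugeVec n X d z.1) (gaugeComp r₀ r₁ s₀ s₁ d z.1) := by
  rw [← lift_smul, ← lift_smul, ← lift_add]
  congr 1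
  · simp [gaugeVec]; module
  · funext i
    fin_cases i <;> simp [gaugeComp] <;> ring

variable {U : Set Plane} {η₀ η₁ τ : OneForm Plane} {K : Plane → ℝ} {n X : Plane → Plane}
  {G r₀ r₁ : Plane → ℝ}

/-- The derivative along `n`. -/
def along (n : Plane → Plane) (q : Plane → ℝ) : Plane → ℝ := fun x => fderiv ℝ q x (n x)

/-- The tangent vector at `z` with components `c` in the frame adapted to the Killing field. -/
def killingLift (τ : OneForm Plane) (n X : Plane → Plane) (G r₀ r₁ : Plane → ℝ) (z : Ambient)
    (c : Fin 8 → ℝ) : Ambient :=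
  lift z (gaugeVec n X c z.1)
    (gaugeComp r₀ r₁ (fun x => τ x (n x)) (fun x => τ x (X x) - along n G x) c z.1)

/-- The forms in the `m`-th derived system annihilate the vector field with components `c`. -/
def Annihilated (O : Set Ambient) (Φ : Set (OneForm Ambient)) (N : Set Ambient) (τ : OneForm Plane)
    (n X : Plane → Plane) (G r₀ r₁ : Plane → ℝ) (m : ℕ) (c : Plane → Fin 8 → ℝ) : Prop :=
  ∀ ζ ∈ derivedFlag frameDefect O Φ m, ∀ y ∈ levelSet frameDefect O, y ∈ N →
    ζ y (killingLift τ n X G r₀ r₁ y (c y.1)) = 0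

namespace Annihilated

variable {O N : Set Ambient} {Φ : Set (OneForm Ambient)} {m : ℕ} {c c' d d' e : Plane → Fin 8 → ℝ}

theorem succ (h : Annihilated O Φ N τ n X G r₀ r₁ m c) :
    Annihilated O Φ N τ n X G r₀ r₁ (m + 1) c :=
  fun ζ hζ => h ζ (derivedFlag_succ_subset m hζ)

theorem comb (hNU : ∀ y ∈ N, y.1 ∈ U) (hc : Annihilated O Φ N τ n X G r₀ r₁ m c)
    (hd : Annihilated O Φ N τ n X G r₀ r₁ m d) (a b : Plane → ℝ)
    (h : ∀ x ∈ U, e x = a x • c x + b x • d x) : Annihilated O Φ N τ n X G r₀ r₁ m e := by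
  intro ζ hζ y hy hyN
  rw [killingLift, h _ (hNU y hyN), lift_gauge_comb, map_add, map_smul, map_smul]
  have h1 := hc ζ hζ y hy hyN
  have h2 := hd ζ hζ y hy hyN
  rw [killingLift] at h1 h2
  rw [h1, h2]
  simp

/-- Taking a bracket costs one step of the derived flag, by Cartan's formula, and in the adapted
frame the bracket is computed by `bracketTuple`. -/
theorem bracket (hC : IsCoframe U η₀ η₁ τ K) (hU : IsOpen U)
    (h : IsKillingFrame U η₀ η₁ n X G r₀ r₁) (hO : IsOpen O) (hN : IsOpen N)
    (hNU : ∀ y ∈ N, y.1 ∈ U)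
    (hc' : HasInvDeriv U (IsKillingFrame.dualN η₀ η₁ r₀ r₁) c c')
    (hd' : HasInvDeriv U (IsKillingFrame.dualN η₀ η₁ r₀ r₁) d d')
    (hc : Annihilated O Φ N τ n X G r₀ r₁ m c) (hd : Annihilated O Φ N τ n X G r₀ r₁ m d) :
    Annihilated O Φ N τ n X G r₀ r₁ (m + 1)
      fun x => bracketTuple (c x) (c' x) (d x) (d' x) := by
  intro ζ hζ z hz hzN
  have hx := hNU z hzN
  have hn := (differentiableAt_of_contDiffOn hU h.smooth_n hx).hasFDerivAt
  have hX := (differentiableAt_of_contDiffOn hU h.smooth_X hx).hasFDerivAt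
  have hs₀ := (differentiableAt_of_contDiffOn hU (hC.smooth_conn.clm_apply h.smooth_n)
      hx).hasFDerivAt
  have hs₁ := (differentiableAt_of_contDiffOn hU ((hC.smooth_conn.clm_apply h.smooth_X).sub
    (contDiffOn_fderiv_apply hU h.smooth_G h.smooth_n)) hx).hasFDerivAt
  have hr₀ := (differentiableAt_of_contDiffOn hU h.smooth_r₀ hx).hasFDerivAt
  have hr₁ := (differentiableAt_of_contDiffOn hU h.smooth_r₁ hx).hasFDerivAt
  obtain ⟨k1, k2, k3, k4⟩ := h.fderiv_rotation hC hU hx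
  have hb := bracket_gauge hn hX hr₀ hr₁ hs₀ hs₁ (h.dualN_n hx) (h.dualN_X hx) (h.commute _ hx)
    (h.gauss hC hU hx).1 k1 k2 (by rw [k3]; ring) (by rw [k4]; ring) (h.sq_sub_sq _ hx)
    (hc' _ hx) (hd' _ hx)
  have hdiff {c c' : Plane → Fin 8 → ℝ}
      (hc' : HasInvDeriv U (IsKillingFrame.dualN η₀ η₁ r₀ r₁) c c') :
      DifferentiableAt ℝ (fun y : Ambient => killingLift τ n X G r₀ r₁ y (c y.1)) z := by
    obtain ⟨La, hLa, -⟩ := hasFDerivAt_gaugeVec hn hX (hc' _ hx)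
    obtain ⟨Lu, hLu, -⟩ := hasFDerivAt_gaugeComp hr₀ hr₁ hs₀ hs₁ (hc' _ hx)
    obtain ⟨L, hL, -⟩ := hasFDerivAt_lift hLa hLu
    exact hL.differentiableAt
  have key := apply_bracket_eq_zero hO hζ hz hzN (hdiff hc') (hdiff hd')
    (lift_mem_tangent hz _ _) (lift_mem_tangent hz _ _) hc hd (fun ψ hψ h0 v hv => by
      rw [← lift_components (O := O) hz hv]
      exact fderiv_lift_eq_zero (hO.inter hN) ⟨⟨hz.1, hzN⟩, hz.2⟩ hψ
        (fun y hy => h0 y ⟨hy.1.1, hy.2⟩ hy.1.2) _ _)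
  rw [killingLift]
  exact (congrArg (ζ z) hb.symm).trans key

end Annihilated

/-- The vector fields in the Lie algebra generated by a characteristic distribution cannot meet the
other one; for a metric with a Killing field this gives a differential equation. -/
theorem along_mul_along_of_characteristic (hC : IsCoframe U η₀ η₁ τ K) (hU : IsOpen U)
    (h : IsKillingFrame U η₀ η₁ n X G r₀ r₁) {κ : Plane → ℝ} (hκ : ContDiffOn ℝ ∞ κ U)
    (hκX : ∀ x ∈ U, fderiv ℝ κ x (X x) = 0) (hκ0 : ∀ x ∈ U, κ x ≠ 0)
    (hκK : ∀ x ∈ U, K x = -κ x ^ 2) {O N : Set Ambient} (hO : IsOpen O) (hN : IsOpen N)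
    (hNU : ∀ y ∈ N, y.1 ∈ U) {Φ : Set (OneForm Ambient)}
    (hΦ : ∀ y ∈ levelSet frameDefect O, y ∈ N → ∀ ξ ∈ Φ, ∀ a,
      ξ y (characteristic η₀ η₁ τ (κ y.1) y a) = 0)
    {z : Ambient} (hz : z ∈ levelSet frameDefect O) (hzN : z ∈ N)
    (hT : ∀ a, (∀ ζ ∈ terminal frameDefect O Φ,
      ζ z (characteristic η₀ η₁ τ (-κ z.1) z a) = 0) → a = 0) :
    along n G z.1 * along n κ z.1 = 2 * κ z.1 ^ 3 * G z.1 := by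
  set α := IsKillingFrame.dualN η₀ η₁ r₀ r₁ with hα
  have inv {q : Plane → ℝ} (hq : ContDiffOn ℝ ∞ q U) (hqX : ∀ x ∈ U, fderiv ℝ q x (X x) = 0) :
      HasInvDeriv U α q (along n q) := fun x hx => by
    have e : (α x).smulRight (along n q x) = fderiv ℝ q x (n x) • α x :=
      ContinuousLinearMap.ext fun a => by simp [along]; ring
    rw [e]
    exact h.hasFDerivAt_of_invariant hC hU hq hqX hx
  have smooth {q : Plane → ℝ} (hq : ContDiffOn ℝ ∞ q U) : ContDiffOn ℝ ∞ (along n q) U :=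
    contDiffOn_fderiv_apply hU hq h.smooth_n
  have invX {q : Plane → ℝ} (hq : ContDiffOn ℝ ∞ q U) (hqX : ∀ x ∈ U, fderiv ℝ q x (X x) = 0) :
      ∀ x ∈ U, fderiv ℝ (along n q) x (X x) = 0 := fun x hx => h.invariant_fderiv hU hq hqX hx
  have iG := inv h.smooth_G h.invariant_G
  have iG1 : HasInvDeriv U α (along n G) fun x => κ x ^ 2 * G x := fun x hx => by
    have := inv (smooth h.smooth_G) (invX h.smooth_G h.invariant_G) x hx
    have h2 : along n (along n G) x = κ x ^ 2 * G x := by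
      have := (h.gauss hC hU hx).2
      rw [hκK x hx, neg_neg] at this
      exact this
    rwa [h2] at this
  have iκ := inv hκ hκX
  have iκ1 := inv (smooth hκ) (invX hκ hκX)
  have iκ2 := inv (smooth (smooth hκ)) (invX (smooth hκ) (invX hκ hκX))
  set G1 := along n G
  set κ1 := along n κ
  set κ2 := along n κ1
  set κ3 := along n κ2
  let c0 := HasInvDeriv.const (U := U) (α := α) 0
  have fin8 {P : Fin 8 → Prop} (h0 : P 0) (h1 : P 1) (h2 : P 2) (h3 : P 3) (h4 : P 4) (h5 : P 5)
      (h6 : P 6) (h7 : P 7) : ∀ i, P i := by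
    intro i; fin_cases i <;> assumption
  -- `X₁` and `X₂` are the lifts of n and X to the characteristic distribution of κ. Their brackets
  -- are [X₁, X₂] = G Z, [X₁, Z] = W₁ and [X₂, Z] = W₂. The claim is that `A` vanishes at `z`.
  let X₁ : Plane → Fin 8 → ℝ := fun x => ![1, 0, 1, 0, 0, 0, 0, -κ x]
  let X₂ : Plane → Fin 8 → ℝ := fun x => ![0, 1, 0, G x, 0, G1 x, κ x * G x, 0]
  let Z : Plane → Fin 8 → ℝ := fun x => ![0, 0, 0, 0, -2 * κ x, 2 * κ x ^ 2, κ1 x, 0]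
  let A : Plane → ℝ := fun x => 2 * κ x ^ 3 * G x - κ1 x * G1 x
  let A1 : Plane → ℝ := fun x => 6 * κ x ^ 2 * κ1 x * G x + 2 * κ x ^ 3 * G1 x -
    κ2 x * G1 x - κ1 x * (κ x ^ 2 * G x)
  let W₁ : Plane → Fin 8 → ℝ := fun x =>
    ![0, 0, 0, -4 * κ x ^ 2, -3 * κ1 x, 5 * κ x * κ1 x, κ2 x - 2 * κ x ^ 3, 0]
  let W₂ : Plane → Fin 8 → ℝ := fun x => ![0, 0, -4 * κ x ^ 2 * G x, 0, 0, 0, 0, A x]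
  have dA : HasInvDeriv U α A A1 := by
    refine (((((HasInvDeriv.const 2).mul (iκ.mul (iκ.mul iκ))).mul iG)).add
      ((HasInvDeriv.const (-1)).mul (iκ1.mul iG1))).congr (fun x => ?_) (fun x => ?_)
    · simp only [A]; ring
    · simp only [A1]; ring
  have dX₁ : HasInvDeriv U α X₁ fun x => ![0, 0, 0, 0, 0, 0, 0, -κ1 x] :=
    HasInvDeriv.tuple (fin8 (HasInvDeriv.const 1) c0 (HasInvDeriv.const 1) c0 c0 c0 c0
      (((HasInvDeriv.const (-1)).mul iκ).congr (fun x => by simp [X₁]) (fun x => by simp)))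
  have dX₂ : HasInvDeriv U α X₂ fun x => ![0, 0, 0, G1 x, 0, κ x ^ 2 * G x,
      κ1 x * G x + κ x * G1 x, 0] :=
    HasInvDeriv.tuple (fin8 c0 (HasInvDeriv.const 1) c0 iG c0 iG1 (iκ.mul iG) c0)
  have dZ : HasInvDeriv U α Z fun x => ![0, 0, 0, 0, -2 * κ1 x, 4 * κ x * κ1 x, κ2 x, 0] :=
    HasInvDeriv.tuple (fin8 c0 c0 c0 c0
      (((HasInvDeriv.const (-2)).mul iκ).congr (fun x => by simp [Z]) (fun x => by simp))
      (((HasInvDeriv.const 2).mul (iκ.mul iκ)).congr (fun x => by simp [Z]; ring)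
        (fun x => by simp; ring)) iκ1 c0)
  have dW₂ : HasInvDeriv U α W₂ fun x => ![0, 0, -(8 * κ x * κ1 x * G x + 4 * κ x ^ 2 * G1 x),
      0, 0, 0, 0, A1 x] :=
    HasInvDeriv.tuple (fin8 c0 c0
      (((HasInvDeriv.const (-4)).mul ((iκ.mul iκ).mul iG)).congr (fun x => by simp [W₂]; ring)
        (fun x => by simp; ring)) c0 c0 c0 c0 dA)
  have aX₁ : Annihilated O Φ N τ n X G r₀ r₁ 0 X₁ := by
    intro ζ hζ y hy hyN
    have hx := hNU y hyN
    have e : killingLift τ n X G r₀ r₁ y (X₁ y.1) =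
        characteristic η₀ η₁ τ (κ y.1) y (n y.1) := by
      simp only [killingLift, characteristic]
      congr 1
      · simp [gaugeVec, X₁]
      · simp only [gaugeComp, adapted, h.zero_n _ hx, h.one_n _ hx]
        funext i
        fin_cases i <;> simp [X₁] <;> ring
    rw [e]
    exact apply_eq_zero_of_mem_sections hζ hy (lift_mem_tangent hy _ _)
      (fun ξ hξ => hΦ y hy hyN ξ hξ _)
  have aX₂ : Annihilated O Φ N τ n X G r₀ r₁ 0 X₂ := by
    intro ζ hζ y hy hyN
    have hx := hNU y hyN
    have e : killingLift τ n X G r₀ r₁ y (X₂ y.1) =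
        characteristic η₀ η₁ τ (κ y.1) y (X y.1) := by
      simp only [killingLift, characteristic]
      congr 1
      · simp [gaugeVec, X₂]
      · simp only [gaugeComp, adapted, h.zero_X _ hx, h.one_X _ hx]
        funext i
        fin_cases i <;> simp [X₂, G1] <;> ring
    rw [e]
    exact apply_eq_zero_of_mem_sections hζ hy (lift_mem_tangent hy _ _)
      (fun ξ hξ => hΦ y hy hyN ξ hξ _)
  have br {m : ℕ} {c c' d d' : Plane → Fin 8 → ℝ} (hc' : HasInvDeriv U α c c')
      (hd' : HasInvDeriv U α d d') (hc : Annihilated O Φ N τ n X G r₀ r₁ m c)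
      (hd : Annihilated O Φ N τ n X G r₀ r₁ m d) :=
    Annihilated.bracket hC hU h hO hN hNU hc' hd' hc hd
  have aZ : Annihilated O Φ N τ n X G r₀ r₁ 1 Z := by
    refine Annihilated.comb (U := U) hNU (br dX₁ dX₂ aX₁ aX₂) aX₁.succ
      (fun x => (G x)⁻¹) (fun _ => 0) fun x hx => ?_
    have hG := (h.pos x hx).ne'
    funext i
    fin_cases i <;> simp [Z, X₁, X₂, bracketTuple] <;> field_simp <;> ring
  have aW₁ : Annihilated O Φ N τ n X G r₀ r₁ 2 W₁ := by
    refine Annihilated.comb (U := U) hNU (br dX₁ dZ aX₁.succ aZ) aZ.succ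
      (fun _ => 1) (fun _ => 0) fun x hx => ?_
    funext i
    fin_cases i <;> simp [W₁, Z, X₁, bracketTuple] <;> ring
  have aW₂ : Annihilated O Φ N τ n X G r₀ r₁ 2 W₂ := by
    refine Annihilated.comb (U := U) hNU (br dX₂ dZ aX₂.succ aZ) aZ.succ
      (fun _ => 1) (fun _ => 0) fun x hx => ?_
    funext i
    fin_cases i <;> simp [W₂, A, Z, X₂, bracketTuple] <;> ring
  -- the direction `P₂` does not occur
  have noP {m : ℕ} {s : Plane → ℝ} (hs : Annihilated O Φ N τ n X G r₀ r₁ m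
      fun x => ![0, 0, 0, 0, 0, 0, 0, s x]) : s z.1 = 0 := by
    have hx := hNU z hzN
    have h1 : s z.1 • n z.1 = 0 := by
      apply hT
      intro ζ hζ
      rw [terminal, Set.mem_iInter] at hζ
      have e1 := hs ζ (hζ m) z hz hzN
      have e2 := aX₁ ζ (hζ 0) z hz hzN
      -- The lifts of n to the two characteristic distributions differ only by 2κ in the last
      -- component. So s times the lift to the opposite one is annihilated by the final derived
      -- system, and `hT` applies.
      have e : characteristic η₀ η₁ τ (-κ z.1) z (s z.1 • n z.1) =
          s z.1 • killingLift τ n X G r₀ r₁ z (X₁ z.1) +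
            (2 * κ z.1) • killingLift τ n X G r₀ r₁ z ![0, 0, 0, 0, 0, 0, 0, s z.1] := by
        simp only [killingLift, characteristic]
        rw [← lift_gauge_comb]
        congr 1
        · simp [gaugeVec, X₁]
        · simp only [gaugeComp, adapted, map_smul, h.zero_n _ hx, h.one_n _ hx]
          funext i
          fin_cases i <;> simp [X₁] <;> ring
      rw [e, map_add, map_smul, map_smul, e1, e2]
      simp
    have h2 := congrArg (α z.1) h1
    rw [map_smul, h.dualN_n hx] at h2
    simpa using h2
  -- Elimination coefficients: [X₂, W₂] - G G′ W₁ has no component 3, and its component 4 is β. Then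
  -- 2κ times it plus β Z has no component 4 either, and this is `T`.
  let β : Plane → ℝ := fun x => -4 * κ x ^ 2 * G x ^ 2 * κ x - A x * G x + 3 * κ1 x * G x * G1 x
  let b : Plane → ℝ := fun x => 2 * κ x * (κ x * G x * A x - 5 * κ x * κ1 x * G x * G1 x) +
    2 * κ x ^ 2 * β x
  let p : Plane → ℝ := fun x => 2 * κ x * (-A x * G1 x - G x * G1 x * (κ2 x - 2 * κ x ^ 3)) +
    κ1 x * β x
  let T : Plane → Fin 8 → ℝ := fun x => ![0, 0, 0, 0, 0, b x, p x, 0]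
  have aU₂ := br dX₂ dW₂ aX₂.succ.succ aW₂
  have aV : Annihilated O Φ N τ n X G r₀ r₁ 3 fun x => ![0, 0, 0, 0, β x,
      κ x * G x * A x - 5 * κ x * κ1 x * G x * G1 x,
      -A x * G1 x - G x * G1 x * (κ2 x - 2 * κ x ^ 3), 0] := by
    refine Annihilated.comb (U := U) hNU aU₂ aW₁.succ (fun _ => 1) (fun x => -(G x * G1 x))
      fun x hx => ?_
    funext i
    fin_cases i <;> simp [W₁, W₂, β, X₂, bracketTuple] <;> ring
  have aT : Annihilated O Φ N τ n X G r₀ r₁ 3 T := by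
    refine Annihilated.comb (U := U) hNU aV aZ.succ.succ (fun x => 2 * κ x) β fun x hx => ?_
    funext i
    fin_cases i <;> simp [T, Z, b, p] <;> ring
  -- Only existence matters: neither `X₂` nor `T` has a component along n, so `T'` drops out of
  -- their bracket.
  obtain ⟨T', dT⟩ : ∃ T', HasInvDeriv U α T T' := by
    have c (a : ℝ) := HasInvDeriv.const (U := U) (α := α) a
    have dβ : ∃ β', HasInvDeriv U α β β' :=
      ⟨_, ((((((c (-4)).mul (iκ.mul iκ)).mul (iG.mul iG)).mul iκ).add
        ((c (-1)).mul (dA.mul iG))).add ((((c 3).mul iκ1).mul iG).mul iG1)).congr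
        (fun x => by simp only [β]; ring) fun x => rfl⟩
    obtain ⟨β', dβ⟩ := dβ
    have db : ∃ b', HasInvDeriv U α b b' :=
      ⟨_, ((((c 2).mul iκ).mul (((iκ.mul iG).mul dA).add ((c (-5)).mul (((iκ.mul iκ1).mul iG).mul
        iG1)))).add (((c 2).mul (iκ.mul iκ)).mul dβ)).congr
        (fun x => by simp only [b]; ring) fun x => rfl⟩
    have dp : ∃ p', HasInvDeriv U α p p' :=
      ⟨_, ((((c 2).mul iκ).mul (((c (-1)).mul (dA.mul iG1)).add ((c (-1)).mul ((iG.mul iG1).mul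
        (iκ2.add ((c (-2)).mul (iκ.mul (iκ.mul iκ)))))))).add (iκ1.mul dβ)).congr
        (fun x => by simp only [p]; ring) fun x => rfl⟩
    obtain ⟨b', db⟩ := db
    obtain ⟨p', dp⟩ := dp
    exact ⟨fun x => ![0, 0, 0, 0, 0, b' x, p' x, 0],
      HasInvDeriv.tuple (fin8 c0 c0 c0 c0 c0 db dp c0)⟩
  -- [X₁, W₂], like W₂, has only components 2 and 7. Eliminating component 2 leaves the forbidden
  -- direction.
  have E1 := noP (s := fun x => κ x * G x * A1 x - (2 * κ1 x * G x + κ x * G1 x) * A x) (m := 3) <|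
      by
    refine Annihilated.comb (U := U) hNU (br dX₁ dW₂ aX₁.succ.succ aW₂) aW₂.succ
      (fun x => κ x * G x) (fun x => -(2 * κ1 x * G x + κ x * G1 x)) fun x hx => ?_
    funext i
    fin_cases i <;> simp [W₂, X₁, bracketTuple] <;> ring
  -- The same elimination for [X₂, T] and W₂.
  have E2 := noP (s := fun x => 4 * κ x ^ 2 * (κ x * G x * b x - p x * G1 x) - b x * A x) (m := 4)
      <| by
    refine Annihilated.comb (U := U) hNU (br dX₂ dT aX₂.succ.succ.succ aT) aW₂.succ.succ
      (fun x => 4 * κ x ^ 2) (fun x => -b x) fun x hx => ?_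
    funext i
    fin_cases i <;> simp [W₂, X₂, T, bracketTuple] <;> ring
  have hx := hNU z hzN
  -- κ″ occurs linearly in both identities. The multiple of `E1` is chosen to cancel it, and a
  -- perfect square times a nonzero factor remains.
  have hA : 4 * κ z.1 ^ 2 * G z.1 * A z.1 ^ 2 = 0 := by
    simp only [b, p, β, A, A1] at E1 E2 ⊢
    linear_combination -E2 - 8 * κ z.1 ^ 2 * G1 z.1 * E1
  have hA0 : A z.1 = 0 := by
    simpa [hκ0 _ hx, (h.pos _ hx).ne'] using hA
  simp only [A] at hA0
  linear_combination -hA0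

end Lorentz

/-! ### From Darboux pairs to the differential equation. -/

namespace EDS

/-- The dual form of the Darboux pair condition: a vector killed by both families is killed by every
covector. -/
theorem eq_zero_of_coSpan_sup_eq_top {E G : Type*} [NormedAddCommGroup E] [NormedSpace ℝ E]
    [NormedAddCommGroup G] [NormedSpace ℝ G] {F : E → G} {Φ Ψ : Set (OneForm E)} {x : E}
    (h : coSpan F Φ x ⊔ coSpan F Ψ x = ⊤) {v : E} (hv : v ∈ tangent F x)
    (hΦ : ∀ ζ ∈ Φ, ζ x v = 0) (hΨ : ∀ ζ ∈ Ψ, ζ x v = 0) : v = 0 := by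
  have h1 : (⟨v, hv⟩ : tangent F x) ∈ ann F Φ x := (mem_ann_iff _).2 hΦ
  have h2 : (⟨v, hv⟩ : tangent F x) ∈ ann F Ψ x := (mem_ann_iff _).2 hΨ
  rw [ann, Submodule.mem_dualCoannihilator] at h1 h2
  have h3 : (⟨v, hv⟩ : tangent F x) = 0 := by
    rw [← Module.forall_dual_apply_eq_zero_iff ℝ]
    intro φ
    obtain ⟨φ₁, hφ₁, φ₂, hφ₂, rfl⟩ := Submodule.mem_sup.1 (h ▸ Submodule.mem_top : φ ∈ _)
    rw [LinearMap.add_apply, h1 _ hφ₁, h2 _ hφ₂, add_zero]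
  exact congrArg Subtype.val h3

end EDS

namespace Lorentz

open EDS Minkowski

variable {U : Set Plane} {η₀ η₁ τ : OneForm Plane} {K : Plane → ℝ} {n X : Plane → Plane}
  {G r₀ r₁ : Plane → ℝ}

theorem differentiableAt_characteristic (hC : IsCoframe U η₀ η₁ τ K) (hU : IsOpen U)
    {κ : Plane → ℝ} (hκ : ContDiffOn ℝ ∞ κ U) (a : Plane) {z : Ambient} (hz : z.1 ∈ U) :
    DifferentiableAt ℝ (fun y : Ambient => characteristic η₀ η₁ τ (κ y.1) y a) z := by
  have h0 := differentiableAt_of_contDiffOn hU (hC.smooth_zero.clm_apply contDiffOn_const) hz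
    (f := fun y => η₀ y a)
  have h1 := differentiableAt_of_contDiffOn hU (hC.smooth_one.clm_apply contDiffOn_const) hz
    (f := fun y => η₁ y a)
  have ht := differentiableAt_of_contDiffOn hU (hC.smooth_conn.clm_apply contDiffOn_const) hz
    (f := fun y => τ y a)
  have hk := differentiableAt_of_contDiffOn hU hκ hz
  obtain ⟨L, hL, -⟩ := hasFDerivAt_lift (hasFDerivAt_const a z.1)
    (hasFDerivAt_vec_six h0.hasFDerivAt h1.hasFDerivAt (hasFDerivAt_const (0 : ℝ) _)
      ht.hasFDerivAt (hk.fun_mul h1).hasFDerivAt (hk.fun_mul h0).fun_neg.hasFDerivAt)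
  exact hL.differentiableAt

/-- The matching of singular systems with signs of κ is known pointwise only. It persists near `z`,
because the other matching would make every `σc` vanish on the distribution for -κ, whereas one of
them is nonzero there at `z`, an open condition. -/
theorem along_mul_along_of_characteristic_at (hC : IsCoframe U η₀ η₁ τ K) (hU : IsOpen U)
    (h : IsKillingFrame U η₀ η₁ n X G r₀ r₁) {κ : Plane → ℝ} (hκ : ContDiffOn ℝ ∞ κ U)
    (hκX : ∀ x ∈ U, fderiv ℝ κ x (X x) = 0) (hκ0 : ∀ x ∈ U, κ x ≠ 0)
    (hκK : ∀ x ∈ U, K x = -κ x ^ 2) {O : Set Ambient} (hO : IsOpen O) (hOU : O ⊆ region U)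
    {p q s t : ℕ} {σh : Fin p → OneForm Ambient} {σc : Fin q → OneForm Ambient}
    {Ch : Fin s → Fin p → Fin p → Ambient → ℝ} {Cc : Fin t → Fin q → Fin q → Ambient → ℝ}
    (hD : IsDecomposition frameDefect O (system η₀ η₁ τ) σh σc Ch Cc)
    (hP : IsDarbouxPair frameDefect O (Set.range (system η₀ η₁ τ) ∪ Set.range σh)
      (Set.range (system η₀ η₁ τ) ∪ Set.range σc)) {z : Ambient}
    (hz : z ∈ levelSet frameDefect O)
    (hσ : ∀ a, (∀ i, σc i z (characteristic η₀ η₁ τ (κ z.1) z a) = 0) ∧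
        ∀ i, σh i z (characteristic η₀ η₁ τ (-κ z.1) z a) = 0) :
    along n G z.1 * along n κ z.1 = 2 * κ z.1 ^ 3 * G z.1 := by
  have hzU := (hOU hz.1).1
  -- Otherwise the whole coframe would vanish on a nonzero vector.
  obtain ⟨a, i, hai⟩ : ∃ a i, σc i z (characteristic η₀ η₁ τ (-κ z.1) z a) ≠ 0 := by
    by_contra! hcon
    obtain ⟨a, -, ha, -⟩ := hC.exists_dual _ hzU
    have : characteristic η₀ η₁ τ (-κ z.1) z a = 0 := by
      refine eq_zero_of_coSpan_sup_eq_top (Φ := Set.range (Sum.elim (system η₀ η₁ τ)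
        (Sum.elim σh σc))) (Ψ := ∅) (by rw [hD.span_eq_top z hz, top_sup_eq])
        (lift_mem_tangent hz _ _) ?_ (by simp)
      rintro _ ⟨j | j | j, rfl⟩
      · exact system_apply_adapted hz _ _ _ _
      · exact (hσ a).2 j
      · exact hcon a j
    have h0 : a = 0 := congrArg Prod.fst this
    rw [h0, map_zero] at ha
    exact zero_ne_one ha
  have hcont : ContinuousOn
      (fun y : Ambient => σc i y (characteristic η₀ η₁ τ (-κ y.1) y a)) O := fun y hy =>
    ((differentiableAt_of_contDiffOn hO (hD.smooth_σc i) hy).clm_apply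
      (differentiableAt_characteristic (κ := fun x => -κ x) hC hU hκ.neg a
        (hOU hy).1)).continuousAt.continuousWithinAt
  have hN := hcont.isOpen_inter_preimage hO (isOpen_compl_singleton (x := (0 : ℝ)))
  refine along_mul_along_of_characteristic hC hU h hκ hκX hκ0 hκK hO hN
    (fun y hy => (hOU hy.1).1) (Φ := Set.range (system η₀ η₁ τ) ∪ Set.range σc) ?_ hz
    ⟨hz.1, hai⟩ ?_
  · intro y hy hyN ξ hξ b
    have hyU := (hOU hy.1).1
    rcases hξ with ⟨j, rfl⟩ | ⟨j, rfl⟩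
    · exact system_apply_adapted hy _ _ _ _
    · rcases characteristic_of_isDecomposition hC hU hD hy hyU (hκ0 _ hyU) (hκK _ hyU) with h1 | h1
      · exact (h1 b).1 j
      · exact absurd ((h1 a).1 i) hyN.2
  · intro b hb
    have := eq_zero_of_coSpan_sup_eq_top (hP.sup_left z hz)
      (lift_mem_tangent hz b (adapted η₀ η₁ τ z.1 b (-κ z.1 * η₁ z.1 b) (-(-κ z.1 * η₀ z.1 b))))
      ?_ hb
    · exact congrArg Prod.fst this
    · rintro _ (⟨j, rfl⟩ | ⟨j, rfl⟩)
      · exact system_apply_adapted hz _ _ _ _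
      · exact (hσ b).2 j

/-- The differential equation satisfied by the curvature of a Darboux integrable metric with a
Killing field. -/
theorem along_mul_along_of_isDarbouxIntegrable (hC : IsCoframe U η₀ η₁ τ K) (hU : IsOpen U)
    (h : IsKillingFrame U η₀ η₁ n X G r₀ r₁) {k : Plane → ℝ} (hk : ContDiffOn ℝ ∞ k U)
    (hkX : ∀ x ∈ U, fderiv ℝ k x (X x) = 0) (hk0 : ∀ x ∈ U, k x ≠ 0)
    (hkK : ∀ x ∈ U, K x = -k x ^ 2)
    (hDI : EDS.IsDarbouxIntegrable frameDefect (region U) (system η₀ η₁ τ)) {x : Plane}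
    (hx : x ∈ U) : along n G x * along n k x = 2 * k x ^ 3 * G x := by
  -- Any frame over `x` would do; this is the standard one at the origin.
  let z : Ambient := (x, 0, fun i j => (1 : Matrix (Fin 3) (Fin 3) ℝ) i j)
  have hz : z ∈ levelSet frameDefect (region U) := by
    refine ⟨⟨hx, ?_⟩, (frameDefect_eq_zero_iff _ _ _).2 (by simp)⟩
    have : Matrix.of z.2.2 = 1 := rfl
    rw [this]
    simp
  obtain ⟨O, hO, hzO, hOU, p, q, s, t, σh, σc, Ch, Cc, hD, -, -, hP⟩ := hDI z hz
  have hz' : z ∈ levelSet frameDefect O := ⟨hzO, hz.2⟩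
  rcases characteristic_of_isDecomposition hC hU hD hz' hx (hk0 _ hx) (hkK _ hx) with h1 | h1
  · exact along_mul_along_of_characteristic_at hC hU h hk hkX hk0 hkK hO hOU hD hP hz' h1
  -- With the roles of the distributions exchanged, κ = -k; the equation is odd in κ.
  · have := along_mul_along_of_characteristic_at (κ := fun x => -k x) hC hU h hk.neg
      (fun y hy => by simp [fderiv_fun_neg, hkX y hy]) (fun y hy => neg_ne_zero.2 (hk0 y hy))
      (fun y hy => by rw [hkK y hy]; ring) hO hOU hD hP hz' (by simpa only [neg_neg] using h1)
    have hneg : along n (fun x => -k x) x = -along n k x := by simp [along, fderiv_fun_neg]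
    change along n G x * along n (fun x => -k x) x = 2 * (-k x) ^ 3 * G x at this
    rw [hneg] at this
    linear_combination -this

end Lorentz

/-! ### Orthonormal frames of a metric in coordinates. -/

namespace Lorentz

open EDS Minkowski

namespace IsOrthonormalFrame

variable {γ : Plane → Plane →L[ℝ] Plane →L[ℝ] ℝ} {U : Set Plane} {f : Fin 2 → Plane → Plane}
  {x : Plane}

theorem dual_zero_zero (hf : IsOrthonormalFrame γ U f) (hx : x ∈ U) :
    dualForm γ f 0 x (f 0 x) = 1 := by
  simpa [dualForm] using hf.zero_zero x hx

theorem dual_zero_one (hf : IsOrthonormalFrame γ U f) (hx : x ∈ U) :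
    dualForm γ f 0 x (f 1 x) = 0 := by
  simpa [dualForm] using hf.zero_one x hx

theorem dual_one_zero (hf : IsOrthonormalFrame γ U f) (hγ : ∀ x ∈ U, ∀ a b, γ x a b = γ x b a)
    (hx : x ∈ U) : dualForm γ f 1 x (f 0 x) = 0 := by
  simpa [dualForm, hγ x hx (f 1 x)] using hf.zero_one x hx

theorem dual_one_one (hf : IsOrthonormalFrame γ U f) (hx : x ∈ U) :
    dualForm γ f 1 x (f 1 x) = 1 := by
  simp [dualForm, hf.one_one x hx]

theorem eq_smul_add_smul (hf : IsOrthonormalFrame γ U f)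
    (hγ : ∀ x ∈ U, ∀ a b, γ x a b = γ x b a) (hx : x ∈ U) (a : Plane) :
    a = dualForm γ f 0 x a • f 0 x + dualForm γ f 1 x a • f 1 x := by
  have h1 := hf.dual_zero_zero hx
  have h2 := hf.dual_zero_one hx
  have h3 := hf.dual_one_zero hγ hx
  have h4 := hf.dual_one_one hx
  rw [← sub_eq_zero]
  exact eq_zero_of_dual h1 h3 h2 h4 (by simp [h1, h2]) (by simp [h3, h4])

/-- The metric in terms of the orthonormal coframe. -/
theorem metric_eq (hf : IsOrthonormalFrame γ U f)
    (hγ : ∀ x ∈ U, ∀ a b, γ x a b = γ x b a) (hx : x ∈ U) (a b : Plane) :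
    γ x a b = dualForm γ f 0 x a * dualForm γ f 0 x b - dualForm γ f 1 x a * dualForm γ f 1 x b :=
        by
  conv_lhs => rw [hf.eq_smul_add_smul hγ hx a]
  simp only [map_add, map_smul, add_apply, FunLike.coe_smul, Pi.smul_apply, smul_eq_mul]
  simp [dualForm]
  ring

theorem dForm_eq (hf : IsOrthonormalFrame γ U f)
    (hγ : ∀ x ∈ U, ∀ a b, γ x a b = γ x b a) (hx : x ∈ U) (ζ : OneForm Plane) (a b : Plane) :
    dForm ζ x a b = dForm ζ x (f 0 x) (f 1 x) *
      (dualForm γ f 0 x a * dualForm γ f 1 x b - dualForm γ f 0 x b * dualForm γ f 1 x a) := by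
  have ha := hf.eq_smul_add_smul hγ hx a
  have hb := hf.eq_smul_add_smul hγ hx b
  generalize dualForm γ f 0 x a = a0, dualForm γ f 1 x a = a1, dualForm γ f 0 x b = b0,
    dualForm γ f 1 x b = b1 at *
  subst ha hb
  simp [dForm]
  ring

theorem contDiffOn_dualForm (hf : IsOrthonormalFrame γ U f) (hγ : ContDiffOn ℝ ∞ γ U) (i : Fin 2) :
    ContDiffOn ℝ ∞ (dualForm γ f i) U := by
  fin_cases i
  · exact (hγ.clm_apply (hf.smooth 0)).congr fun x _ => by simp [dualForm]
  · exact (hγ.clm_apply (hf.smooth 1)).neg.congr fun x _ => by simp [dualForm]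

theorem contDiffOn_dForm (hf : IsOrthonormalFrame γ U f) (hU : IsOpen U) {ζ : OneForm Plane}
    (hζ : ContDiffOn ℝ ∞ ζ U) : ContDiffOn ℝ ∞ (fun x => dForm ζ x (f 0 x) (f 1 x)) U :=
  ((contDiffOn_fderiv_apply hU hζ (hf.smooth 0)).clm_apply (hf.smooth 1)).sub
    ((contDiffOn_fderiv_apply hU hζ (hf.smooth 1)).clm_apply (hf.smooth 0))

theorem contDiffOn_connForm (hf : IsOrthonormalFrame γ U f) (hU : IsOpen U)
    (hγ : ContDiffOn ℝ ∞ γ U) : ContDiffOn ℝ ∞ (connForm γ f) U := by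
  have h0 := hf.contDiffOn_dualForm hγ 0
  have h1 := hf.contDiffOn_dualForm hγ 1
  exact ((hf.contDiffOn_dForm hU h0).neg.smul h0).add ((hf.contDiffOn_dForm hU h1).smul h1)

theorem contDiffOn_frameCurvature (hf : IsOrthonormalFrame γ U f) (hU : IsOpen U)
    (hγ : ContDiffOn ℝ ∞ γ U) : ContDiffOn ℝ ∞ (frameCurvature γ f) U :=
  (hf.contDiffOn_dForm hU (hf.contDiffOn_connForm hU hγ)).neg

theorem isCoframe (hf : IsOrthonormalFrame γ U f) (hU : IsOpen U) (hγ : ContDiffOn ℝ ∞ γ U)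
    (hs : ∀ x ∈ U, ∀ a b, γ x a b = γ x b a) :
    IsCoframe U (dualForm γ f 0) (dualForm γ f 1) (connForm γ f) (frameCurvature γ f) where
  smooth_zero := hf.contDiffOn_dualForm hγ 0
  smooth_one := hf.contDiffOn_dualForm hγ 1
  smooth_conn := hf.contDiffOn_connForm hU hγ
  d_zero x hx a b := by
    rw [hf.dForm_eq hs hx]
    simp [connForm]
    ring
  d_one x hx a b := by
    rw [hf.dForm_eq hs hx]
    simp [connForm]
    ring
  d_conn x hx a b := by
    rw [hf.dForm_eq hs hx, frameCurvature]
    ring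
  exists_dual x hx := ⟨f 0 x, f 1 x, hf.dual_zero_zero hx, hf.dual_one_zero hs hx,
    hf.dual_zero_one hx, hf.dual_one_one hx⟩

end IsOrthonormalFrame

/-! ### The adapted frame of a spacelike Killing field. -/

section Killing

variable (γ : Plane → Plane →L[ℝ] Plane →L[ℝ] ℝ) (f : Fin 2 → Plane → Plane) (X : Plane → Plane)

/-- The length of a spacelike vector field. -/
def spaceNorm (x : Plane) : ℝ := √(-γ x (X x) (X x))

/-- The unit vector field orthogonal to a spacelike vector field. -/
def unitNormal (x : Plane) : Plane :=
  (dualForm γ f 1 x (X x) / spaceNorm γ X x) • f 0 x +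
    (dualForm γ f 0 x (X x) / spaceNorm γ X x) • f 1 x

variable {γ f X} {U : Set Plane}

theorem fderiv_metric {A B : Plane → Plane} {x : Plane} (hγ : DifferentiableAt ℝ γ x)
    (hA : DifferentiableAt ℝ A x) (hB : DifferentiableAt ℝ B x) (v : Plane) :
    fderiv ℝ (fun y => γ y (A y) (B y)) x v =
      fderiv ℝ γ x v (A x) (B x) + γ x (fderiv ℝ A x v) (B x) + γ x (A x) (fderiv ℝ B x v) := by
  rw [fderiv_clm_apply (hγ.clm_apply hA) hB, fderiv_clm_apply hγ hA]
  simp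
  ring

/-- Differentiating γ(n, n) = 1 and γ(X, n) = 0 along X, with L_X γ = 0 and [X, X] = 0, shows that
[X, n] is orthogonal to n and X, hence zero. The length of X is invariant for the same reason. -/
theorem IsOrthonormalFrame.isKillingFrame (hf : IsOrthonormalFrame γ U f) (hU : IsOpen U)
    (hγ : ContDiffOn ℝ ∞ γ U) (hs : ∀ x ∈ U, ∀ a b, γ x a b = γ x b a)
    (hX : ContDiffOn ℝ ∞ X U) (hXX : ∀ x ∈ U, γ x (X x) (X x) < 0)
    (hK : ∀ x ∈ U, ∀ a b, fderiv ℝ γ x (X x) a b + γ x (fderiv ℝ X x a) b +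
      γ x a (fderiv ℝ X x b) = 0) :
    IsKillingFrame U (dualForm γ f 0) (dualForm γ f 1) (unitNormal γ f X) X (spaceNorm γ X)
      (fun x => dualForm γ f 1 x (X x) / spaceNorm γ X x)
      (fun x => dualForm γ f 0 x (X x) / spaceNorm γ X x) := by
  have hpos : ∀ x ∈ U, 0 < spaceNorm γ X x := fun x hx =>
    Real.sqrt_pos.2 (neg_pos.2 (hXX x hx))
  have hsq : ∀ x ∈ U, spaceNorm γ X x ^ 2 = -γ x (X x) (X x) := fun x hx =>
    Real.sq_sqrt (neg_pos.2 (hXX x hx)).le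
  have hsG : ContDiffOn ℝ ∞ (spaceNorm γ X) U :=
    ContDiffOn.sqrt ((hγ.clm_apply hX).clm_apply hX).neg fun x hx => (neg_pos.2 (hXX x hx)).ne'
  have hr0 : ContDiffOn ℝ ∞ (fun x => dualForm γ f 1 x (X x) / spaceNorm γ X x) U :=
    ((hf.contDiffOn_dualForm hγ 1).clm_apply hX).div hsG fun x hx => (hpos x hx).ne'
  have hr1 : ContDiffOn ℝ ∞ (fun x => dualForm γ f 0 x (X x) / spaceNorm γ X x) U :=
    ((hf.contDiffOn_dualForm hγ 0).clm_apply hX).div hsG fun x hx => (hpos x hx).ne'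
  have hn : ContDiffOn ℝ ∞ (unitNormal γ f X) U :=
    (hr0.smul (hf.smooth 0)).add (hr1.smul (hf.smooth 1))
  have h1 : ∀ x ∈ U, (dualForm γ f 1 x (X x) / spaceNorm γ X x) ^ 2 -
      (dualForm γ f 0 x (X x) / spaceNorm γ X x) ^ 2 = 1 := by
    intro x hx
    have h2 := hf.metric_eq hs hx (X x) (X x)
    have h3 := hsq x hx
    have h4 := (hpos x hx).ne'
    field_simp
    linear_combination h2 - h3
  have z0 : ∀ x ∈ U, dualForm γ f 0 x (unitNormal γ f X x) =
      dualForm γ f 1 x (X x) / spaceNorm γ X x := by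
    intro x hx
    simp only [unitNormal, map_add, map_smul, smul_eq_mul, hf.dual_zero_zero hx,
      hf.dual_zero_one hx]
    ring
  have z1 : ∀ x ∈ U, dualForm γ f 1 x (unitNormal γ f X x) =
      dualForm γ f 0 x (X x) / spaceNorm γ X x := by
    intro x hx
    simp only [unitNormal, map_add, map_smul, smul_eq_mul, hf.dual_one_zero hs hx,
      hf.dual_one_one hx]
    ring
  have nn : ∀ x ∈ U, γ x (unitNormal γ f X x) (unitNormal γ f X x) = 1 := by
    intro x hx
    rw [hf.metric_eq hs hx, z0 x hx, z1 x hx]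
    linarith [h1 x hx]
  have Xn : ∀ x ∈ U, γ x (X x) (unitNormal γ f X x) = 0 := by
    intro x hx
    rw [hf.metric_eq hs hx, z0 x hx, z1 x hx]
    ring
  refine ⟨hn, hX, hsG, hr0, hr1, hpos, h1, z0, z1, ?_, ?_, ?_, ?_⟩
  · intro x hx
    have := (hpos x hx).ne'
    field_simp
  · intro x hx
    have := (hpos x hx).ne'
    field_simp
  · intro x hx
    have dγ := differentiableAt_of_contDiffOn hU hγ hx
    have dn := differentiableAt_of_contDiffOn hU hn hx
    have dX := differentiableAt_of_contDiffOn hU hX hx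
    have e1 := fderiv_metric dγ dn dn (X x)
    have e2 := fderiv_metric dγ dX dn (X x)
    rw [fderiv_congr_on hU nn hx] at e1
    rw [fderiv_congr_on hU Xn hx] at e2
    have k1 := hK x hx (unitNormal γ f X x) (unitNormal γ f X x)
    have k2 := hK x hx (X x) (unitNormal γ f X x)
    simp at e1 e2
    rw [← sub_eq_zero]
    set Z := fderiv ℝ X x (unitNormal γ f X x) - fderiv ℝ (unitNormal γ f X) x (X x) with hZ
    have g1 : γ x (unitNormal γ f X x) Z = 0 := by
      rw [hZ, map_sub]
      have s1 := hs x hx (fderiv ℝ X x (unitNormal γ f X x)) (unitNormal γ f X x)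
      have s2 := hs x hx (fderiv ℝ (unitNormal γ f X) x (X x)) (unitNormal γ f X x)
      linarith
    have g2 : γ x (X x) Z = 0 := by
      rw [hZ, map_sub]
      linarith
    rw [hf.metric_eq hs hx, z0 x hx, z1 x hx] at g1
    rw [hf.metric_eq hs hx] at g2
    have h2 := h1 x hx
    have h4 := (hpos x hx).ne'
    have e3 : dualForm γ f 0 x Z = 0 := by
      linear_combination (-dualForm γ f 0 x Z) * h2 +
        (dualForm γ f 1 x (X x) / spaceNorm γ X x) * g1 -
        (dualForm γ f 0 x (X x) / spaceNorm γ X x / spaceNorm γ X x) * g2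
    have e4 : dualForm γ f 1 x Z = 0 := by
      linear_combination (-dualForm γ f 1 x Z) * h2 +
        (dualForm γ f 0 x (X x) / spaceNorm γ X x) * g1 -
        (dualForm γ f 1 x (X x) / spaceNorm γ X x / spaceNorm γ X x) * g2
    exact eq_zero_of_dual (hf.dual_zero_zero hx) (hf.dual_one_zero hs hx) (hf.dual_zero_one hx)
      (hf.dual_one_one hx) e3 e4
  · intro x hx
    have dγ := differentiableAt_of_contDiffOn hU hγ hx
    have dX := differentiableAt_of_contDiffOn hU hX hx
    have dG := differentiableAt_of_contDiffOn hU hsG hx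
    have e1 := fderiv_metric dγ dX dX (X x)
    rw [hK x hx (X x) (X x), fderiv_congr_on (g := fun y => -spaceNorm γ X y ^ 2) hU
      (fun y hy => by rw [hsq y hy, neg_neg]) hx, fderiv_fun_neg, fderiv_fun_pow 2 dG] at e1
    simpa [(hpos x hx).ne'] using e1

end Killing

/-- The metric in terms of the coframe adapted to a Killing field. -/
theorem IsKillingFrame.sq_sub_sq_eq {U : Set Plane} {η₀ η₁ : OneForm Plane} {n X : Plane → Plane}
    {G r₀ r₁ : Plane → ℝ} (h : IsKillingFrame U η₀ η₁ n X G r₀ r₁) {x : Plane} (hx : x ∈ U)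
    (a b : Plane) : η₀ x a * η₀ x b - η₁ x a * η₁ x b =
      dualN η₀ η₁ r₀ r₁ x a * dualN η₀ η₁ r₀ r₁ x b -
        G x ^ 2 * (dualX η₀ η₁ G r₀ r₁ x a * dualX η₀ η₁ G r₀ r₁ x b) := by
  have h2 := h.sq_sub_sq x hx
  have hG := (h.pos x hx).ne'
  simp [dualN, dualX]
  field_simp
  linear_combination (-(η₀ x a * η₀ x b - η₁ x a * η₁ x b)) * h2

/-- A unit vector orthogonal to X is ±n, so expressions even in the normal do not depend on its
choice. -/
theorem IsKillingFrame.sq_dualN_eq_one {U : Set Plane} {η₀ η₁ : OneForm Plane} {n X : Plane → Plane}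
    {G r₀ r₁ : Plane → ℝ} (h : IsKillingFrame U η₀ η₁ n X G r₀ r₁) {x : Plane} (hx : x ∈ U)
    {a : Plane} (h1 : η₀ x a * η₀ x a - η₁ x a * η₁ x a = 1)
    (h2 : η₀ x a * η₀ x (X x) - η₁ x a * η₁ x (X x) = 0) : dualN η₀ η₁ r₀ r₁ x a ^ 2 = 1 := by
  have hG := (h.pos x hx).ne'
  rw [h.sq_sub_sq_eq hx] at h1 h2
  rw [h.dualN_X hx, h.dualX_X hx] at h2
  have h3 : dualX η₀ η₁ G r₀ r₁ x a = 0 := by simpa [hG] using h2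
  rw [h3] at h1
  linear_combination h1

end Lorentz

/-! ### Metrics and vector fields in charts. -/

namespace LorentzianMetric

open Lorentz

variable {M : Type*} [TopologicalSpace M] [ChartedSpace Plane M] [IsManifold (𝓡 2) ∞ M]
  {g : LorentzianMetric M} {V : ∀ p : M, TangentSpace (𝓡 2) p}
  {φ : OpenPartialHomeomorph M Plane}

theorem mdifferentiable_of_mem_maximalAtlas {M : Type*} [TopologicalSpace M]
    [ChartedSpace Plane M] {φ : OpenPartialHomeomorph M Plane}
    (hφ : φ ∈ IsManifold.maximalAtlas (𝓡 2) ∞ M) :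
    φ.MDifferentiable (𝓡 2) (𝓡 2) :=
  ⟨(contMDiffOn_of_mem_maximalAtlas hφ).mdifferentiableOn (by simp),
    (contMDiffOn_symm_of_mem_maximalAtlas hφ).mdifferentiableOn (by simp)⟩

theorem inChart_symm (g : LorentzianMetric M) (φ : OpenPartialHomeomorph M Plane) (x a b : Plane) :
    g.inChart φ x a b = g.inChart φ x b a :=
  g.symm _ _ _

/-- The coordinate vector fields of a chart are smooth. -/
theorem contMDiffOn_mfderiv_symm (hφ : φ ∈ IsManifold.maximalAtlas (𝓡 2) ∞ M) (a : Plane) :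
    ContMDiffOn (𝓡 2) (𝓡 2).tangent ∞ (fun x => (Bundle.TotalSpace.mk' Plane (φ.symm x)
      (mfderiv (𝓡 2) (𝓡 2) φ.symm x a) : TangentBundle (𝓡 2) M)) φ.target := by
  have h1 := (contMDiffOn_symm_of_mem_maximalAtlas hφ).contMDiffOn_tangentMapWithin
    (m := ∞) (by simp) φ.open_target.uniqueMDiffOn
  have h2 : ContMDiffOn (𝓡 2) (𝓡 2).tangent ∞ (fun x => (Bundle.TotalSpace.mk' Plane x a :
      TangentBundle (𝓡 2) Plane)) φ.target :=
    contMDiffOn_vectorSpace_iff_contDiffOn.2 contDiffOn_const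
  refine (h1.comp h2 (fun x hx => hx)).congr fun x hx => ?_
  simp only [Function.comp, tangentMapWithin, mfderivWithin_of_isOpen φ.open_target hx]

theorem contDiffOn_inChart (g : LorentzianMetric M)
    (hφ : φ ∈ IsManifold.maximalAtlas (𝓡 2) ∞ M) : ContDiffOn ℝ ∞ (g.inChart φ) φ.target := by
  refine contDiffOn_clm_apply.2 fun a => contDiffOn_clm_apply.2 fun b => ?_
  rw [← contMDiffOn_iff_contDiffOn]
  intro x hx
  have h1 := contMDiffOn_mfderiv_symm hφ a x hx
  have h2 := contMDiffOn_mfderiv_symm hφ b x hx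
  have h3 := contMDiffOn_symm_of_mem_maximalAtlas hφ x hx
  have h4 : ContMDiffWithinAt (𝓡 2) ((𝓡 2).prod 𝓘(ℝ)) ∞
      (fun x => Bundle.TotalSpace.mk' ℝ (E := Bundle.Trivial M ℝ) (φ.symm x)
        (g.val (φ.symm x) (mfderiv (𝓡 2) (𝓡 2) φ.symm x a) (mfderiv (𝓡 2) (𝓡 2) φ.symm x b)))
      φ.target x := by
    apply ContMDiffWithinAt.clm_bundle_apply₂ (F₁ := Plane) (F₂ := Plane)
    · exact ContMDiffAt.comp_contMDiffWithinAt x g.contMDiff.contMDiffAt h3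
    · exact h1
    · exact h2
  simp only [Bundle.contMDiffWithinAt_totalSpace] at h4
  exact h4.2

theorem contDiffOn_fieldInChart (hφ : φ ∈ IsManifold.maximalAtlas (𝓡 2) ∞ M)
    (hV : ContMDiff (𝓡 2) (𝓡 2).tangent ∞
      (fun p => (Bundle.TotalSpace.mk' Plane p (V p) : TangentBundle (𝓡 2) M))) :
    ContDiffOn ℝ ∞ (fieldInChart V φ) φ.target := by
  have h1 := (contMDiffOn_of_mem_maximalAtlas hφ).contMDiffOn_tangentMapWithin
    (m := ∞) (by simp) φ.open_source.uniqueMDiffOn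
  have h2 := hV.comp_contMDiffOn (contMDiffOn_symm_of_mem_maximalAtlas hφ)
  have h3 := h1.comp h2 (fun x hx => φ.map_target hx)
  refine (contMDiffOn_vectorSpace_iff_contDiffOn (V := fieldInChart V φ)).1
    (h3.congr fun x hx => ?_)
  simp only [Function.comp, tangentMapWithin,
    mfderivWithin_of_isOpen φ.open_source (φ.map_target hx)]
  -- `φ (φ.symm x)` equals `x` only propositionally; with the base point generalised, the equality
  -- can be substituted.
  have h4 : ∀ y, y = x → ∀ v : Plane, (⟨x, v⟩ : TangentBundle (𝓡 2) Plane) = ⟨y, v⟩ := by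
    rintro y rfl v
    rfl
  exact h4 _ (φ.right_inv hx) _

theorem inChart_mfderiv (hφ : φ ∈ IsManifold.maximalAtlas (𝓡 2) ∞ M) {p : M} (hp : p ∈ φ.source)
    (v w : TangentSpace (𝓡 2) p) :
    g.inChart φ (φ p) (mfderiv (𝓡 2) (𝓡 2) φ p v) (mfderiv (𝓡 2) (𝓡 2) φ p w) = g.val p v w := by
  have h (u : TangentSpace (𝓡 2) p) :
      mfderiv (𝓡 2) (𝓡 2) φ.symm (φ p) (mfderiv (𝓡 2) (𝓡 2) φ p u) = u :=
    DFunLike.congr_fun ((mdifferentiable_of_mem_maximalAtlas hφ).symm_comp_deriv hp) u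
  have h' : ∀ q : M, p = q → ∀ v' w' : Plane, (g.val q : Plane →L[ℝ] Plane →L[ℝ] ℝ) v' w' =
      (g.val p : Plane →L[ℝ] Plane →L[ℝ] ℝ) v' w' := by
    rintro q rfl v' w'
    rfl
  refine (h' _ (φ.left_inv hp).symm _ _).trans ?_
  exact congrArg₂ (fun a b : Plane => (g.val p : Plane →L[ℝ] Plane →L[ℝ] ℝ) a b) (h v) (h w)

theorem inChart_fieldInChart (hφ : φ ∈ IsManifold.maximalAtlas (𝓡 2) ∞ M) {x : Plane}
    (hx : x ∈ φ.target) :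
    g.inChart φ x (fieldInChart V φ x) (fieldInChart V φ x) =
      g.val (φ.symm x) (V (φ.symm x)) (V (φ.symm x)) := by
  have h := inChart_mfderiv (g := g) hφ (φ.map_target hx) (V (φ.symm x)) (V (φ.symm x))
  rwa [φ.right_inv hx] at h

theorem trans_mem_maximalAtlas (hφ : φ ∈ IsManifold.maximalAtlas (𝓡 2) ∞ M)
    {Φ : OpenPartialHomeomorph Plane Plane} (h : ContDiffOn ℝ ∞ Φ Φ.source)
    (h' : ContDiffOn ℝ ∞ Φ.symm Φ.target) :
    φ.trans Φ ∈ IsManifold.maximalAtlas (𝓡 2) ∞ M := by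
  refine (φ.trans Φ).mem_maximalAtlas_of_contMDiffOn ?_ ?_
  · exact (contMDiffOn_iff_contDiffOn.2 h).comp
      ((contMDiffOn_of_mem_maximalAtlas hφ).mono (by simp)) (by simp)
  · exact (contMDiffOn_symm_of_mem_maximalAtlas hφ).comp
      ((contMDiffOn_iff_contDiffOn.2 h').mono (by simp)) (by simp)

/-- The components of the metric after a change of coordinates. -/
theorem inChart_trans (hφ : φ ∈ IsManifold.maximalAtlas (𝓡 2) ∞ M)
    {Φ : OpenPartialHomeomorph Plane Plane} (h' : ContDiffOn ℝ ∞ Φ.symm Φ.target) {x : Plane}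
    (hx : x ∈ (φ.trans Φ).target) (a b : Plane) :
    g.inChart (φ.trans Φ) x a b =
      g.inChart φ (Φ.symm x) (fderiv ℝ Φ.symm x a) (fderiv ℝ Φ.symm x b) := by
  rw [OpenPartialHomeomorph.trans_target] at hx
  have h1 : MDifferentiableAt (𝓡 2) (𝓡 2) Φ.symm x :=
    (Lorentz.differentiableAt_of_contDiffOn Φ.open_target h' hx.1).mdifferentiableAt
  have h2 := (mdifferentiable_of_mem_maximalAtlas hφ).mdifferentiableAt_symm hx.2
  have h3 : mfderiv (𝓡 2) (𝓡 2) (φ.trans Φ).symm x =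
      (mfderiv (𝓡 2) (𝓡 2) φ.symm (Φ.symm x)).comp (mfderiv (𝓡 2) (𝓡 2) Φ.symm x) :=
    mfderiv_comp x h2 h1
  have h4 : mfderiv (𝓡 2) (𝓡 2) Φ.symm x = fderiv ℝ Φ.symm x := mfderiv_eq_fderiv
  simp only [inChart, h3, h4]
  rfl

end LorentzianMetric

/-! ### Integration of the differential equation and normal coordinates. -/

namespace Lorentz

open EDS Minkowski

variable {U : Set Plane} {η₀ η₁ τ : OneForm Plane} {K : Plane → ℝ} {n X : Plane → Plane}
  {G r₀ r₁ k : Plane → ℝ}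

namespace IsKillingFrame

theorem contDiffOn_dualX (h : IsKillingFrame U η₀ η₁ n X G r₀ r₁) (hC : IsCoframe U η₀ η₁ τ K) :
    ContDiffOn ℝ ∞ (dualX η₀ η₁ G r₀ r₁) U :=
  (h.smooth_G.inv fun x hx => (h.pos x hx).ne').smul
    ((h.smooth_r₀.smul hC.smooth_one).sub (h.smooth_r₁.smul hC.smooth_zero))

/-- The 1-form dual to a Killing field is closed. -/
theorem fderiv_dualX_comm (h : IsKillingFrame U η₀ η₁ n X G r₀ r₁) (hC : IsCoframe U η₀ η₁ τ K)
    (hU : IsOpen U) {x : Plane} (hx : x ∈ U) (a b : Plane) :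
    fderiv ℝ (dualX η₀ η₁ G r₀ r₁) x a b = fderiv ℝ (dualX η₀ η₁ G r₀ r₁) x b a := by
  have e := dForm_apply_fields (differentiableAt_of_contDiffOn hU (h.contDiffOn_dualX hC) hx)
    (differentiableAt_of_contDiffOn hU h.smooth_n hx)
    (differentiableAt_of_contDiffOn hU h.smooth_X hx) (h.commute x hx)
  rw [fderiv_congr_on hU (fun y hy => h.dualX_X hy) hx,
    fderiv_congr_on hU (fun y hy => h.dualX_n hy) hx] at e
  simp [dForm] at e
  have ha := h.eq_smul_add_smul hC hx a
  have hb := h.eq_smul_add_smul hC hx b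
  generalize dualN η₀ η₁ r₀ r₁ x a = a0, dualX η₀ η₁ G r₀ r₁ x a = a1,
    dualN η₀ η₁ r₀ r₁ x b = b0, dualX η₀ η₁ G r₀ r₁ x b = b1 at *
  subst ha hb
  simp
  linear_combination (a0 * b1 - a1 * b0) * e

theorem hasFDerivAt_G (h : IsKillingFrame U η₀ η₁ n X G r₀ r₁) (hC : IsCoframe U η₀ η₁ τ K)
    (hU : IsOpen U) {x : Plane} (hx : x ∈ U) :
    HasFDerivAt G (along n G x • dualN η₀ η₁ r₀ r₁ x) x :=
  h.hasFDerivAt_of_invariant hC hU h.smooth_G h.invariant_G hx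

/-- The Gauss equation G″ = -K G, together with invariance of G′ along X. -/
theorem hasFDerivAt_along (h : IsKillingFrame U η₀ η₁ n X G r₀ r₁) (hC : IsCoframe U η₀ η₁ τ K)
    (hU : IsOpen U) {x : Plane} (hx : x ∈ U) :
    HasFDerivAt (along n G) ((-K x * G x) • dualN η₀ η₁ r₀ r₁ x) x := by
  rw [← (h.gauss hC hU hx).2]
  exact h.hasFDerivAt_of_invariant hC hU (contDiffOn_fderiv_apply hU h.smooth_G h.smooth_n)
    (fun y hy => h.invariant_fderiv hU h.smooth_G h.invariant_G hy) hx

/-- First integrals of the differential equation for the curvature. -/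
theorem hasFDerivAt_first_integrals (h : IsKillingFrame U η₀ η₁ n X G r₀ r₁)
    (hC : IsCoframe U η₀ η₁ τ K) (hU : IsOpen U) (hk : ContDiffOn ℝ ∞ k U)
    (hkX : ∀ x ∈ U, fderiv ℝ k x (X x) = 0) (hk0 : ∀ x ∈ U, 0 < k x)
    (hkK : ∀ x ∈ U, K x = -k x ^ 2)
    (hode : ∀ x ∈ U, along n G x * along n k x = 2 * k x ^ 3 * G x) {x : Plane} (hx : x ∈ U) :
    HasFDerivAt (fun y => k y * (along n G y ^ 2)⁻¹) (0 : Plane →L[ℝ] ℝ) x ∧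
      HasFDerivAt (fun y => (along n G y ^ 2)⁻¹ * (1 + k y ^ 2 * (G y ^ 2 * (along n G y ^ 2)⁻¹)))
        (0 : Plane →L[ℝ] ℝ) x := by
  have hG := h.hasFDerivAt_G hC hU hx
  have hG1 := h.hasFDerivAt_along hC hU hx
  have hkd : HasFDerivAt k (along n k x • dualN η₀ η₁ r₀ r₁ x) x :=
    h.hasFDerivAt_of_invariant hC hU hk hkX hx
  have e := hode x hx
  have hGp := h.pos x hx
  have hkp := hk0 x hx
  -- The right side of the differential equation is positive, so G′ has no zeros and can be divided
  -- by.
  have hne : along n G x ≠ 0 := by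
    intro h0
    rw [h0, zero_mul] at e
    exact (by positivity : 2 * k x ^ 3 * G x ≠ 0) e.symm
  have hi := (hasDerivAt_inv (pow_ne_zero 2 hne)).comp_hasFDerivAt x (hG1.pow 2)
  rw [hkK x hx] at hi
  have e' : along n k x = 2 * k x ^ 3 * G x / along n G x := by
    rw [← e]
    field_simp
  rw [e'] at hkd
  constructor
  · refine (hkd.mul hi).congr_fderiv ?_
    ext a
    simp
    field_simp
    ring
  · refine (hi.mul (((hkd.pow 2).mul ((hG.pow 2).mul hi)).const_add 1)).congr_fderiv ?_
    ext a
    simp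
    field_simp
    ring

end IsKillingFrame

theorem exists_ball_eq_of_hasFDerivAt_zero {E : Type*} [NormedAddCommGroup E] [NormedSpace ℝ E]
    {q : E → ℝ} {x₀ : E} {r : ℝ} (h : ∀ x ∈ Metric.ball x₀ r, HasFDerivAt q (0 : E →L[ℝ] ℝ) x)
    {x : E} (hx : x ∈ Metric.ball x₀ r) : q x = q x₀ := by
  refine (convex_ball x₀ r).is_const_of_fderivWithin_eq_zero (𝕜 := ℝ) (f := q)
    (fun y hy => (h y hy).differentiableAt.differentiableWithinAt) (fun y hy => ?_) hx
    (Metric.mem_ball_self (Metric.pos_of_mem_ball hx))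
  rw [fderivWithin_of_isOpen Metric.isOpen_ball hy, (h y hy).fderiv]

/-- The inverse function theorem on an open set. -/
theorem exists_openPartialHomeomorph {E : Type*} [NormedAddCommGroup E] [NormedSpace ℝ E]
    [FiniteDimensional ℝ E] {F : E → E} {B : Set E} (hB : IsOpen B) (hF : ContDiffOn ℝ ∞ F B)
    (hi : ∀ y ∈ B, ∀ a, fderiv ℝ F y a = 0 → a = 0) {x₀ : E} (hx₀ : x₀ ∈ B) :
    ∃ Φ : OpenPartialHomeomorph E E, x₀ ∈ Φ.source ∧ Φ.source ⊆ B ∧ (∀ y, Φ y = F y) ∧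
      ContDiffOn ℝ ∞ Φ Φ.source ∧ ContDiffOn ℝ ∞ Φ.symm Φ.target := by
  have : CompleteSpace E := FiniteDimensional.complete ℝ E
  have hd : ∀ y ∈ B, ∃ L : E ≃L[ℝ] E, HasFDerivAt F (L : E →L[ℝ] E) y := by
    intro y hy
    have hinj : Function.Injective (fderiv ℝ F y).toLinearMap :=
      (injective_iff_map_eq_zero _).2 (hi y hy)
    refine ⟨(LinearEquiv.ofInjectiveEndo _ hinj).toContinuousLinearEquiv, ?_⟩
    convert (differentiableAt_of_contDiffOn hB hF hy).hasFDerivAt using 1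
    ext a
    rfl
  obtain ⟨L, hL⟩ := hd x₀ hx₀
  have hc : ∀ y ∈ B, ContDiffAt ℝ ∞ F y := fun y hy => hF.contDiffAt (hB.mem_nhds hy)
  let Φ := ((hc x₀ hx₀).toOpenPartialHomeomorph F hL (by simp)).restrOpen B hB
  have hΦ : ∀ y, Φ y = F y := fun y => rfl
  have hs : Φ.source ⊆ B := fun y hy => hy.2
  refine ⟨Φ, ⟨(hc x₀ hx₀).mem_toOpenPartialHomeomorph_source hL (by simp), hx₀⟩, hs, hΦ,
    hF.mono hs, fun y hy => ?_⟩
  obtain ⟨L', hL'⟩ := hd _ (hs (Φ.map_target hy))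
  exact (Φ.contDiffAt_symm hy hL' (hc _ (hs (Φ.map_target hy)))).contDiffWithinAt

/-- Coordinates in which the metric is in normal form. -/
theorem exists_normal_coordinates (h : IsKillingFrame U η₀ η₁ n X G r₀ r₁)
    (hC : IsCoframe U η₀ η₁ τ K) (hU : IsOpen U) (hk : ContDiffOn ℝ ∞ k U)
    (hkX : ∀ x ∈ U, fderiv ℝ k x (X x) = 0) (hk0 : ∀ x ∈ U, 0 < k x)
    (hkK : ∀ x ∈ U, K x = -k x ^ 2)
    (hode : ∀ x ∈ U, along n G x * along n k x = 2 * k x ^ 3 * G x) {x₀ : Plane} (hx₀ : x₀ ∈ U) :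
    ∃ c : ℝ, 0 < c ∧ ∃ Φ : OpenPartialHomeomorph Plane Plane, x₀ ∈ Φ.source ∧ Φ.source ⊆ U ∧
      ContDiffOn ℝ ∞ Φ Φ.source ∧ ContDiffOn ℝ ∞ Φ.symm Φ.target ∧ ∀ y ∈ Φ.source,
        0 < Φ y 0 ∧ Φ y 0 < Real.pi / 2 ∧ K y = -c⁻¹ * (Real.cos (Φ y 0))⁻¹ ^ 4 ∧
        (1 - K y * G y ^ 2 / along n G y ^ 2) ^ 2 / (-K y) = c ∧
        ∀ a b : Plane, η₀ y a * η₀ y b - η₁ y a * η₁ y b =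
          c * (Real.cos (Φ y 0) ^ 4 * (fderiv ℝ Φ y a 0 * fderiv ℝ Φ y b 0) -
            Real.sin (Φ y 0) ^ 2 * (fderiv ℝ Φ y a 1 * fderiv ℝ Φ y b 1)) := by
  have hne : ∀ x ∈ U, along n G x ≠ 0 := by
    intro x hx h0
    have e := hode x hx
    have hGp := h.pos x hx
    have hkp := hk0 x hx
    rw [h0, zero_mul] at e
    exact (by positivity : 2 * k x ^ 3 * G x ≠ 0) e.symm
  have hsG1 : ContDiffOn ℝ ∞ (along n G) U := contDiffOn_fderiv_apply hU h.smooth_G h.smooth_n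
  -- `s` is the sign of G′ near `x₀`; it makes the coordinate u positive.
  obtain ⟨s, hs2, hs⟩ : ∃ s : ℝ, s ^ 2 = 1 ∧ 0 < s * along n G x₀ := by
    rcases lt_or_gt_of_ne (hne x₀ hx₀) with h1 | h1
    · exact ⟨-1, by norm_num, by linarith⟩
    · exact ⟨1, by norm_num, by linarith⟩
  have hev : ∀ᶠ x in nhds x₀, x ∈ U ∧ 0 < s * along n G x :=
    Filter.Eventually.and (hU.mem_nhds hx₀) ((continuousAt_const.mul
      (hsG1.contDiffAt (hU.mem_nhds hx₀)).continuousAt).eventually (lt_mem_nhds hs))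
  obtain ⟨r, hr, hball⟩ := Metric.eventually_nhds_iff_ball.1 hev
  have hBo : IsOpen (Metric.ball x₀ r) := Metric.isOpen_ball
  have hBU : Metric.ball x₀ r ⊆ U := fun y hy => (hball y hy).1
  have hfi := fun y (hy : y ∈ Metric.ball x₀ r) =>
    h.hasFDerivAt_first_integrals hC hU hk hkX hk0 hkK hode (hBU hy)
  have ha := fun y hy => exists_ball_eq_of_hasFDerivAt_zero (x := y) (fun y hy => (hfi y hy).1) hy
  have hc := fun y hy => exists_ball_eq_of_hasFDerivAt_zero (x := y) (fun y hy => (hfi y hy).2) hy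
  have hGx := h.pos x₀ hx₀
  have hkx := hk0 x₀ hx₀
  have hnx := hne x₀ hx₀
  set A := k x₀ * (along n G x₀ ^ 2)⁻¹ with hA
  set C := (along n G x₀ ^ 2)⁻¹ * (1 + k x₀ ^ 2 * (G x₀ ^ 2 * (along n G x₀ ^ 2)⁻¹)) with hCdef
  have hApos : 0 < A := by positivity
  have hCpos : 0 < C := by positivity
  clear_value A C
  -- Poincaré lemma on the ball: a primitive of the closed form dual to X.
  obtain ⟨w, hw⟩ := (convex_ball x₀ r).exists_forall_hasFDerivAt_of_fderiv_symmetric hBo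
    (((h.contDiffOn_dualX hC).mono hBU).differentiableOn (by simp))
    (fun y hy a b => h.fderiv_dualX_comm hC hU (hBU hy) a b)
  -- With T = A s G G′ the first integrals say k = A G′² and 1 + T² = C G′². So u = arctan T has
  -- cos²u = 1/(C G′²), sin²u = A²G²/C and du = A s G′² times the form dual to n. The factor 1/√C
  -- normalises v.
  let F : Plane → Plane := fun y =>
    !₂[Real.arctan (A * s * (G y * along n G y)), (√C)⁻¹ * w y]
  have hws : ContDiffOn ℝ ∞ w (Metric.ball x₀ r) :=
    (contDiffOn_infty_iff_fderiv_of_isOpen hBo).2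
      ⟨fun y hy => (hw y hy).differentiableAt.differentiableWithinAt,
        ((h.contDiffOn_dualX hC).mono hBU).congr fun y hy => (hw y hy).fderiv⟩
  have hFs : ContDiffOn ℝ ∞ F (Metric.ball x₀ r) := by
    refine (contDiffOn_piLp 2).2 fun i => ?_
    fin_cases i
    · exact ((contDiffOn_const.mul (h.smooth_G.mul hsG1)).mono hBU).arctan
    · exact contDiffOn_const.mul hws
  have key : ∀ y ∈ Metric.ball x₀ r, k y = A * along n G y ^ 2 ∧
      1 + (A * s * (G y * along n G y)) ^ 2 = C * along n G y ^ 2 := by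
    intro y hy
    have h1 := ha y hy
    have h2 := hc y hy
    have h3 := hne y (hBU hy)
    have h4 : k y = A * along n G y ^ 2 := by
      rw [← h1]
      field_simp
    refine ⟨h4, ?_⟩
    rw [h4] at h2
    rw [← h2]
    field_simp
    rw [hs2]
    ring
  have hF' : ∀ y ∈ Metric.ball x₀ r, ∀ a,
      fderiv ℝ F y a 0 = A * s * along n G y ^ 2 * IsKillingFrame.dualN η₀ η₁ r₀ r₁ y a ∧
      fderiv ℝ F y a 1 = (√C)⁻¹ * IsKillingFrame.dualX η₀ η₁ G r₀ r₁ y a := by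
    intro y hy a
    obtain ⟨k1, k2⟩ := key y hy
    have h3 := hne y (hBU hy)
    have d0 := (((h.hasFDerivAt_G hC hU (hBU hy)).mul
      (h.hasFDerivAt_along hC hU (hBU hy))).const_mul (A * s)).arctan
    have d1 := (hw y hy).const_mul (√C)⁻¹
    have dF : DifferentiableAt ℝ F y := differentiableAt_of_contDiffOn hBo hFs hy
    have p (i : Fin 2) : HasFDerivAt (fun z => F z i)
        ((EuclideanSpace.proj i : Plane →L[ℝ] ℝ).comp (fderiv ℝ F y)) y :=
      (EuclideanSpace.proj i : Plane →L[ℝ] ℝ).hasFDerivAt.comp y dF.hasFDerivAt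
    have e0 := DFunLike.congr_fun ((p 0).unique d0) a
    have e1 := DFunLike.congr_fun ((p 1).unique d1) a
    refine ⟨?_, by simpa using e1⟩
    simp only [Pi.mul_apply] at e0
    rw [k2, hkK y (hBU hy), k1] at e0
    simp at e0
    rw [e0]
    field_simp
    linear_combination (s * IsKillingFrame.dualN η₀ η₁ r₀ r₁ y a) *
      (k2 - (A * (G y * along n G y)) ^ 2 * hs2)
  obtain ⟨Φ, hΦ0, hΦB, hΦF, hΦs, hΦs'⟩ := exists_openPartialHomeomorph hBo hFs (fun y hy a h0 => by
    obtain ⟨e0, e1⟩ := hF' y hy a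
    rw [h0] at e0 e1
    have h3 := hne y (hBU hy)
    have hs0 : s ≠ 0 := by
      rintro rfl
      norm_num at hs2
    have hC0 := (Real.sqrt_pos.2 hCpos).ne'
    have e0' : IsKillingFrame.dualN η₀ η₁ r₀ r₁ y a = 0 := by
      simpa [hApos.ne', hs0, h3] using e0.symm
    have e1' : IsKillingFrame.dualX η₀ η₁ G r₀ r₁ y a = 0 := by
      simpa [hC0] using e1.symm
    rw [h.eq_smul_add_smul hC (hBU hy) a, e0', e1']
    simp) (Metric.mem_ball_self hr)
  -- The constant is forced by c cos⁴u du² being the square of the form dual to n.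
  refine ⟨C ^ 2 / A ^ 2, by positivity, Φ, hΦ0, hΦB.trans hBU, hΦs, hΦs', fun y hy => ?_⟩
  have hyB := hΦB hy
  have hyU := hBU hyB
  obtain ⟨k1, k2⟩ := key y hyB
  have h3 := hne y hyU
  have h4 := h.pos y hyU
  have hΦF' : (Φ : Plane → Plane) = F := funext hΦF
  have hu : Φ y 0 = Real.arctan (A * s * (G y * along n G y)) := by rw [hΦF']; rfl
  have hcos := Real.cos_sq_arctan (A * s * (G y * along n G y))
  have hsin := Real.sin_sq_arctan (A * s * (G y * along n G y))
  rw [k2, ← hu] at hcos hsin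
  have hcos4 : Real.cos (Φ y 0) ^ 4 = (1 / (C * along n G y ^ 2)) ^ 2 := by
    rw [← hcos]
    ring
  refine ⟨?_, ?_, ?_, ?_, fun a b => ?_⟩
  · rw [hu, Real.arctan_pos]
    have := (hball y hyB).2
    have : A * s * (G y * along n G y) = A * G y * (s * along n G y) := by ring
    rw [this]
    positivity
  · rw [hu]
    exact Real.arctan_lt_pi_div_two _
  · rw [inv_pow, hcos4, hkK y hyU, k1]
    field_simp
  · have k3 : C * along n G y ^ 2 = 1 + A ^ 2 * G y ^ 2 * along n G y ^ 2 := by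
      linear_combination (A * (G y * along n G y)) ^ 2 * hs2 - k2
    -- This and -K = A²G′⁴ express C²/A² through K, G and G′ alone, free of the choices made on the
    -- ball.
    have k4 : 1 - K y * G y ^ 2 / along n G y ^ 2 = C * along n G y ^ 2 := by
      rw [hkK y hyU, k1, k3]
      field_simp
      ring
    rw [k4, hkK y hyU, k1]
    field_simp
  · rw [h.sq_sub_sq_eq hyU, hsin, hcos4, hΦF', (hF' y hyB a).1, (hF' y hyB a).2, (hF' y hyB b).1,
      (hF' y hyB b).2]
    have hsq : (√C)⁻¹ * (√C)⁻¹ = C⁻¹ := by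
      rw [← mul_inv, Real.mul_self_sqrt hCpos.le]
    generalize IsKillingFrame.dualN η₀ η₁ r₀ r₁ y a = a0,
      IsKillingFrame.dualX η₀ η₁ G r₀ r₁ y a = a1,
      IsKillingFrame.dualN η₀ η₁ r₀ r₁ y b = b0, IsKillingFrame.dualX η₀ η₁ G r₀ r₁ y b = b1
    have e1 : (√C)⁻¹ * a1 * ((√C)⁻¹ * b1) = C⁻¹ * (a1 * b1) := by
      rw [← hsq]
      ring
    rw [e1]
    field_simp
    rw [hs2]
    ring

end Lorentz

/-! ### Normal form on the surface and invariance of the scale factor. -/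

namespace LorentzianMetric

open Lorentz

variable {M : Type*} [TopologicalSpace M] [ChartedSpace Plane M] [IsManifold (𝓡 2) ∞ M]
  {g : LorentzianMetric M} {V : ∀ p : M, TangentSpace (𝓡 2) p}
  {φ : OpenPartialHomeomorph M Plane}

theorem fieldInChart_apply {M : Type*} [TopologicalSpace M] [ChartedSpace Plane M]
    {V : ∀ p : M, TangentSpace (𝓡 2) p} {φ : OpenPartialHomeomorph M Plane} {p : M} (hp : p ∈
        φ.source) :
    fieldInChart V φ (φ p) = mfderiv (𝓡 2) (𝓡 2) φ p (V p) := by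
  have h : ∀ q : M, q = p → (mfderiv (𝓡 2) (𝓡 2) φ q (V q) : Plane) =
      (mfderiv (𝓡 2) (𝓡 2) φ p (V p) : Plane) := by
    rintro q rfl
    rfl
  exact h _ (φ.left_inv hp)

/-- Minus the square of the length of a vector field. -/
def negSq (g : LorentzianMetric M) (V : ∀ p : M, TangentSpace (𝓡 2) p) (p : M) : ℝ :=
  -g.val p (V p) (V p)

/-- The derivative of `negSq g V`. -/
def derivNegSq (g : LorentzianMetric M) (V : ∀ p : M, TangentSpace (𝓡 2) p) (p : M)
    (w : TangentSpace (𝓡 2) p) : ℝ :=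
  mfderiv (𝓡 2) 𝓘(ℝ) (negSq g V) p w

/-- The scale factor of the normal form of the metric in terms of the curvature `κ` and the norm of
the Killing field `V`, where `w` is a unit vector orthogonal to `V`. -/
def normalScale (g : LorentzianMetric M) (V : ∀ p : M, TangentSpace (𝓡 2) p) (p : M) (κ : ℝ)
    (w : TangentSpace (𝓡 2) p) : ℝ :=
  (1 - κ * (4 * negSq g V p ^ 2 / derivNegSq g V p w ^ 2)) ^ 2 / (-κ)

theorem derivNegSq_eq (hφ : φ ∈ IsManifold.maximalAtlas (𝓡 2) ∞ M) {p : M} (hp : p ∈ φ.source)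
    {G : Plane → ℝ} {L : Plane →L[ℝ] ℝ} {U : Set Plane} (hU : IsOpen U) (hpU : φ p ∈ U)
    (hG : ∀ x ∈ U, G x ^ 2 = -g.inChart φ x (fieldInChart V φ x) (fieldInChart V φ x))
    (hL : HasFDerivAt G L (φ p)) (w : TangentSpace (𝓡 2) p) :
    derivNegSq g V p w =
      2 * G (φ p) * L (mfderiv (𝓡 2) (𝓡 2) φ p w) := by
  have h1 : negSq g V =ᶠ[nhds p] (fun x => G x ^ 2) ∘ φ := by
    filter_upwards [φ.open_source.mem_nhds hp,
      (φ.continuousAt hp).preimage_mem_nhds (hU.mem_nhds hpU)] with q hq hqU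
    rw [Function.comp, hG _ hqU, fieldInChart_apply hq, inChart_mfderiv hφ hq, negSq]
  have h2 : HasMFDerivAt (𝓡 2) 𝓘(ℝ) (fun x : Plane => G x ^ 2) (φ p) _ := (hL.pow 2).hasMFDerivAt
  have h3 := ((mdifferentiable_of_mem_maximalAtlas hφ).mdifferentiableAt hp).hasMFDerivAt
  rw [derivNegSq, h1.mfderiv_eq, (h2.comp p h3).mfderiv]
  change (2 • G (φ p) ^ (2 - 1) : ℝ) * L (mfderiv (𝓡 2) (𝓡 2) φ p w) = _
  simp

/-- The normal form of the metric near a point. -/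
theorem exists_normalForm (hhyp : g.IsHyperbolic) (hdi : g.IsDarbouxIntegrable)
    (hV : g.IsKillingField V) (hspace : ∀ p, g.val p (V p) (V p) < 0) (p : M) :
    (∃ w : TangentSpace (𝓡 2) p, g.val p w w = 1 ∧ g.val p w (V p) = 0) ∧
    ∃ c : ℝ, 0 < c ∧
      (∃ φ ∈ IsManifold.maximalAtlas (𝓡 2) ∞ M, p ∈ φ.source ∧ ∀ x ∈ φ.target,
        0 < x 0 ∧ x 0 < Real.pi / 2 ∧
        (∀ a b : Plane, g.inChart φ x a b =
          c * (Real.cos (x 0) ^ 4 * (a 0 * b 0) - Real.sin (x 0) ^ 2 * (a 1 * b 1))) ∧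
        g.HasGaussCurvatureAt (φ.symm x) (-c⁻¹ * ((Real.cos (x 0))⁻¹) ^ 4)) ∧
      ∀ᶠ q in nhds p, ∀ κ, g.HasGaussCurvatureAt q κ → ∀ w : TangentSpace (𝓡 2) q,
        g.val q w w = 1 → g.val q w (V q) = 0 → normalScale g V q κ w = c := by
  obtain ⟨φ, hφ, hp, U, f, hU, hpU, hUt, hf, hDI⟩ := hdi p
  have hγ : ContDiffOn ℝ ∞ (g.inChart φ) U := (contDiffOn_inChart g hφ).mono hUt
  have hs : ∀ x ∈ U, ∀ a b, g.inChart φ x a b = g.inChart φ x b a := fun x _ => inChart_symm g φ x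
  have hXs := (contDiffOn_fieldInChart hφ hV.contMDiff).mono hUt
  have hXX : ∀ x ∈ U, g.inChart φ x (fieldInChart V φ x) (fieldInChart V φ x) < 0 := fun x hx => by
    rw [inChart_fieldInChart hφ (hUt hx)]
    exact hspace _
  have hC := hf.isCoframe hU hγ hs
  have h := hf.isKillingFrame hU hγ hs hXs hXX
    (fun x hx => hV.lieDeriv_eq_zero φ hφ x (hUt hx))
  have hcurv : ∀ x ∈ U, ∀ κ, g.HasGaussCurvatureAt (φ.symm x) κ →
      frameCurvature (g.inChart φ) f x = κ := fun x hx κ hκ => by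
    have := hκ φ hφ (φ.map_target (hUt hx)) U f hU (by rwa [φ.right_inv (hUt hx)]) hUt hf
    rwa [φ.right_inv (hUt hx)] at this
  have hKs := hf.contDiffOn_frameCurvature hU hγ
  have hneg : ∀ x ∈ U, frameCurvature (g.inChart φ) f x < 0 := fun x hx => by
    obtain ⟨κ, hκ, hκ'⟩ := hhyp (φ.symm x)
    rwa [hcurv x hx κ hκ']
  have hk : ContDiffOn ℝ ∞ (fun x => √(-frameCurvature (g.inChart φ) f x)) U :=
    hKs.neg.sqrt fun x hx => (neg_pos.2 (hneg x hx)).ne'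
  have hk0 : ∀ x ∈ U, 0 < √(-frameCurvature (g.inChart φ) f x) := fun x hx =>
    Real.sqrt_pos.2 (neg_pos.2 (hneg x hx))
  have hkK : ∀ x ∈ U, frameCurvature (g.inChart φ) f x =
      -√(-frameCurvature (g.inChart φ) f x) ^ 2 := fun x hx => by
    rw [Real.sq_sqrt (neg_pos.2 (hneg x hx)).le, neg_neg]
  have hkX : ∀ x ∈ U, fderiv ℝ (fun x => √(-frameCurvature (g.inChart φ) f x)) x
      (fieldInChart V φ x) = 0 := fun x hx => by
    have h1 := h.invariant_K hC hU hKs hx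
    rw [fderiv_congr_on hU hkK hx, fderiv_fun_neg,
      fderiv_fun_pow 2 (differentiableAt_of_contDiffOn hU hk hx)] at h1
    simpa [(hk0 x hx).ne'] using h1
  have hode := fun x (hx : x ∈ U) => along_mul_along_of_isDarbouxIntegrable hC hU h hk hkX
    (fun x hx => (hk0 x hx).ne') hkK hDI hx
  obtain ⟨c, hc, Φ, hΦp, hΦU, hΦs, hΦs', hΦ⟩ :=
    exists_normal_coordinates h hC hU hk hkX hk0 hkK hode hpU
  refine ⟨?_, c, hc, ⟨φ.trans Φ, trans_mem_maximalAtlas hφ hΦs hΦs', ⟨hp, hΦp⟩, fun x hx => ?_⟩, ?_⟩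
  · obtain ⟨w, hw⟩ := (mdifferentiable_of_mem_maximalAtlas hφ).mfderiv_surjective hp
      (unitNormal (g.inChart φ) f (fieldInChart V φ) (φ p))
    refine ⟨w, ?_, ?_⟩
    · rw [← inChart_mfderiv hφ hp, hw, hf.metric_eq hs hpU, h.sq_sub_sq_eq hpU]
      simp [h.dualN_n hpU, h.dualX_n hpU]
    · rw [← inChart_mfderiv hφ hp, hw, ← fieldInChart_apply hp, hf.metric_eq hs hpU,
        h.sq_sub_sq_eq hpU]
      simp [h.dualN_X hpU, h.dualX_n hpU]
  · have hx' := hx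
    rw [OpenPartialHomeomorph.trans_target] at hx'
    have hy := Φ.map_target hx'.1
    obtain ⟨h1, h2, h3, -, h4⟩ := hΦ _ hy
    rw [Φ.right_inv hx'.1] at h1 h2 h3 h4
    refine ⟨h1, h2, fun a b => ?_, ?_⟩
    · have hinv : ∀ v, fderiv ℝ Φ (Φ.symm x) (fderiv ℝ Φ.symm x v) = v := by
        intro v
        have d1 := (differentiableAt_of_contDiffOn Φ.open_source hΦs hy).hasFDerivAt
        have d2 := (differentiableAt_of_contDiffOn Φ.open_target hΦs' hx'.1).hasFDerivAt
        have d3 := (d1.comp x d2).congr_of_eventuallyEq (f₁ := id)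
          (Filter.eventuallyEq_of_mem (Φ.open_target.mem_nhds hx'.1)
            fun z hz => (Φ.right_inv hz).symm)
        exact DFunLike.congr_fun (d3.unique (hasFDerivAt_id x)) v
      rw [inChart_trans hφ hΦs' hx, hf.metric_eq hs (hΦU hy), h4, hinv, hinv]
    · obtain ⟨κ, -, hκ⟩ := hhyp ((φ.trans Φ).symm x)
      rwa [← h3, hcurv _ (hΦU hy) κ hκ]
  · filter_upwards [φ.open_source.mem_nhds hp,
      (φ.continuousAt hp).preimage_mem_nhds (Φ.open_source.mem_nhds hΦp)] with q hq hqΦ κ hκ w hw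
          hwV
    have hqU : φ q ∈ U := hΦU hqΦ
    obtain ⟨-, -, -, h4, -⟩ := hΦ _ hqΦ
    rw [hcurv _ hqU κ (by rwa [φ.left_inv hq])] at h4
    have hG : ∀ x ∈ U, spaceNorm (g.inChart φ) (fieldInChart V φ) x ^ 2 =
        -g.inChart φ x (fieldInChart V φ x) (fieldInChart V φ x) := fun x hx =>
      Real.sq_sqrt (neg_pos.2 (hXX x hx)).le
    have hpos := h.pos _ hqU
    have e1 := derivNegSq_eq hφ hq hU hqU hG (h.hasFDerivAt_G hC hU hqU) w
    have e2 : negSq g V q = spaceNorm (g.inChart φ) (fieldInChart V φ) (φ q) ^ 2 := by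
      rw [hG _ hqU, fieldInChart_apply hq, inChart_mfderiv hφ hq, negSq]
    rw [← inChart_mfderiv hφ hq] at hw hwV
    rw [← fieldInChart_apply hq] at hwV
    rw [normalScale, e1, e2, ← h4]
    generalize (mfderiv (𝓡 2) (𝓡 2) φ q w : Plane) = a at hw hwV ⊢
    have hw' := h.sq_dualN_eq_one hqU ((hf.metric_eq hs hqU a a).symm.trans hw)
      ((hf.metric_eq hs hqU a _).symm.trans hwV)
    congr 3
    -- With `s` = G, `d` = G′ and `a` = ±1: 4 (G²)² / (±2 G G′)² = G²/G′², which turns `normalScale`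
    -- into the expression for c found in coordinates.
    have hw1 : ∀ d a s : ℝ, a ^ 2 = 1 → s ≠ 0 →
        4 * (s ^ 2) ^ 2 / (2 * s * (d * a)) ^ 2 = s ^ 2 / d ^ 2 := by
      intro d a s h1 h3
      rw [show (2 * s * (d * a)) ^ 2 = 4 * s ^ 2 * d ^ 2 * a ^ 2 by ring, h1]
      rcases eq_or_ne d 0 with rfl | hd
      · simp
      · field_simp
    exact (congrArg (κ * ·) (hw1 _ _ _ hw' hpos.ne')).trans (mul_div_assoc _ _ _).symm

end LorentzianMetric

end

theorem mainTheorem12 {M : Type*} [TopologicalSpace M] [ChartedSpace (EuclideanSpace ℝ (Fin 2)) M]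
    [IsManifold (𝓡 2) ∞ M] (g : LorentzianMetric M)
    (hhyp : g.IsHyperbolic) (hdi : g.IsDarbouxIntegrable)
    (V : ∀ p : M, TangentSpace (𝓡 2) p) (hV : g.IsKillingField V)
    (hspace : ∀ p, g.val p (V p) (V p) < 0) :
    ∃ c : M → ℝ, IsLocallyConstant c ∧ ∀ p, 0 < c p ∧
      ∃ φ ∈ IsManifold.maximalAtlas (𝓡 2) ∞ M, p ∈ φ.source ∧ ∀ x ∈ φ.target,
        0 < x 0 ∧ x 0 < Real.pi / 2 ∧
        (∀ a b : EuclideanSpace ℝ (Fin 2), g.inChart φ x a b =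
          c p * (Real.cos (x 0) ^ 4 * (a 0 * b 0) - Real.sin (x 0) ^ 2 * (a 1 * b 1))) ∧
        g.HasGaussCurvatureAt (φ.symm x) (-(c p)⁻¹ * ((Real.cos (x 0))⁻¹) ^ 4) := by
  have h := fun p => LorentzianMetric.exists_normalForm hhyp hdi hV hspace p
  choose w hw hwV using fun p => (h p).1
  choose c hc hφ hev using fun p => (h p).2
  choose κ _ hκ using hhyp
  have hcN : ∀ p, LorentzianMetric.normalScale g V p (κ p) (w p) = c p := fun p =>
    (hev p).self_of_nhds _ (hκ p) _ (hw p) (hwV p)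
  refine ⟨c, (IsLocallyConstant.iff_eventually_eq c).2 fun p => ?_, fun p => ⟨hc p, hφ p⟩⟩
  -- Near p, the scale at q is c p by the normal form around p and c q by the normal form around q.
  filter_upwards [hev p] with q hq
  rw [← hcN q, hq _ (hκ q) _ (hw q) (hwV q)]
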